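/- **Theorem 3 (Mass conservation).** Let $J\subset\mathbb R$ be an open interval and let $(\gamma_{ab}(t),K_{ab}(t))$, $t\in J$, with lapse $\alpha>0$ and shift $N^a$, all smooth on $J\times\mathbb R^3$, be a vacuum solution of Einstein's equations in $3+1$ form: on each slice $\gamma$ is a Riemannian metric on $\mathbb R^3$ and $K$ a symmetric tensor with $$D_bK^{ab}-D^aK=0,\qquad {}^{(3)}R-K_{ab}K^{ab}+K^2=0,$$ and $$\dot\gamma_{ab}=-2\alpha K_{ab}+\mathcal L_N\gamma_{ab},\qquad \dot K_{ab}=\mathcal L_NK_{ab}-D_aD_b\alpha+\alpha\left({}^{(3)}R_{ab}+K\,K_{ab}-2K_{ac}K^c{}_b\right).$$ Write $f=o_\infty(r^k)$ if $\partial^\nu f=o(r^{k-|\nu|})$ as $r\to\infty$ for all spatial multi-indices $\nu$, uniformly for $t$ in compact subsets of $J$. Assume: * (axial symmetry) $\gamma$, $K$, $N$ are invariant under $\eta=x\partial_y-y\partial_x=\partial_\phi$. Put $\lambda^2=\gamma_{ab}\eta^a\eta^b$, $\omega'=\epsilon_{abc}\eta^aD^b\eta^c$, $q_{ab}=\gamma_{ab}-\eta_a\eta_b/\lambda^2$,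 $\chi_{ab}=q_a^cq_b^dK_{cd}$, and let $k_{ab}$ be the trace-free part of $\chi_{ab}$ with respect to $q_{ab}$; * (asymptotic flatness) in the Cartesian coordinates $(x,y,z)$ associated with $(\rho,z,\phi)$, $\gamma_{\mu\nu}-\delta_{\mu\nu}=o_\infty(r^{-1/2})$ and $K_{\mu\nu}=o_\infty(r^{-3/2})$; * (maximal-isothermal gauge) on every slice $K=\gamma^{ab}K_{ab}=0$, and for $\rho>0$ one has $q=e^{2u}(d\rho^2+dz^2)$ and $\lambda=\rho e^{\sigma/2}$; the lapse satisfies $\Delta_\gamma\alpha=\alpha K^{ab}K_{ab}$ with $\alpha-1=o_\infty(r^{-1/2})$; the components $\beta=(N^\rho,N^z)$ of the shift satisfy $D_a\beta_b+D_b\beta_a-q_{ab}D_c\beta^c=2\alpha k_{ab}$ ($D$ here being the connection of $q$) and, as functions on the $(\rho,z)$-plane extended to $\rho<0$ by parity ($\beta^\rho$ odd, $\beta^z$ even), $\beta=o_\infty(r^{-1/2})$. Let $$m(t)=\frac1{16}\int_{-\infty}^\infty dz\int_0^\infty\left[(\partial_\rho\sigma)^2+(\partial_z\sigma)^2+\frac{e^{2u}\omega'^2}{\lambda^4}+2e^{2u}K^{ab}K_{ab}\right]\rho\,d\rho\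 \in[0,\infty].$$ Then $m(t)$ is the same for all $t\in J$, and if it is finite, then $$\frac{dm(t)}{dt}=0\quad\text{for all }t\in J.$$ -/

import Mathlib

open scoped ContDiff

noncomputable section

namespace AxiMass

/-- Euclidean coordinate space. For `n = 3` the coordinates are `(x, y, z)`, for `n = 2` they are
`(ρ, z)`. -/
abbrev E (n : ℕ) : Type := EuclideanSpace ℝ (Fin n)

/-- Covariant 2-tensors in coordinates. -/
abbrev Mat (n : ℕ) : Type := Matrix (Fin n) (Fin n) ℝ

/-! ### Tensor calculus in coordinates -/

/-- The partial derivative `∂ᵢ f`. -/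
def pd {n : ℕ} (i : Fin n) (f : E n → ℝ) (x : E n) : ℝ :=
  fderiv ℝ f x (EuclideanSpace.single i 1)

/-- Lie derivative of a function, `X^k ∂ₖ f`. -/
def lieFun {n : ℕ} (X : E n → E n) (f : E n → ℝ) (x : E n) : ℝ :=
  ∑ k, X x k * pd k f x

/-- Lie derivative of a vector field, `X^k ∂ₖ Y^i - Y^k ∂ₖ X^i`. -/
def lieVec {n : ℕ} (X Y : E n → E n) (x : E n) (i : Fin n) : ℝ :=
  lieFun X (fun y => Y y i) x - lieFun Y (fun y => X y i) x

/-- Lie derivative of a covariant 2-tensor,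
`X^k ∂ₖ T_{ij} + T_{kj} ∂ᵢ X^k + T_{ik} ∂ⱼ X^k`. -/
def lieTensor {n : ℕ} (X : E n → E n) (T : E n → Mat n) (x : E n) : Mat n :=
  Matrix.of fun i j =>
    lieFun X (fun y => T y i j) x
      + ∑ k, (T x k j * pd i (fun y => X y k) x + T x i k * pd j (fun y => X y k) x)

/-- Christoffel symbols `Γ^k_{ij}` of the metric `g`. -/
def christoffel {n : ℕ} (g : E n → Mat n) (k i j : Fin n) (x : E n) : ℝ :=
  (1 / 2) * ∑ l, (g x)⁻¹ k l *
    (pd i (fun y => g y j l) x + pd j (fun y => g y i l) x - pd l (fun y => g y i j) x)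

/-- Ricci tensor
`R_{ij} = ∂ₖ Γ^k_{ij} - ∂ⱼ Γ^k_{ik} + Γ^k_{kl} Γ^l_{ij} - Γ^k_{jl} Γ^l_{ik}`. -/
def ricci {n : ℕ} (g : E n → Mat n) (x : E n) : Mat n :=
  Matrix.of fun i j =>
    ∑ k, (pd k (christoffel g k i j) x - pd j (christoffel g k i k) x
      + ∑ l, (christoffel g k k l x * christoffel g l i j x
        - christoffel g k j l x * christoffel g l i k x))

/-- Trace `g^{ij} T_{ij}`. -/
def trace {n : ℕ} (g T : Mat n) : ℝ := ∑ i, ∑ j, g⁻¹ i j * T i j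

/-- Square `g^{ik} g^{jl} T_{ij} T_{kl}`. -/
def normSq {n : ℕ} (g T : Mat n) : ℝ :=
  ∑ i, ∑ j, ∑ k, ∑ l, g⁻¹ i k * g⁻¹ j l * T i j * T k l

/-- Trace free part of `T` in dimension two, `T_{ij} - (1/2) g_{ij} g^{kl} T_{kl}`. -/
def traceFree (g T : Mat 2) : Mat 2 := T - (trace g T / 2) • g

/-- Scalar curvature. -/
def scalarCurvature {n : ℕ} (g : E n → Mat n) (x : E n) : ℝ := trace (g x) (ricci g x)

/-- Covariant derivative `D_k T_{ij}`. -/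
def covTensor {n : ℕ} (g T : E n → Mat n) (k i j : Fin n) (x : E n) : ℝ :=
  pd k (fun y => T y i j) x
    - ∑ l, (christoffel g l k i x * T x l j + christoffel g l k j x * T x i l)

/-- Hessian `D_i D_j f`. -/
def hessian {n : ℕ} (g : E n → Mat n) (f : E n → ℝ) (x : E n) : Mat n :=
  Matrix.of fun i j => pd i (pd j f) x - ∑ k, christoffel g k i j x * pd k f x

/-- Laplacian `Δ_g f`. -/
def laplacian {n : ℕ} (g : E n → Mat n) (f : E n → ℝ) (x : E n) : ℝ :=
  trace (g x) (hessian g f x)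

/-- The vacuum constraint equations `D_b K^{ab} - D^a K = 0` (with the free index lowered) and
`R - K_{ab} K^{ab} + K² = 0`. -/
def VacuumConstraints (g K : E 3 → Mat 3) : Prop :=
  (∀ x a, (∑ b, ∑ c, (g x)⁻¹ b c * covTensor g K c a b x)
      - pd a (fun y => trace (g y) (K y)) x = 0) ∧
  (∀ x, scalarCurvature g x - normSq (g x) (K x) + trace (g x) (K x) ^ 2 = 0)

/-! ### Axial symmetry and the quotient by the rotations -/

/-- The axial vector field `η = x ∂_y - y ∂_x = ∂/∂φ`. -/
def eta (x : E 3) : E 3 := !₂[-x 1, x 0, 0]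

/-- The covector `η_a = g_{ab} η^b`. -/
def etaLow (g : E 3 → Mat 3) (x : E 3) (a : Fin 3) : ℝ := ∑ b, g x a b * eta x b

/-- `λ² = g_{ab} η^a η^b`. -/
def normEtaSq (g : E 3 → Mat 3) (x : E 3) : ℝ := ∑ a, ∑ b, g x a b * eta x a * eta x b

/-- The twist scalar `ω' = ε_{abc} η^a D^b η^c = ε^{abc} η_a D_b η_c`, where
`ε^{abc} = (det g)^{-1/2} [abc]`. -/
def twist (g : E 3 → Mat 3) (x : E 3) : ℝ :=
  (Real.sqrt (g x).det)⁻¹ * ∑ s : Equiv.Perm (Fin 3), ((Equiv.Perm.sign s : ℤ) : ℝ) *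
    (etaLow g x (s 0) *
      (pd (s 1) (fun y => etaLow g y (s 2)) x
        - ∑ k, christoffel g k (s 1) (s 2) x * etaLow g x k))

/-- The quotient metric `q_{ab} = g_{ab} - η_a η_b / λ²` (off the axis). -/
def quotientMetric (g : E 3 → Mat 3) (x : E 3) : Mat 3 :=
  Matrix.of fun a b => g x a b - etaLow g x a * etaLow g x b / normEtaSq g x

/-- The projector `q_a^c = δ_a^c - η_a η^c / λ²` (off the axis). -/
def projector (g : E 3 → Mat 3) (x : E 3) (a c : Fin 3) : ℝ :=
  (if a = c then 1 else 0) - etaLow g x a * eta x c / normEtaSq g x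

/-- The extrinsic curvature `χ_{ab} = q_a^c q_b^d K_{cd}` of the reduced slice. -/
def reducedCurvature (g K : E 3 → Mat 3) (x : E 3) : Mat 3 :=
  Matrix.of fun a b => ∑ c, ∑ d, projector g x a c * projector g x b d * K x c d

/-- The meridian plane `y = 0`, with coordinates `(ρ, z)`. The half `0 < ρ` represents the
quotient by the rotations; there `∂_ρ = ∂_x`, and negative `ρ` gives the extension
by parity of the functions of `(ρ, z)`. -/
def meridian (p : E 2) : E 3 := !₂[p 0, 0, p 1]

/-- The `(ρ, z)` components of a tensor on the meridian plane. -/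
def onMeridian (T : E 3 → Mat 3) (p : E 2) : Mat 2 :=
  (T (meridian p)).submatrix ![0, 2] ![0, 2]

/-- The components `(β^ρ, β^z)` of a vector field on the meridian plane. -/
def vecOnMeridian (N : E 3 → E 3) (p : E 2) : E 2 := !₂[N (meridian p) 0, N (meridian p) 2]

/-! ### Fall off at infinity -/

/-- `f = o_∞(r^k)`: for every order `m` the derivatives of order `m` of `f t` are `o(r^{k-m})` as
`r → ∞`, uniformly for `t` in compact subsets of `J`. Only derivatives in space are meant. -/
def LittleOInfty {n : ℕ} (J : Set ℝ) (f : ℝ → E n → ℝ) (k : ℝ) : Prop :=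
  ∀ (m : ℕ) (C : Set ℝ), C ⊆ J → IsCompact C → ∀ ε : ℝ, 0 < ε → ∃ R : ℝ, 0 < R ∧
    ∀ t ∈ C, ∀ x : E n, R ≤ ‖x‖ → ‖iteratedFDeriv ℝ m (f t) x‖ ≤ ε * ‖x‖ ^ (k - m)

/-! ### Evolutions in the maximal-isothermal gauge -/

/-- An axially symmetric, asymptotically flat solution of the vacuum Einstein equations on
`J × ℝ³`, in `3+1` form and in the maximal-isothermal gauge. -/
structure MaximalIsothermalEvolution (J : Set ℝ) where
  /-- the induced metric `γ_{ab}` of the slices -/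
  γ : ℝ → E 3 → Mat 3
  /-- the second fundamental form `K_{ab}` of the slices -/
  K : ℝ → E 3 → Mat 3
  /-- the lapse -/
  lapse : ℝ → E 3 → ℝ
  /-- the shift, as a vector field on `ℝ³` -/
  shift : ℝ → E 3 → E 3
  /-- the logarithm of the conformal factor of the quotient metric, used for `0 < ρ` -/
  u : ℝ → E 2 → ℝ
  /-- the function `σ` of `λ = ρ e^{σ/2}`, used for `0 < ρ` -/
  σ : ℝ → E 2 → ℝ
  smooth_γ : ∀ i j, ContDiffOn ℝ ∞ (fun p : ℝ × E 3 => γ p.1 p.2 i j) (J ×ˢ Set.univ)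
  smooth_K : ∀ i j, ContDiffOn ℝ ∞ (fun p : ℝ × E 3 => K p.1 p.2 i j) (J ×ˢ Set.univ)
  smooth_lapse : ContDiffOn ℝ ∞ (fun p : ℝ × E 3 => lapse p.1 p.2) (J ×ˢ Set.univ)
  smooth_shift : ContDiffOn ℝ ∞ (fun p : ℝ × E 3 => shift p.1 p.2) (J ×ˢ Set.univ)
  posDef_γ : ∀ t ∈ J, ∀ x, (γ t x).PosDef
  symm_K : ∀ t ∈ J, ∀ x, (K t x).IsSymm
  lapse_pos : ∀ t ∈ J, ∀ x, 0 < lapse t x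
  /- vacuum Einstein equations -/
  constraints : ∀ t ∈ J, VacuumConstraints (γ t) (K t)
  evolution_γ : ∀ t ∈ J, ∀ x i j, HasDerivAt (fun s => γ s x i j)
    (-2 * lapse t x * K t x i j + lieTensor (shift t) (γ t) x i j) t
  evolution_K : ∀ t ∈ J, ∀ x i j, HasDerivAt (fun s => K s x i j)
    (lieTensor (shift t) (K t) x i j - hessian (γ t) (lapse t) x i j
      + lapse t x * (ricci (γ t) x i j + trace (γ t x) (K t x) * K t x i j
        - 2 * (K t x * (γ t x)⁻¹ * K t x) i j)) t
  /- axial symmetry -/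
  axial_γ : ∀ t ∈ J, ∀ x, lieTensor eta (γ t) x = 0
  axial_K : ∀ t ∈ J, ∀ x, lieTensor eta (K t) x = 0
  axial_shift : ∀ t ∈ J, ∀ x, lieVec eta (shift t) x = 0
  /- asymptotic flatness -/
  falloff_γ : ∀ i j, LittleOInfty J (fun t x => γ t x i j - if i = j then 1 else 0) (-1 / 2)
  falloff_K : ∀ i j, LittleOInfty J (fun t x => K t x i j) (-3 / 2)
  /- maximal slices, and the gauge equation for the lapse -/
  maximal : ∀ t ∈ J, ∀ x, trace (γ t x) (K t x) = 0
  lapse_eq : ∀ t ∈ J, ∀ x,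
    laplacian (γ t) (lapse t) x = lapse t x * normSq (γ t x) (K t x)
  falloff_lapse : LittleOInfty J (fun t x => lapse t x - 1) (-1 / 2)
  /- isothermal coordinates: `q = e^{2u} (dρ² + dz²)` and `λ = ρ e^{σ/2}` -/
  isothermal : ∀ t ∈ J, ∀ p : E 2, 0 < p 0 →
    onMeridian (quotientMetric (γ t)) p = Real.exp (2 * u t p) • (1 : Mat 2)
  norm_eta : ∀ t ∈ J, ∀ p : E 2, 0 < p 0 →
    Real.sqrt (normEtaSq (γ t) (meridian p)) = p 0 * Real.exp (σ t p / 2)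
  /- the gauge equation for the shift: the trace free part of `D_a β_b + D_b β_a`, that is of the
  Lie derivative of `q` along `β`, is `2 α k_{ab}` with `k` the trace free part of `χ` -/
  shift_eq : ∀ t ∈ J, ∀ p : E 2, 0 < p 0 →
    traceFree (onMeridian (quotientMetric (γ t)) p)
      (lieTensor (vecOnMeridian (shift t)) (onMeridian (quotientMetric (γ t))) p)
    = (2 * lapse t (meridian p)) •
      traceFree (onMeridian (quotientMetric (γ t)) p)
        (onMeridian (reducedCurvature (γ t) (K t)) p)
  falloff_shift : ∀ i, LittleOInfty J (fun t p => vecOnMeridian (shift t) p i) (-1 / 2)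

namespace MaximalIsothermalEvolution

variable {J : Set ℝ}

/-- The integrand `|∂σ|² + e^{2u} ω'² / λ⁴ + 2 e^{2u} K^{ab} K_{ab}` of the mass at a point
`(ρ, z)` with `0 < ρ`. -/
def massDensity (S : MaximalIsothermalEvolution J) (t : ℝ) (p : E 2) : ℝ :=
  (pd 0 (S.σ t) p ^ 2 + pd 1 (S.σ t) p ^ 2)
    + Real.exp (2 * S.u t p) * twist (S.γ t) (meridian p) ^ 2
        / normEtaSq (S.γ t) (meridian p) ^ 2
    + 2 * Real.exp (2 * S.u t p) * normSq (S.γ t (meridian p)) (S.K t (meridian p))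

/-- The mass `m(t) = (1/16) ∫ dz ∫_0^∞ massDensity ρ dρ`. The integrand is nonnegative, and the
integral is taken in `[0, ∞]`. -/
def mass (S : MaximalIsothermalEvolution J) (t : ℝ) : ENNReal :=
  (∫⁻ p in {p : E 2 | 0 < p 0}, ENNReal.ofReal (S.massDensity t p * p 0)) / 16

end MaximalIsothermalEvolution

end AxiMass

end

noncomputable section

namespace AxiMass

/-! ### Partial derivatives -/

section PartialDerivatives

variable {n : ℕ} {f g : E n → ℝ}

/-! The mass is a boundary term at infinity, and the boundary term changes too slowly in time to be
seen there.

Write `L = e^σ` and `Q = e^{2u}`, so that `λ² = ρ² L`. On the half plane `ρ > 0` the metric is `Q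
(dρ² + dz²) + L (dy + a dρ + b dz)²`, and its scalar curvature is computed explicitly
(`IsothermalSlice.scalarCurvature_meridian`). On a maximal slice the Hamiltonian constraint reads `R
= K^{ab} K_{ab}`. When this is inserted in the mass density, `|∂σ|²` and the twist term
(`IsothermalSlice.twist_sq_meridian`) cancel, and `ρ` times the density becomes linear in the
logarithms: `-2 ρ Δ(2u + σ) - 4 ∂_ρ σ`. This is the divergence of (`fluxRho`, `fluxZ`)
(`massDensity_mul_eq`). The flux is smooth across the axis, and its `ρ` component vanishes there
because `Q = L` on the axis (`eq_on_axis`). The density is nonnegative, so the mass is the limit in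
`[0, ∞]` of the fluxes through growing rectangles (`tendsto_boundaryFlux`).

For a single slice the flux density is only of order `r^{-1/2}` on a boundary of length of order
`r`, so the boundary integral may diverge. For two slices one compares the integrals. The evolution
equation of the metric gives the time derivatives of `σ` and `2u` (`hasDerivAt_logL_logQ`). They
have order `r^{-3/2}`, with gradients of order `r^{-5/2}`: `αK`, `∂β` and `β^ρ/ρ` have these orders,
the last because `β^ρ` vanishes on the axis (`LittleOInfty.isSymbol_div_coord`). After integration
in time (`IsSymbol.integrate_time`) the flux densities differ by `O(r^{-3/2})` and the boundary
integrals by `O(r^{-1/2})`. Hence the limits agree, whether finite or infinite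
(`eq_of_tendsto_ofReal`). -/

theorem _root_.ContDiff.pd (hf : ContDiff ℝ ∞ f) (i : Fin n) : ContDiff ℝ ∞ (pd i f) := by
  unfold AxiMass.pd
  exact (hf.fderiv_right (m := ∞) (by simp)).clm_apply contDiff_const

theorem _root_.ContDiff.differentiableAt_top (hf : ContDiff ℝ ∞ f) (x : E n) :
    DifferentiableAt ℝ f x :=
  (hf.differentiable (by simp)) x

theorem pd_congr {x : E n} (i : Fin n) (h : f =ᶠ[nhds x] g) : pd i f x = pd i g x := by
  unfold pd
  rw [h.fderiv_eq]

theorem pd_pd_congr {x : E n} (i j : Fin n) (h : f =ᶠ[nhds x] g) :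
    pd i (pd j f) x = pd i (pd j g) x := by
  apply pd_congr
  filter_upwards [h.eventually_nhds] with y hy using pd_congr j hy

theorem pd_const (i : Fin n) (c : ℝ) (x : E n) : pd i (fun _ => c) x = 0 := by
  simp [pd]

theorem pd_coord (i j : Fin n) (x : E n) : pd i (fun y => y j) x = if j = i then 1 else 0 := by
  have h : HasFDerivAt (fun y : E n => y j) (EuclideanSpace.proj j : E n →L[ℝ] ℝ) x :=
    (EuclideanSpace.proj j : E n →L[ℝ] ℝ).hasFDerivAt
  simp [pd, h.fderiv]

theorem pd_add {x : E n} (i : Fin n) (hf : DifferentiableAt ℝ f x) (hg : DifferentiableAt ℝ g x) :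
    pd i (fun y => f y + g y) x = pd i f x + pd i g x := by
  unfold pd
  rw [fderiv_fun_add hf hg]; rfl

theorem pd_sub {x : E n} (i : Fin n) (hf : DifferentiableAt ℝ f x) (hg : DifferentiableAt ℝ g x) :
    pd i (fun y => f y - g y) x = pd i f x - pd i g x := by
  unfold pd
  rw [fderiv_fun_sub hf hg]; rfl

theorem pd_neg {x : E n} (i : Fin n) : pd i (fun y => -f y) x = -pd i f x := by
  unfold pd
  rw [fderiv_fun_neg]; rfl

theorem pd_mul {x : E n} (i : Fin n) (hf : DifferentiableAt ℝ f x) (hg : DifferentiableAt ℝ g x) :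
    pd i (fun y => f y * g y) x = pd i f x * g x + f x * pd i g x := by
  unfold pd
  rw [fderiv_fun_mul hf hg]
  simp; ring

theorem pd_const_mul {x : E n} (i : Fin n) (c : ℝ) (hf : DifferentiableAt ℝ f x) :
    pd i (fun y => c * f y) x = c * pd i f x := by
  rw [pd_mul i (differentiableAt_const c) hf, pd_const]; ring

theorem pd_sum {ι : Type*} (s : Finset ι) {F : ι → E n → ℝ} {x : E n} (i : Fin n)
    (hF : ∀ k ∈ s, DifferentiableAt ℝ (F k) x) :
    pd i (fun y => ∑ k ∈ s, F k y) x = ∑ k ∈ s, pd i (F k) x := by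
  unfold pd
  rw [fderiv_fun_sum hF]; simp

theorem pd_log {x : E n} (i : Fin n) (hf : DifferentiableAt ℝ f x) (h0 : f x ≠ 0) :
    pd i (fun y => Real.log (f y)) x = pd i f x / f x := by
  unfold pd
  rw [(hf.hasFDerivAt.log h0).fderiv]
  simp; field_simp

theorem pd_div {x : E n} (i : Fin n) (hf : DifferentiableAt ℝ f x) (hg : DifferentiableAt ℝ g x)
    (h0 : g x ≠ 0) :
    pd i (fun y => f y / g y) x = (pd i f x * g x - f x * pd i g x) / g x ^ 2 := by
  have hinv : HasFDerivAt (fun y => (g y)⁻¹) (-(g x ^ 2)⁻¹ • fderiv ℝ g x) x :=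
    (hasDerivAt_inv h0).comp_hasFDerivAt x hg.hasFDerivAt
  simp only [div_eq_mul_inv (f _)]
  rw [pd_mul i hf hinv.differentiableAt]
  unfold pd
  rw [hinv.fderiv]
  simp; field_simp; ring

theorem pd_comm (hf : ContDiff ℝ ∞ f) (i j : Fin n) (x : E n) :
    pd i (pd j f) x = pd j (pd i f) x := by
  have hd : Differentiable ℝ (fderiv ℝ f) :=
    (hf.fderiv_right (m := ∞) (by simp)).differentiable (by simp)
  have key : ∀ a b : Fin n, pd a (pd b f) x
      = fderiv ℝ (fderiv ℝ f) x (EuclideanSpace.single a 1) (EuclideanSpace.single b 1) := by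
    intro a b
    unfold pd
    rw [fderiv_clm_apply (hd x) (differentiableAt_const _)]
    simp
  rw [key, key]
  exact (hf.contDiffAt.isSymmSndFDerivAt (by simpa using ENat.LEInfty.out)).eq _ _

/-- The embedding of the meridian plane as a linear isometry. -/
def meridianL : E 2 →ₗᵢ[ℝ] E 3 where
  toFun := meridian
  map_add' p q := by ext i; fin_cases i <;> simp [meridian]
  map_smul' c p := by ext i; fin_cases i <;> simp [meridian]
  norm_map' p := by
    simp [EuclideanSpace.norm_eq, Fin.sum_univ_three, meridian]

theorem contDiff_meridian : ContDiff ℝ ∞ meridian := meridianL.contDiff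

theorem norm_meridian (p : E 2) : ‖meridian p‖ = ‖p‖ := meridianL.norm_map p

theorem hasFDerivAt_meridian (p : E 2) :
    HasFDerivAt meridian meridianL.toContinuousLinearMap p :=
  meridianL.toContinuousLinearMap.hasFDerivAt

theorem pd_zero_comp_meridian {f : E 3 → ℝ} {p : E 2} (hf : DifferentiableAt ℝ f (meridian p)) :
    pd 0 (fun q => f (meridian q)) p = pd 0 f (meridian p) := by
  unfold pd
  have h := (hf.hasFDerivAt.comp p (hasFDerivAt_meridian p)).fderiv
  simp only [Function.comp_def] at h
  rw [h, ContinuousLinearMap.comp_apply]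
  congr 1
  ext i; fin_cases i <;> simp [meridianL, meridian]

theorem pd_one_comp_meridian {f : E 3 → ℝ} {p : E 2} (hf : DifferentiableAt ℝ f (meridian p)) :
    pd 1 (fun q => f (meridian q)) p = pd 2 f (meridian p) := by
  unfold pd
  have h := (hf.hasFDerivAt.comp p (hasFDerivAt_meridian p)).fderiv
  simp only [Function.comp_def] at h
  rw [h, ContinuousLinearMap.comp_apply]
  congr 1
  ext i; fin_cases i <;> simp [meridianL, meridian]

end PartialDerivatives

/-! ### The Ricci tensor in terms of the Christoffel symbols of the first kind -/

section Curvature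

variable {n : ℕ} {g : E n → Mat n}

/-- Christoffel symbols of the first kind `[ij, l]`. -/
def christoffelFirst (g : E n → Mat n) (i j l : Fin n) (x : E n) : ℝ :=
  (1 / 2) * (pd i (fun y => g y j l) x + pd j (fun y => g y i l) x - pd l (fun y => g y i j) x)

theorem christoffel_eq_sum (g : E n → Mat n) (k i j : Fin n) (x : E n) :
    christoffel g k i j x = ∑ l, (g x)⁻¹ k l * christoffelFirst g i j l x := by
  simp only [christoffel, christoffelFirst, Finset.mul_sum]
  exact Finset.sum_congr rfl fun l _ => by ring

theorem contDiff_christoffelFirst (hg : ∀ i j, ContDiff ℝ ∞ fun x => g x i j) (i j l : Fin n) :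
    ContDiff ℝ ∞ (christoffelFirst g i j l) := by
  unfold christoffelFirst
  exact contDiff_const.mul ((((hg j l).pd i).add ((hg i l).pd j)).sub ((hg i j).pd l))

theorem contDiff_det {M : E n → Mat n} (hg : ∀ i j, ContDiff ℝ ∞ fun x => M x i j) :
    ContDiff ℝ ∞ fun x => (M x).det := by
  simp only [Matrix.det_apply]
  refine ContDiff.sum fun s _ => ContDiff.const_smul _ (contDiff_prod fun i _ => hg _ _)

theorem contDiff_inv_apply (hg : ∀ i j, ContDiff ℝ ∞ fun x => g x i j)
    (hdet : ∀ x, (g x).det ≠ 0) (i j : Fin n) : ContDiff ℝ ∞ fun x => (g x)⁻¹ i j := by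
  have h : (fun x => (g x)⁻¹ i j) = fun x => ((g x).det)⁻¹ * (g x).adjugate i j := by
    funext x
    rw [Matrix.inv_def]; simp
  rw [h]
  refine ((contDiff_det hg).inv hdet).mul ?_
  simp only [Matrix.adjugate_apply]
  refine contDiff_det fun a b => ?_
  simp only [Matrix.updateRow_apply]
  split_ifs
  · exact contDiff_const
  · exact hg _ _

theorem contDiff_christoffel (hg : ∀ i j, ContDiff ℝ ∞ fun x => g x i j)
    (hdet : ∀ x, (g x).det ≠ 0) (k i j : Fin n) : ContDiff ℝ ∞ (christoffel g k i j) := by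
  have h : christoffel g k i j = fun x => ∑ l, (g x)⁻¹ k l * christoffelFirst g i j l x :=
    funext fun x => christoffel_eq_sum g k i j x
  rw [h]
  exact ContDiff.sum fun l _ =>
    (contDiff_inv_apply hg hdet k l).mul (contDiff_christoffelFirst hg i j l)

theorem sum_mul_christoffel (hdet : ∀ x, (g x).det ≠ 0) (b i j : Fin n) (x : E n) :
    ∑ k, g x b k * christoffel g k i j x = christoffelFirst g i j b x := by
  simp only [christoffel_eq_sum, Finset.mul_sum]
  rw [Finset.sum_comm]
  have h : ∀ l, ∑ k, g x b k * ((g x)⁻¹ k l * christoffelFirst g i j l x)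
      = (1 : Mat n) b l * christoffelFirst g i j l x := by
    intro l
    rw [← Matrix.mul_nonsing_inv (g x) (hdet x).isUnit, Matrix.mul_apply, Finset.sum_mul]
    exact Finset.sum_congr rfl fun k _ => by ring
  simp [h, Matrix.one_apply]

theorem pd_metric_eq (hsym : ∀ x i j, g x i j = g x j i) (k b l : Fin n) (x : E n) :
    pd k (fun y => g y b l) x = christoffelFirst g k b l x + christoffelFirst g k l b x := by
  have h : (fun y => g y l b) = fun y => g y b l := funext fun y => hsym y l b
  simp only [christoffelFirst, h]
  ring

/-- Differentiating the lowered identity `g_{bl} Γ^l_{ij} = [ij, b]` and solving for `∂Γ` avoids any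
derivative of the inverse metric. -/
theorem pd_christoffel (hg : ∀ i j, ContDiff ℝ ∞ fun x => g x i j)
    (hsym : ∀ x i j, g x i j = g x j i) (hdet : ∀ x, (g x).det ≠ 0) (m k i j : Fin n) (x : E n) :
    pd m (christoffel g k i j) x = ∑ b, (g x)⁻¹ k b * (pd m (christoffelFirst g i j b) x
      - ∑ l, (christoffelFirst g m b l x + christoffelFirst g m l b x) * christoffel g l i j x) :=
          by
  have hΓ := contDiff_christoffel hg hdet
  have h1 : ∀ b, ∑ l, g x b l * pd m (christoffel g l i j) x = pd m (christoffelFirst g i j b) x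
      - ∑ l, (christoffelFirst g m b l x + christoffelFirst g m l b x)
        * christoffel g l i j x := by
    intro b
    have h2 : christoffelFirst g i j b = fun y => ∑ l, g y b l * christoffel g l i j y :=
      funext fun y => (sum_mul_christoffel hdet b i j y).symm
    rw [h2, pd_sum _ _ fun l _ => ((hg b l).mul (hΓ l i j)).differentiableAt_top x,
      ← Finset.sum_sub_distrib]
    refine Finset.sum_congr rfl fun l _ => ?_
    rw [pd_mul _ ((hg b l).differentiableAt_top x) ((hΓ l i j).differentiableAt_top x),
      pd_metric_eq hsym]
    ring
  simp only [← h1, Finset.mul_sum]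
  rw [Finset.sum_comm]
  have h : ∀ l, ∑ b, (g x)⁻¹ k b * (g x b l * pd m (christoffel g l i j) x)
      = (1 : Mat n) k l * pd m (christoffel g l i j) x := by
    intro l
    rw [← Matrix.nonsing_inv_mul (g x) (hdet x).isUnit, Matrix.mul_apply, Finset.sum_mul]
    exact Finset.sum_congr rfl fun k _ => by ring
  simp [h, Matrix.one_apply]

/-- In this form the inverse metric enters only algebraically, so it can be diagonalized at a single
point by a frame with constant coefficients. -/
theorem ricci_eq (hg : ∀ i j, ContDiff ℝ ∞ fun x => g x i j)
    (hsym : ∀ x i j, g x i j = g x j i) (hdet : ∀ x, (g x).det ≠ 0) (i j : Fin n) (x : E n) :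
    ricci g x i j = ∑ k, ∑ b, (g x)⁻¹ k b *
      (pd k (christoffelFirst g i j b) x - pd j (christoffelFirst g i k b) x
        - ∑ l, ∑ c, (g x)⁻¹ l c *
          (christoffelFirst g k b l x * christoffelFirst g i j c x
            - christoffelFirst g j b l x * christoffelFirst g i k c x)) := by
  simp only [ricci, Matrix.of_apply]
  refine Finset.sum_congr rfl fun k _ => ?_
  rw [pd_christoffel hg hsym hdet, pd_christoffel hg hsym hdet]
  have h3 : ∀ m p q : Fin n,
      ∑ b, (g x)⁻¹ k b * ∑ l, christoffelFirst g m l b x * christoffel g l p q x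
        = ∑ l, christoffel g k m l x * christoffel g l p q x := by
    intro m p q
    simp only [Finset.mul_sum]
    rw [Finset.sum_comm]
    refine Finset.sum_congr rfl fun l _ => ?_
    rw [christoffel_eq_sum g k, Finset.sum_mul]
    exact Finset.sum_congr rfl fun b _ => by ring
  have h4 : ∀ m b p q : Fin n,
      ∑ l, ∑ c, (g x)⁻¹ l c * (christoffelFirst g m b l x * christoffelFirst g p q c x)
        = ∑ l, christoffelFirst g m b l x * christoffel g l p q x := by
    intro m b p q
    refine Finset.sum_congr rfl fun l _ => ?_
    rw [christoffel_eq_sum, Finset.mul_sum]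
    exact Finset.sum_congr rfl fun c _ => by ring
  simp only [add_mul, Finset.sum_add_distrib, mul_sub, Finset.sum_sub_distrib, mul_add, h3, h4]
  ring

end Curvature

/-! ### The scalar curvature in an orthogonal frame -/

section Frame

/-- Components of a tensor with three indices in the frame `P`. -/
def frame3 (P : Fin 3 → Fin 3 → ℝ) (c : Fin 3 → Fin 3 → Fin 3 → ℝ) (m n p : Fin 3) : ℝ :=
  ∑ i, ∑ j, P m i * P n j * ∑ l, P p l * c i j l

/-- Components of a tensor with four indices in the frame `P`. -/
def frame4 (P : Fin 3 → Fin 3 → ℝ) (c : Fin 3 → Fin 3 → Fin 3 → Fin 3 → ℝ) (m n p q : Fin 3) : ℝ :=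
  ∑ i, ∑ j, P m i * P n j * ∑ k, ∑ l, P p k * P q l * c i j k l

theorem sum_frame {H : Mat 3} {P : Fin 3 → Fin 3 → ℝ} {d : Fin 3 → ℝ}
    (hH : ∀ i j, H i j = ∑ m, d m * P m i * P m j) (T : Fin 3 → Fin 3 → ℝ) :
    ∑ i, ∑ j, H i j * T i j = ∑ m, d m * ∑ i, ∑ j, P m i * P m j * T i j := by
  simp only [hH, Fin.sum_univ_three]
  ring

theorem frame_quadratic (P : Fin 3 → Fin 3 → ℝ) (A B C D : Fin 3 → Fin 3 → ℝ) (m n : Fin 3) :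
    ∑ i, ∑ j, P m i * P m j * ∑ k, ∑ b, P n k * P n b * (A k b * B i j - C j b * D i k)
      = (∑ i, ∑ j, P n i * P n j * A i j) * (∑ i, ∑ j, P m i * P m j * B i j)
        - (∑ i, ∑ j, P m i * P n j * C i j) * (∑ i, ∑ j, P m i * P n j * D i j) := by
  simp only [Fin.sum_univ_three]
  ring

theorem frame_linear (P : Fin 3 → Fin 3 → ℝ) (e : Fin 3 → Fin 3 → Fin 3 → Fin 3 → ℝ) 
    (m n : Fin 3) :
    ∑ i, ∑ j, P m i * P m j * ∑ k, ∑ b, P n k * P n b * (e k i j b - e j i k b)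
      = frame4 P e n m m n - frame4 P e m m n n := by
  simp only [Fin.sum_univ_three, frame4]
  ring

/-- Once `H` is diagonal in the frame, the double trace of the curvature splits into a sum over
pairs of frame vectors. The arrays `c` and `e` stay arbitrary so that no entry of the metric is
expanded here. -/
theorem frame_contraction {H : Mat 3} {P : Fin 3 → Fin 3 → ℝ} {d : Fin 3 → ℝ}
    (hH : ∀ i j, H i j = ∑ m, d m * P m i * P m j)
    (c : Fin 3 → Fin 3 → Fin 3 → ℝ) (e : Fin 3 → Fin 3 → Fin 3 → Fin 3 → ℝ) :
    ∑ i, ∑ j, H i j * ∑ k, ∑ b, H k b * (e k i j b - e j i k b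
        - ∑ l, ∑ r, H l r * (c k b l * c i j r - c j b l * c i k r))
      = ∑ m, ∑ n, d m * d n * (frame4 P e n m m n - frame4 P e m m n n
        - ∑ p, d p * (frame3 P c n n p * frame3 P c m m p
          - frame3 P c m n p * frame3 P c m n p)) := by
  have h1 : ∀ p i j k b, ∑ l, ∑ r, P p l * P p r * (c k b l * c i j r - c j b l * c i k r)
      = (∑ l, P p l * c k b l) * (∑ r, P p r * c i j r)
        - (∑ l, P p l * c j b l) * ∑ r, P p r * c i k r := by
    intro p i j k b
    simp only [Fin.sum_univ_three]
    ring
  have pull : ∀ (w : Fin 3 → Fin 3 → ℝ) (F : Fin 3 → Fin 3 → Fin 3 → ℝ),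
      ∑ i, ∑ j, w i j * ∑ n, d n * F n i j = ∑ n, d n * ∑ i, ∑ j, w i j * F n i j := by
    intro w F
    simp only [Fin.sum_univ_three]
    ring
  have split : ∀ (w U V : Fin 3 → Fin 3 → ℝ),
      ∑ i, ∑ j, w i j * (U i j - V i j)
        = ∑ i, ∑ j, w i j * U i j - ∑ i, ∑ j, w i j * V i j := by
    intro w U V
    simp only [mul_sub, Finset.sum_sub_distrib]
  simp only [sum_frame hH, h1]
  refine Finset.sum_congr rfl fun m _ => ?_
  rw [pull (fun i j => P m i * P m j), Finset.mul_sum]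
  refine Finset.sum_congr rfl fun n _ => ?_
  rw [mul_assoc]
  congr 2
  have hq : ∀ p, frame3 P c n n p * frame3 P c m m p - frame3 P c m n p * frame3 P c m n p
      = _ := fun p =>
    (frame_quadratic P (fun i j => ∑ l, P p l * c i j l) (fun i j => ∑ l, P p l * c i j l)
      (fun i j => ∑ l, P p l * c i j l) (fun i j => ∑ l, P p l * c i j l) m n).symm
  simp only [← frame_linear, hq]
  rw [← pull (fun i j => P m i * P m j), ← split (fun i j => P m i * P m j)]
  refine Finset.sum_congr rfl fun i _ => Finset.sum_congr rfl fun j _ => ?_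
  rw [← pull (fun k b => P n k * P n b), ← split (fun k b => P n k * P n b)]

end Frame

/-! ### Jets of an axially symmetric metric on the meridian plane -/

section Jets

/-- The metric `Q (dx² + dz²) + L (dy + a dx + b dz)²`. -/
def frameMetric (Q L a b : ℝ) : Mat 3 :=
  !![Q + L * a ^ 2, L * a, L * a * b; L * a, L, L * b; L * a * b, L * b, Q + L * b ^ 2]

/-- The first derivative of `frameMetric`, in terms of those of its arguments. -/
def frameMetricD (L a b q l α β : ℝ) : Mat 3 :=
  !![q + l * a ^ 2 + 2 * L * a * α, l * a + L * α, l * a * b + L * α * b + L * a * β;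
     l * a + L * α, l, l * b + L * β;
     l * a * b + L * α * b + L * a * β, l * b + L * β, q + l * b ^ 2 + 2 * L * b * β]

/-- The second derivative of `frameMetric`, in terms of those of its arguments. -/
def frameMetricDD (L a b l α β l' α' β' q'' l'' α'' β'' : ℝ) : Mat 3 :=
  !![q'' + l'' * a ^ 2 + 2 * a * (l * α' + l' * α) + 2 * L * (α * α' + a * α''),
      l'' * a + l * α' + l' * α + L * α'',
      l'' * a * b + l * (α' * b + a * β') + l' * (α * b + a * β)
        + L * (α'' * b + α * β' + α' * β + a * β'');
     l'' * a + l * α' + l' * α + L * α'', l'', l'' * b + l * β' + l' * β + L * β'';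
     l'' * a * b + l * (α' * b + a * β') + l' * (α * b + a * β)
        + L * (α'' * b + α * β' + α' * β + a * β''),
      l'' * b + l * β' + l' * β + L * β'',
      q'' + l'' * b ^ 2 + 2 * b * (l * β' + l' * β) + 2 * L * (β * β' + b * β'')]

/-- The infinitesimal rotation of a covariant 2-tensor: for an axially symmetric tensor `T`,
`x ∂_y T - y ∂_x T = rotate T`. -/
def rotate (M : Mat 3) : Mat 3 :=
  !![-M 1 0 - M 0 1, M 0 0 - M 1 1, -M 1 2; M 0 0 - M 1 1, M 0 1 + M 1 0, M 0 2;
     -M 2 1, M 2 0, 0]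

/-- The first derivatives of an axially symmetric tensor at a point of the meridian plane. -/
def jet1 (x : ℝ) (G Gx Gz : Mat 3) : Fin 3 → Mat 3 := ![Gx, x⁻¹ • rotate G, Gz]

/-- The second derivatives of an axially symmetric tensor at a point of the meridian plane. -/
def jet2 (x : ℝ) (G Gx Gz Gxx Gxz Gzz : Mat 3) : Fin 3 → Fin 3 → Mat 3 :=
  ![![Gxx, x⁻¹ • (rotate Gx - x⁻¹ • rotate G), Gxz],
    ![x⁻¹ • (rotate Gx - x⁻¹ • rotate G), x⁻¹ • (Gx + x⁻¹ • rotate (rotate G)), x⁻¹ • rotate Gz],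
    ![Gxz, x⁻¹ • rotate Gz, Gzz]]

/-- The frame `∂_x - a ∂_y, ∂_y, ∂_z - b ∂_y`, orthogonal for `frameMetric`. -/
def shearFrame (a b : ℝ) : Fin 3 → Fin 3 → ℝ := ![![1, -a, 0], ![0, 1, 0], ![0, -b, 1]]

/-- The rows of `shearFrame` are orthogonal for `frameMetric`, with squared lengths `Q`, `L`, `Q`.
-/
theorem frameMetric_inv {Q L a b : ℝ} (hQ : Q ≠ 0) (hL : L ≠ 0) (i j : Fin 3) :
    (frameMetric Q L a b)⁻¹ i j
      = ∑ m, ![Q⁻¹, L⁻¹, Q⁻¹] m * shearFrame a b m i * shearFrame a b m j := by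
  have h : (frameMetric Q L a b)⁻¹ = Matrix.of fun i j =>
      ∑ m, ![Q⁻¹, L⁻¹, Q⁻¹] m * shearFrame a b m i * shearFrame a b m j := by
    apply Matrix.inv_eq_right_inv
    ext i j
    fin_cases i <;> fin_cases j <;>
      simp [Matrix.mul_apply, Fin.sum_univ_three, frameMetric, shearFrame] <;> field_simp <;> ring
  rw [h, Matrix.of_apply]

section Algebra

variable (x Q L a b Qx Lx ax bx Qz Lz az bz Qxx Lxx axx bxx Qxz Lxz axz bxz Qzz Lzz azz bzz : ℝ)

/-- The Christoffel symbols of the first kind from the first derivatives of the metric. -/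
def firstKind (D : Fin 3 → Mat 3) (i j l : Fin 3) : ℝ := (1 / 2) * (D i j l + D j i l - D l i j)

/-- The derivatives of the Christoffel symbols of the first kind. -/
def firstKindD (D : Fin 3 → Fin 3 → Mat 3) (k i j l : Fin 3) : ℝ :=
  (1 / 2) * (D k i j l + D k j i l - D k l i j)

theorem frame3_firstKind (P : Fin 3 → Fin 3 → ℝ) (D : Fin 3 → Mat 3) (m n p : Fin 3) :
    frame3 P (firstKind D) m n p = (1 / 2) * (frame3 P (fun i j l => D i j l) m n p
      + frame3 P (fun i j l => D i j l) n m p - frame3 P (fun i j l => D i j l) p m n) := by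
  simp only [frame3, firstKind, Fin.sum_univ_three]
  ring

theorem frame4_firstKindD (P : Fin 3 → Fin 3 → ℝ) (D : Fin 3 → Fin 3 → Mat 3) (m n p q : Fin 3) :
    frame4 P (firstKindD D) m n p q = (1 / 2) * (frame4 P (fun i j k l => D i j k l) m n p q
      + frame4 P (fun i j k l => D i j k l) m p n q
      - frame4 P (fun i j k l => D i j k l) m q n p) := by
  simp only [frame4, firstKindD, Fin.sum_univ_three]
  ring

/-- The first derivatives of the metric in the frame `shearFrame`. -/
def frameJet : Fin 3 → Mat 3 :=
  ![!![Qx + 2 * a ^ 2 * Q / x, L * ax - a * (Q - L - L * a ^ 2) / x, a * b * Q / x;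
       L * ax - a * (Q - L - L * a ^ 2) / x, Lx - 2 * L * a ^ 2 / x, L * bx + L * a ^ 2 * b / x;
       a * b * Q / x, L * bx + L * a ^ 2 * b / x, Qx],
    !![-2 * a * Q / x, (Q - L - L * a ^ 2) / x, -b * Q / x;
       (Q - L - L * a ^ 2) / x, 2 * L * a / x, -L * a * b / x;
       -b * Q / x, -L * a * b / x, 0],
    !![Qz + 2 * a * b * Q / x, L * az - b * (Q - L - L * a ^ 2) / x, b ^ 2 * Q / x;
       L * az - b * (Q - L - L * a ^ 2) / x, Lz - 2 * L * a * b / x, L * bz + L * a * b ^ 2 / x;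
       b ^ 2 * Q / x, L * bz + L * a * b ^ 2 / x, Qz]]

/-- The frame is frozen at the point: derivatives of the coordinate components are contracted with
constants, so no derivative of `a` or `b` comes from the frame itself. -/
theorem frame3_jet1 (hx : x ≠ 0) (m n p : Fin 3) :
    frame3 (shearFrame a b) (fun i j l => jet1 x (frameMetric Q L a b)
      (frameMetricD L a b Qx Lx ax bx) (frameMetricD L a b Qz Lz az bz) i j l) m n p
      = frameJet x Q L a b Qx Lx ax bx Qz Lz az bz m n p := by
  fin_cases m <;> fin_cases n <;> fin_cases p <;>
    simp [frame3, Fin.sum_univ_three, shearFrame, jet1, frameMetric, frameMetricD, frameJet,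
      rotate] <;> field_simp <;> ring

end Algebra

end Jets

/-! ### The curvatures of the three coordinate planes of the orthogonal frame. -/

section Jets

variable (x Q L a b Qx Lx ax bx Qz Lz az bz Qxx Lxx axx bxx Qxz Lxz axz bxz Qzz Lzz azz bzz : ℝ)

section

variable (G Gx Gz Gxx Gxz Gzz : Mat 3)

theorem jet2_zero_zero : jet2 x G Gx Gz Gxx Gxz Gzz 0 0 = Gxx := rfl

theorem jet2_zero_one : jet2 x G Gx Gz Gxx Gxz Gzz 0 1 = x⁻¹ • (rotate Gx - x⁻¹ • rotate G) := rfl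

theorem jet2_zero_two : jet2 x G Gx Gz Gxx Gxz Gzz 0 2 = Gxz := rfl

theorem jet2_one_one :
    jet2 x G Gx Gz Gxx Gxz Gzz 1 1 = x⁻¹ • (Gx + x⁻¹ • rotate (rotate G)) := rfl

theorem jet2_one_two : jet2 x G Gx Gz Gxx Gxz Gzz 1 2 = x⁻¹ • rotate Gz := rfl

theorem jet2_two_two : jet2 x G Gx Gz Gxx Gxz Gzz 2 2 = Gzz := rfl

theorem jet2_comm (i j : Fin 3) :
    jet2 x G Gx Gz Gxx Gxz Gzz i j = jet2 x G Gx Gz Gxx Gxz Gzz j i := by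
  fin_cases i <;> fin_cases j <;> rfl

end

/-- The frame is sparse, so few of the 81 terms survive. This expansion and its companions are made
for an opaque `D`, which keeps the rational identities of the plane curvatures small. -/
theorem frame4_shearFrame_zero_one_zero_one (D : Fin 3 → Fin 3 → Mat 3) :
    frame4 (shearFrame a b) (fun i j k l => D i j k l) 0 1 0 1
      = D 0 1 0 1 - a * D 0 1 1 1 - a * D 1 1 0 1 + a ^ 2 * D 1 1 1 1 := by
  simp [frame4, Fin.sum_univ_three, shearFrame]
  ring

theorem frame4_shearFrame_one_one_zero_zero (D : Fin 3 → Fin 3 → Mat 3) :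
    frame4 (shearFrame a b) (fun i j k l => D i j k l) 1 1 0 0
      = D 1 1 0 0 - a * D 1 1 0 1 - a * D 1 1 1 0 + a ^ 2 * D 1 1 1 1 := by
  simp [frame4, Fin.sum_univ_three, shearFrame]
  ring

theorem frame4_shearFrame_zero_zero_one_one (D : Fin 3 → Fin 3 → Mat 3) (hD : ∀ i j, D i j = D j i)
    :
    frame4 (shearFrame a b) (fun i j k l => D i j k l) 0 0 1 1
      = D 0 0 1 1 - a * D 0 1 1 1 - a * D 0 1 1 1 + a ^ 2 * D 1 1 1 1 := by
  simp [frame4, Fin.sum_univ_three, shearFrame, hD 1 0]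
  ring

theorem frame4_shearFrame_zero_two_zero_two (D : Fin 3 → Fin 3 → Mat 3) :
    frame4 (shearFrame a b) (fun i j k l => D i j k l) 0 2 0 2
      = D 0 2 0 2 - b * D 0 2 0 1 - a * D 0 2 1 2 + a * b * D 0 2 1 1 - b * D 0 1 0 2
        + b ^ 2 * D 0 1 0 1 + a * b * D 0 1 1 2 - a * b ^ 2 * D 0 1 1 1 - a * D 1 2 0 2
        + a * b * D 1 2 0 1 + a ^ 2 * D 1 2 1 2 - a ^ 2 * b * D 1 2 1 1 + a * b * D 1 1 0 2
        - a * b ^ 2 * D 1 1 0 1 - a ^ 2 * b * D 1 1 1 2 + a ^ 2 * b ^ 2 * D 1 1 1 1 := by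
  simp [frame4, Fin.sum_univ_three, shearFrame]
  ring

theorem frame4_shearFrame_two_two_zero_zero (D : Fin 3 → Fin 3 → Mat 3) (hD : ∀ i j, D i j = D j i)
    :
    frame4 (shearFrame a b) (fun i j k l => D i j k l) 2 2 0 0
      = D 2 2 0 0 - a * D 2 2 0 1 - a * D 2 2 1 0 + a ^ 2 * D 2 2 1 1 - b * D 1 2 0 0
        + a * b * D 1 2 0 1 + a * b * D 1 2 1 0 - a ^ 2 * b * D 1 2 1 1 - b * D 1 2 0 0
        + a * b * D 1 2 0 1 + a * b * D 1 2 1 0 - a ^ 2 * b * D 1 2 1 1 + b ^ 2 * D 1 1 0 0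
        - a * b ^ 2 * D 1 1 0 1 - a * b ^ 2 * D 1 1 1 0 + a ^ 2 * b ^ 2 * D 1 1 1 1 := by
  simp [frame4, Fin.sum_univ_three, shearFrame, hD 2 1]
  ring

theorem frame4_shearFrame_zero_zero_two_two (D : Fin 3 → Fin 3 → Mat 3) (hD : ∀ i j, D i j = D j i)
    :
    frame4 (shearFrame a b) (fun i j k l => D i j k l) 0 0 2 2
      = D 0 0 2 2 - b * D 0 0 2 1 - b * D 0 0 1 2 + b ^ 2 * D 0 0 1 1 - a * D 0 1 2 2
        + a * b * D 0 1 2 1 + a * b * D 0 1 1 2 - a * b ^ 2 * D 0 1 1 1 - a * D 0 1 2 2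
        + a * b * D 0 1 2 1 + a * b * D 0 1 1 2 - a * b ^ 2 * D 0 1 1 1 + a ^ 2 * D 1 1 2 2
        - a ^ 2 * b * D 1 1 2 1 - a ^ 2 * b * D 1 1 1 2 + a ^ 2 * b ^ 2 * D 1 1 1 1 := by
  simp [frame4, Fin.sum_univ_three, shearFrame, hD 1 0]
  ring

theorem frame4_shearFrame_one_two_one_two (D : Fin 3 → Fin 3 → Mat 3) :
    frame4 (shearFrame a b) (fun i j k l => D i j k l) 1 2 1 2
      = D 1 2 1 2 - b * D 1 2 1 1 - b * D 1 1 1 2 + b ^ 2 * D 1 1 1 1 := by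
  simp [frame4, Fin.sum_univ_three, shearFrame]
  ring

theorem frame4_shearFrame_two_two_one_one (D : Fin 3 → Fin 3 → Mat 3) (hD : ∀ i j, D i j = D j i) :
    frame4 (shearFrame a b) (fun i j k l => D i j k l) 2 2 1 1
      = D 2 2 1 1 - b * D 1 2 1 1 - b * D 1 2 1 1 + b ^ 2 * D 1 1 1 1 := by
  simp [frame4, Fin.sum_univ_three, shearFrame, hD 2 1]
  ring

theorem frame4_shearFrame_one_one_two_two (D : Fin 3 → Fin 3 → Mat 3) :
    frame4 (shearFrame a b) (fun i j k l => D i j k l) 1 1 2 2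
      = D 1 1 2 2 - b * D 1 1 2 1 - b * D 1 1 1 2 + b ^ 2 * D 1 1 1 1 := by
  simp [frame4, Fin.sum_univ_three, shearFrame]
  ring

/-- The second derivatives of an axially symmetric `frameMetric` on the meridian plane. -/
def frameMetricJet2 : Fin 3 → Fin 3 → Mat 3 :=
  jet2 x (frameMetric Q L a b)
    (frameMetricD L a b Qx Lx ax bx) (frameMetricD L a b Qz Lz az bz)
    (frameMetricDD L a b Lx ax bx Lx ax bx Qxx Lxx axx bxx)
    (frameMetricDD L a b Lx ax bx Lz az bz Qxz Lxz axz bxz)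
    (frameMetricDD L a b Lz az bz Lz az bz Qzz Lzz azz bzz)

/-- The curvature of the plane spanned by the frame vectors `m` and `n` (up to normalization). -/
def framePlaneCurvature (d : Fin 3 → ℝ) (P : Fin 3 → Fin 3 → ℝ) (D : Fin 3 → Fin 3 → Mat 3)
    (J : Fin 3 → Mat 3) (m n : Fin 3) : ℝ :=
  frame4 P (fun i j k l => D i j k l) m n m n
    - (1 / 2) * frame4 P (fun i j k l => D i j k l) n n m m
    - (1 / 2) * frame4 P (fun i j k l => D i j k l) m m n n
    - ∑ p, d p * (firstKind J n n p * firstKind J m m p - firstKind J m n p ^ 2)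

/-- A plane containing the orbit direction: with `λ = x √L` the result is `-L Hess_q λ(e₀, e₀) / λ`
plus O'Neill's term, `e₀` being the first frame vector. The shears enter only through the gauge
invariant combination `bx - b / x - az`. -/
theorem framePlaneCurvature_zero_one (hx : x ≠ 0) (hQ : Q ≠ 0) (hL : L ≠ 0) :
    framePlaneCurvature ![Q⁻¹, L⁻¹, Q⁻¹] (shearFrame a b)
      (frameMetricJet2 x Q L a b Qx Lx ax bx Qz Lz az bz Qxx Lxx axx bxx Qxz Lxz axz bxz
        Qzz Lzz azz bzz)
      (frameJet x Q L a b Qx Lx ax bx Qz Lz az bz) 0 1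
      = -Lx / x - Lxx / 2 + Lx ^ 2 / (4 * L) + (Qx * Lx - Lz * Qz) / (4 * Q) + L * Qx / (2 * Q * x)
        + L ^ 2 * (bx - b / x - az) ^ 2 / (4 * Q) := by
  unfold framePlaneCurvature frameMetricJet2
  rw [frame4_shearFrame_zero_one_zero_one, frame4_shearFrame_one_one_zero_zero,
    frame4_shearFrame_zero_zero_one_one _ _ _ (jet2_comm _ _ _ _ _ _ _)]
  simp only [jet2_zero_zero, jet2_zero_one, jet2_one_one]
  simp [Fin.sum_univ_three, frameMetric, frameMetricD, frameMetricDD, frameJet, rotate, firstKind]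
  field_simp
  ring

/-- The horizontal plane: the curvature of the quotient metric `Q (dx² + dz²)`, lowered by O'Neill's
term with its factor `3/4`. -/
theorem framePlaneCurvature_zero_two (hx : x ≠ 0) (hQ : Q ≠ 0) (hL : L ≠ 0) :
    framePlaneCurvature ![Q⁻¹, L⁻¹, Q⁻¹] (shearFrame a b)
      (frameMetricJet2 x Q L a b Qx Lx ax bx Qz Lz az bz Qxx Lxx axx bxx Qxz Lxz axz bxz
        Qzz Lzz azz bzz)
      (frameJet x Q L a b Qx Lx ax bx Qz Lz az bz) 0 2
      = -(Qxx + Qzz) / 2 + (Qx ^ 2 + Qz ^ 2) / (2 * Q) - 3 / 4 * L * (bx - b / x - az) ^ 2 := by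
  unfold framePlaneCurvature frameMetricJet2
  rw [frame4_shearFrame_zero_two_zero_two, frame4_shearFrame_two_two_zero_zero _ _ _ (jet2_comm _ _
      _ _ _ _ _),
    frame4_shearFrame_zero_zero_two_two _ _ _ (jet2_comm _ _ _ _ _ _ _)]
  simp only [jet2_zero_zero, jet2_zero_one, jet2_zero_two, jet2_one_one, jet2_one_two, jet2_two_two]
  simp [Fin.sum_univ_three, frameMetric, frameMetricD, frameMetricDD, frameJet, rotate, firstKind]
  field_simp
  ring

/-- The other plane through the orbit direction; now the Hessian of `λ = x √L` is taken along the
third frame vector. -/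
theorem framePlaneCurvature_one_two (hx : x ≠ 0) (hQ : Q ≠ 0) (hL : L ≠ 0) :
    framePlaneCurvature ![Q⁻¹, L⁻¹, Q⁻¹] (shearFrame a b)
      (frameMetricJet2 x Q L a b Qx Lx ax bx Qz Lz az bz Qxx Lxx axx bxx Qxz Lxz axz bxz
        Qzz Lzz azz bzz)
      (frameJet x Q L a b Qx Lx ax bx Qz Lz az bz) 1 2
      = -Lzz / 2 + Lz ^ 2 / (4 * L) + (Lz * Qz - Lx * Qx) / (4 * Q) - L * Qx / (2 * Q * x)
        + L ^ 2 * (bx - b / x - az) ^ 2 / (4 * Q) := by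
  unfold framePlaneCurvature frameMetricJet2
  rw [frame4_shearFrame_one_two_one_two, frame4_shearFrame_two_two_one_one _ _ _ (jet2_comm _ _ _ _
      _ _ _),
    frame4_shearFrame_one_one_two_two]
  simp only [jet2_one_one, jet2_one_two, jet2_two_two]
  simp [Fin.sum_univ_three, frameMetric, frameMetricD, frameMetricDD, frameJet, rotate, firstKind]
  field_simp
  ring

end Jets

/-! ### Summation over the frame planes, and the derivatives forced by axial symmetry. -/

section Jets

/-- The double contraction of the Riemann tensor in an orthogonal frame. -/
theorem sum_frame_eq (d : Fin 3 → ℝ) (P : Fin 3 → Fin 3 → ℝ)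
    (D1 : Fin 3 → Mat 3) (D2 : Fin 3 → Fin 3 → Mat 3)
    (h2 : ∀ k l i j, D2 k l i j = D2 k l j i)
    (h3 : ∀ k l i j, D2 k l i j = D2 l k i j) (J : Fin 3 → Mat 3)
    (hJs : ∀ m n p, J m n p = J m p n)
    (hJ : ∀ m n p, frame3 P (fun i j l => D1 i j l) m n p = J m n p) :
    ∑ m, ∑ n, d m * d n * (frame4 P (firstKindD D2) n m m n - frame4 P (firstKindD D2) m m n n
        - ∑ p, d p * (frame3 P (firstKind D1) n n p * frame3 P (firstKind D1) m m p
          - frame3 P (firstKind D1) m n p * frame3 P (firstKind D1) m n p))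
     = 2 * (d 0 * d 1 * framePlaneCurvature d P D2 J 0 1
        + d 0 * d 2 * framePlaneCurvature d P D2 J 0 2
        + d 1 * d 2 * framePlaneCurvature d P D2 J 1 2) := by
  have e1 : ∀ m n p q, frame4 P (fun i j k l => D2 i j k l) m n p q
      = frame4 P (fun i j k l => D2 i j k l) n m p q := by
    intro m n p q
    simp only [frame4]
    rw [Finset.sum_comm]
    refine Finset.sum_congr rfl fun i _ => Finset.sum_congr rfl fun j _ => ?_
    simp only [h3 j i]
    ring
  have e2 : ∀ m n p q, frame4 P (fun i j k l => D2 i j k l) m n p q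
      = frame4 P (fun i j k l => D2 i j k l) m n q p := by
    intro m n p q
    simp only [frame4]
    refine Finset.sum_congr rfl fun i _ => Finset.sum_congr rfl fun j _ => ?_
    rw [Finset.sum_comm]
    congr 1
    refine Finset.sum_congr rfl fun k _ => Finset.sum_congr rfl fun l _ => ?_
    rw [h2 i j l k]
    ring
  have hJ1 : ∀ m n p, frame3 P (firstKind D1) m n p = firstKind J m n p := by
    intro m n p
    simp only [frame3_firstKind, hJ, firstKind]
  have hJ2 : ∀ m n p, firstKind J m n p = firstKind J n m p := by
    intro m n p
    simp only [firstKind, hJs p m n]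
    ring
  have main : ∀ m n, frame4 P (firstKindD D2) n m m n - frame4 P (firstKindD D2) m m n n
        - ∑ p, d p * (frame3 P (firstKind D1) n n p * frame3 P (firstKind D1) m m p
          - frame3 P (firstKind D1) m n p * frame3 P (firstKind D1) m n p)
      -- Symmetry of second derivatives merges the two mixed terms. The result is symmetric in `m`,
      -- `n` and zero on the diagonal, so only three planes remain, each counted twice.
      = framePlaneCurvature d P D2 J m n := by
    intro m n
    simp only [frame4_firstKindD, hJ1, framePlaneCurvature, pow_two]
    rw [e1 n m]
    ring
  have sw : ∀ m n, framePlaneCurvature d P D2 J m n = framePlaneCurvature d P D2 J n m := by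
    intro m n
    simp only [framePlaneCurvature]
    rw [e1 m n m n, e2 n m m n]
    simp only [hJ2 m n, Fin.sum_univ_three]
    ring
  have dg : ∀ m, framePlaneCurvature d P D2 J m m = 0 := by
    intro m
    simp only [framePlaneCurvature, Fin.sum_univ_three]
    ring
  simp only [main]
  simp only [Fin.sum_univ_three, dg, sw 1 0, sw 2 0, sw 2 1]
  ring

variable {g : E 3 → Mat 3}

/-- The partial derivatives of the components of a tensor. -/
def tensorPd (g : E 3 → Mat 3) (k : Fin 3) (x : E 3) : Mat 3 :=
  Matrix.of fun i j => pd k (fun y => g y i j) x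

/-- The second partial derivatives of the components of a tensor. -/
def tensorPdPd (g : E 3 → Mat 3) (k l : Fin 3) (x : E 3) : Mat 3 :=
  Matrix.of fun i j => pd k (pd l fun y => g y i j) x

theorem eta_apply_zero (x : E 3) : eta x 0 = -x 1 := by simp [eta]

theorem eta_apply_one (x : E 3) : eta x 1 = x 0 := by simp [eta]

theorem eta_apply_two (x : E 3) : eta x 2 = 0 := by simp [eta]

theorem axial_eq (hax : ∀ x, lieTensor eta g x = 0) (x : E 3) (i j : Fin 3) :
    x 0 * pd 1 (fun y => g y i j) x - x 1 * pd 0 (fun y => g y i j) x = rotate (g x) i j := by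
  have h := congrFun (congrFun (hax x) i) j
  simp only [lieTensor, lieFun, Matrix.of_apply, Fin.sum_univ_three, eta_apply_zero,
    eta_apply_one, eta_apply_two, pd_neg, pd_coord, pd_const, Matrix.zero_apply] at h
  fin_cases i <;> fin_cases j <;> simp [rotate] at h ⊢ <;> linarith

theorem pd_rotate (hg : ∀ i j, ContDiff ℝ ∞ fun x => g x i j) (k i j : Fin 3) (x : E 3) :
    pd k (fun y => rotate (g y) i j) x = rotate (tensorPd g k x) i j := by
  have hd : ∀ i j, DifferentiableAt ℝ (fun x => g x i j) x := fun i j =>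
    (hg i j).differentiableAt_top x
  fin_cases i <;> fin_cases j <;> simp [rotate, tensorPd] <;>
    first
    | exact pd_const _ _ _
    | exact pd_neg _
    | exact pd_add _ (hd _ _) (hd _ _)
    | exact pd_sub _ (hd _ _) (hd _ _)
    | exact (pd_sub _ (hd _ _).neg (hd _ _)).trans (congrArg (· - _) (pd_neg _))

/-- On `y = 0` the invariance equation loses its `y ∂_x` term and can be solved for `∂_y`. -/
theorem tensorPd_eq_jet1 (hax : ∀ x, lieTensor eta g x = 0) {x : E 3} (h0 : x 0 ≠ 0)
    (h1 : x 1 = 0) (k : Fin 3) :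
    tensorPd g k x = jet1 (x 0) (g x) (tensorPd g 0 x) (tensorPd g 2 x) k := by
  fin_cases k
  · rfl
  · ext i j
    have h := axial_eq hax x i j
    rw [h1] at h
    simp only [tensorPd, jet1, Matrix.of_apply]
    simp [← h]
    field_simp
  · rfl

theorem tensorPdPd_comm (hg : ∀ i j, ContDiff ℝ ∞ fun x => g x i j) (k l : Fin 3) (x : E 3) :
    tensorPdPd g k l x = tensorPdPd g l k x := by
  ext i j
  exact pd_comm (hg i j) k l x

/-- The two extra terms are the commutator of `∂ₖ` with `x ∂_y - y ∂_x`. -/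
theorem pd_axial_eq (hg : ∀ i j, ContDiff ℝ ∞ fun x => g x i j)
    (hax : ∀ x, lieTensor eta g x = 0) (k : Fin 3) (x : E 3) (i j : Fin 3) :
    x 0 * tensorPdPd g k 1 x i j - x 1 * tensorPdPd g k 0 x i j
      = rotate (tensorPd g k x) i j - (if (0 : Fin 3) = k then 1 else 0) * tensorPd g 1 x i j
        + (if (1 : Fin 3) = k then 1 else 0) * tensorPd g 0 x i j := by
  have hc : ∀ l : Fin 3, DifferentiableAt ℝ (fun y : E 3 => y l) x := fun l =>
    (EuclideanSpace.proj l : E 3 →L[ℝ] ℝ).differentiableAt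
  have hd : ∀ l : Fin 3, DifferentiableAt ℝ (pd l fun x => g x i j) x := fun l =>
    ((hg i j).pd l).differentiableAt_top x
  have h : (fun y => rotate (g y) i j)
      = fun y => y 0 * pd 1 (fun y => g y i j) y - y 1 * pd 0 (fun y => g y i j) y :=
    funext fun y => (axial_eq hax y i j).symm
  rw [← pd_rotate hg, h, pd_sub (f := fun y => y 0 * pd 1 (fun y => g y i j) y)
    (g := fun y => y 1 * pd 0 (fun y => g y i j) y) _ ((hc 0).mul (hd 1)) ((hc 1).mul (hd 0)),
    pd_mul _ (hc 0) (hd 1),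
    pd_mul _ (hc 1) (hd 0), pd_coord, pd_coord]
  simp only [tensorPd, tensorPdPd, Matrix.of_apply]
  ring

/-- Every derivative across the meridian plane is traded for derivatives within it, so the curvature
of the 3-metric is determined by functions of `(ρ, z)`. -/
theorem tensorPdPd_eq_jet2 (hg : ∀ i j, ContDiff ℝ ∞ fun x => g x i j)
    (hax : ∀ x, lieTensor eta g x = 0) {x : E 3} (h0 : x 0 ≠ 0) (h1 : x 1 = 0) (k l : Fin 3) :
    tensorPdPd g k l x = jet2 (x 0) (g x) (tensorPd g 0 x) (tensorPd g 2 x) (tensorPdPd g 0 0 x)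
      (tensorPdPd g 0 2 x) (tensorPdPd g 2 2 x) k l := by
  have hy : tensorPd g 1 x = (x 0)⁻¹ • rotate (g x) := tensorPd_eq_jet1 hax h0 h1 1
  have h01 : tensorPdPd g 0 1 x
      = (x 0)⁻¹ • (rotate (tensorPd g 0 x) - (x 0)⁻¹ • rotate (g x)) := by
    ext i j
    have h := pd_axial_eq hg hax 0 x i j
    rw [h1, hy] at h
    simp at h ⊢
    rw [← h]
    field_simp
  have h11 : tensorPdPd g 1 1 x
      = (x 0)⁻¹ • (tensorPd g 0 x + (x 0)⁻¹ • rotate (rotate (g x))) := by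
    ext i j
    have h := pd_axial_eq hg hax 1 x i j
    have hs : rotate ((x 0)⁻¹ • rotate (g x)) i j = (x 0)⁻¹ * rotate (rotate (g x)) i j := by
      fin_cases i <;> fin_cases j <;> simp [rotate] <;> ring
    rw [h1, hy, hs] at h
    simp at h ⊢
    rw [add_comm, ← h]
    field_simp
  have h21 : tensorPdPd g 2 1 x = (x 0)⁻¹ • rotate (tensorPd g 2 x) := by
    ext i j
    have h := pd_axial_eq hg hax 2 x i j
    rw [h1] at h
    simp at h ⊢
    rw [← h]
    field_simp
  fin_cases k <;> fin_cases l
  · rfl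
  · exact h01
  · rfl
  · exact (tensorPdPd_comm hg 1 0 x).trans h01
  · exact h11
  · exact (tensorPdPd_comm hg 1 2 x).trans h21
  · exact tensorPdPd_comm hg 2 0 x
  · exact h21
  · rfl

end Jets

/-! ### The metric on the meridian plane through its profiles `Q`, `L`, `a`, `b`, which are smooth
also on the axis. -/

section Meridian

variable {g : E 3 → Mat 3}

theorem christoffelFirst_eq (g : E 3 → Mat 3) (i j l : Fin 3) (x : E 3) :
    christoffelFirst g i j l x = firstKind (fun k => tensorPd g k x) i j l := rfl

theorem pd_christoffelFirst (hg : ∀ i j, ContDiff ℝ ∞ fun x => g x i j) (k i j l : Fin 3)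
    (x : E 3) :
    pd k (christoffelFirst g i j l) x = firstKindD (fun k l => tensorPdPd g k l x) k i j l := by
  have hd : ∀ a b c, DifferentiableAt ℝ (pd a fun x => g x b c) x := fun a b c =>
    ((hg b c).pd a).differentiableAt_top x
  unfold christoffelFirst
  rw [pd_const_mul k (1 / 2) (((hd i j l).fun_add (hd j i l)).fun_sub (hd l i j)),
    pd_sub (f := fun x => pd i (fun y => g y j l) x + pd j (fun y => g y i l) x) k
      ((hd i j l).fun_add (hd j i l)) (hd l i j), pd_add k (hd i j l) (hd j i l)]
  rfl

/-- The component `g_yy` on the meridian plane. -/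
def profL (g : E 3 → Mat 3) (p : E 2) : ℝ := g (meridian p) 1 1

/-- The ratio `g_xy / g_yy` on the meridian plane. -/
def profA (g : E 3 → Mat 3) (p : E 2) : ℝ := g (meridian p) 0 1 / g (meridian p) 1 1

/-- The ratio `g_zy / g_yy` on the meridian plane. -/
def profB (g : E 3 → Mat 3) (p : E 2) : ℝ := g (meridian p) 1 2 / g (meridian p) 1 1

/-- The component `g_zz - g_zy² / g_yy` of the quotient metric on the meridian plane. -/
def profQ (g : E 3 → Mat 3) (p : E 2) : ℝ :=
  g (meridian p) 2 2 - g (meridian p) 1 2 ^ 2 / g (meridian p) 1 1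

theorem _root_.Matrix.PosDef.apply_comm {M : Mat 3} (h : M.PosDef) (i j : Fin 3) :
    M i j = M j i := by
  simpa using (h.isHermitian.apply i j).symm

theorem profL_pos (hpos : ∀ x, (g x).PosDef) (p : E 2) : 0 < profL g p :=
  (hpos (meridian p)).diag_pos

/-- `Q` is the squared length of `∂_z - b ∂_y`. -/
theorem profQ_pos (hpos : ∀ x, (g x).PosDef) (p : E 2) : 0 < profQ g p := by
  have hL := profL_pos hpos p
  have h := (hpos (meridian p)).dotProduct_mulVec_pos (x := ![0, -profB g p, 1]) (by
    intro h; simpa using congrFun h 2)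
  have hs := (hpos (meridian p)).apply_comm 2 1
  simp [dotProduct, Matrix.mulVec, Fin.sum_univ_three, hs] at h
  unfold profL at hL
  unfold profQ
  have e : profB g p = g (meridian p) 1 2 / g (meridian p) 1 1 := rfl
  rw [e] at h
  have h2 : g (meridian p) 1 1 * (g (meridian p) 1 2 / g (meridian p) 1 1)
      = g (meridian p) 1 2 := mul_div_cancel₀ _ hL.ne'
  have h3 : g (meridian p) 1 2 ^ 2 / g (meridian p) 1 1
      = g (meridian p) 1 2 / g (meridian p) 1 1 * g (meridian p) 1 2 := by ring
  rw [h2] at h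
  rw [h3]
  linarith

theorem contDiff_comp_meridian {f : E 3 → ℝ} (hf : ContDiff ℝ ∞ f) :
    ContDiff ℝ ∞ fun p => f (meridian p) := hf.comp contDiff_meridian

theorem contDiff_profL (hg : ∀ i j, ContDiff ℝ ∞ fun x => g x i j) : ContDiff ℝ ∞ (profL g) :=
  contDiff_comp_meridian (hg 1 1)

theorem contDiff_profA (hg : ∀ i j, ContDiff ℝ ∞ fun x => g x i j) (hpos : ∀ x, (g x).PosDef) :
    ContDiff ℝ ∞ (profA g) :=
  (contDiff_comp_meridian (hg 0 1)).div (contDiff_profL hg) fun p => (profL_pos hpos p).ne'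

theorem contDiff_profB (hg : ∀ i j, ContDiff ℝ ∞ fun x => g x i j) (hpos : ∀ x, (g x).PosDef) :
    ContDiff ℝ ∞ (profB g) :=
  (contDiff_comp_meridian (hg 1 2)).div (contDiff_profL hg) fun p => (profL_pos hpos p).ne'

theorem contDiff_profQ (hg : ∀ i j, ContDiff ℝ ∞ fun x => g x i j) (hpos : ∀ x, (g x).PosDef) :
    ContDiff ℝ ∞ (profQ g) :=
  (contDiff_comp_meridian (hg 2 2)).sub (((contDiff_comp_meridian (hg 1 2)).pow 2).div
    (contDiff_profL hg) fun p => (profL_pos hpos p).ne')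

theorem meridian_zero (p : E 2) : meridian p 0 = p 0 := by simp [meridian]

theorem meridian_one (p : E 2) : meridian p 1 = 0 := by simp [meridian]

theorem etaLow_meridian (g : E 3 → Mat 3) (p : E 2) (a : Fin 3) :
    etaLow g (meridian p) a = g (meridian p) a 1 * p 0 := by
  simp [etaLow, Fin.sum_univ_three, eta, meridian]

theorem normEtaSq_meridian (g : E 3 → Mat 3) (p : E 2) :
    normEtaSq g (meridian p) = profL g p * p 0 ^ 2 := by
  simp [normEtaSq, Fin.sum_univ_three, eta, meridian, profL]; ring

theorem quotientMetric_meridian (hpos : ∀ x, (g x).PosDef) {p : E 2} (hp : 0 < p 0) (a b : Fin 3) :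
    quotientMetric g (meridian p) a b = g (meridian p) a b
      - g (meridian p) a 1 * g (meridian p) b 1 / profL g p := by
  have hL := (profL_pos hpos p).ne'
  simp only [quotientMetric, Matrix.of_apply, etaLow_meridian, normEtaSq_meridian]
  field_simp

theorem profQ_eq_exp (hpos : ∀ x, (g x).PosDef) {u : E 2 → ℝ} {p : E 2} (hp : 0 < p 0)
    (hiso : onMeridian (quotientMetric g) p = Real.exp (2 * u p) • (1 : Mat 2)) :
    profQ g p = Real.exp (2 * u p) := by
  have h := congrFun (congrFun hiso 1) 1
  simp [onMeridian, quotientMetric_meridian hpos hp] at h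
  rw [← h, (hpos _).apply_comm 2 1, profQ, profL]
  ring

/-- Completing the square in `dy` leaves the quotient metric, and the isothermal condition says that
this remainder is `Q (dx² + dz²)`. -/
theorem metric_eq_frameMetric (hpos : ∀ x, (g x).PosDef) {u : E 2 → ℝ} {p : E 2} (hp : 0 < p 0)
    (hiso : onMeridian (quotientMetric g) p = Real.exp (2 * u p) • (1 : Mat 2)) :
    g (meridian p) = frameMetric (profQ g p) (profL g p) (profA g p) (profB g p) := by
  have hL := (profL_pos hpos p).ne'
  have hs := fun i j => (hpos (meridian p)).apply_comm i j
  have h00 := congrFun (congrFun hiso 0) 0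
  have h01 := congrFun (congrFun hiso 0) 1
  have hA : profL g p * profA g p = g (meridian p) 0 1 := by
    unfold profL at *; unfold profA; field_simp
  have hB : profL g p * profB g p = g (meridian p) 1 2 := by
    unfold profL at *; unfold profB; field_simp
  simp [onMeridian, quotientMetric_meridian hpos hp] at h00 h01
  rw [← profQ_eq_exp hpos hp hiso, ← hA] at h00
  rw [hs 2 1, ← hB, ← hA] at h01
  have hQ : profQ g p = g (meridian p) 2 2 - g (meridian p) 1 2 ^ 2 / profL g p := rfl
  rw [← hB] at hQ
  have e00 : g (meridian p) 0 0 = profQ g p + profL g p * profA g p ^ 2 := by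
    rw [← h00]; field_simp; ring
  have e02 : g (meridian p) 0 2 = profL g p * profA g p * profB g p := by
    field_simp at h01; linarith
  have e22 : g (meridian p) 2 2 = profQ g p + profL g p * profB g p ^ 2 := by
    rw [hQ]; field_simp; ring
  ext i j
  fin_cases i <;> fin_cases j <;> simp [frameMetric]
  · exact e00
  · exact hA.symm
  · exact e02
  · rw [hA]; exact hs 1 0
  · rfl
  · exact hB.symm
  · rw [← e02]; exact hs 2 0
  · rw [hB]; exact hs 2 1
  · exact e22

section FrameMetricDerivatives

variable {n : ℕ} {Q L a b : E n → ℝ}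

theorem pd_frameMetric {p : E n} (hQ : DifferentiableAt ℝ Q p) (hL : DifferentiableAt ℝ L p)
    (ha : DifferentiableAt ℝ a p) (hb : DifferentiableAt ℝ b p) (k : Fin n) (i j : Fin 3) :
    pd k (fun p => frameMetric (Q p) (L p) (a p) (b p) i j) p
      = frameMetricD (L p) (a p) (b p) (pd k Q p) (pd k L p) (pd k a p) (pd k b p) i j := by
  have h1 : ∀ {c : E n → ℝ}, DifferentiableAt ℝ c p →
      pd k (fun p => L p * c p) p = pd k L p * c p + L p * pd k c p := fun hc => pd_mul k hL hc
  have h2 : ∀ {c : E n → ℝ}, DifferentiableAt ℝ c p →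
      pd k (fun p => Q p + L p * c p ^ 2) p
        = pd k Q p + pd k L p * c p ^ 2 + 2 * L p * c p * pd k c p := by
    intro c hc
    simp only [pow_two]
    rw [pd_add k hQ (hL.fun_mul (hc.fun_mul hc)), pd_mul k hL (hc.fun_mul hc), pd_mul k hc hc]
    ring
  have h3 : pd k (fun p => L p * a p * b p) p
      = pd k L p * a p * b p + L p * pd k a p * b p + L p * a p * pd k b p := by
    rw [pd_mul k (hL.fun_mul ha) hb, pd_mul k hL ha]
    ring
  fin_cases i <;> fin_cases j <;> simp [frameMetric, frameMetricD, h1 ha, h1 hb, h2 ha, h2 hb, h3]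

theorem pd_pd_frameMetric (hQ : ContDiff ℝ ∞ Q) (hL : ContDiff ℝ ∞ L)
    (ha : ContDiff ℝ ∞ a) (hb : ContDiff ℝ ∞ b) (k l : Fin n) (i j : Fin 3) (p : E n) :
    pd k (pd l fun p => frameMetric (Q p) (L p) (a p) (b p) i j) p
      = frameMetricDD (L p) (a p) (b p) (pd k L p) (pd k a p) (pd k b p)
          (pd l L p) (pd l a p) (pd l b p) (pd k (pd l Q) p) (pd k (pd l L) p)
          (pd k (pd l a) p) (pd k (pd l b) p) i j := by
  have e : (pd l fun p => frameMetric (Q p) (L p) (a p) (b p) i j) = fun p =>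
      frameMetricD (L p) (a p) (b p) (pd l Q p) (pd l L p) (pd l a p) (pd l b p) i j :=
    funext fun p => pd_frameMetric (hQ.differentiableAt_top p) (hL.differentiableAt_top p)
      (ha.differentiableAt_top p) (hb.differentiableAt_top p) l i j
  have dL := hL.differentiableAt_top p
  have da := ha.differentiableAt_top p
  have db := hb.differentiableAt_top p
  have dQ' := (hQ.pd l).differentiableAt_top p
  have dL' := (hL.pd l).differentiableAt_top p
  have da' := (ha.pd l).differentiableAt_top p
  have db' := (hb.pd l).differentiableAt_top p
  have h1 : ∀ {c c' : E n → ℝ}, DifferentiableAt ℝ c p → DifferentiableAt ℝ c' p →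
      pd k (fun p => pd l L p * c p + L p * c' p) p
        = pd k (pd l L) p * c p + pd l L p * pd k c p + (pd k L p * c' p + L p * pd k c' p) := by
    intro c c' hc hc'
    rw [pd_add k (dL'.fun_mul hc) (dL.fun_mul hc'), pd_mul k dL' hc, pd_mul k dL hc']
  have h2 : ∀ {c c' : E n → ℝ}, DifferentiableAt ℝ c p → DifferentiableAt ℝ c' p →
      pd k (fun p => pd l Q p + pd l L p * c p ^ 2 + 2 * L p * c p * c' p) p
        = pd k (pd l Q) p + (pd k (pd l L) p * c p ^ 2 + pd l L p * (2 * c p * pd k c p))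
          + 2 * (pd k L p * c p * c' p + L p * pd k c p * c' p + L p * c p * pd k c' p) := by
    intro c c' hc hc'
    have e2 : (fun p => pd l Q p + pd l L p * c p ^ 2 + 2 * L p * c p * c' p)
        = fun p => pd l Q p + pd l L p * (c p * c p) + 2 * (L p * c p * c' p) := by
      funext p; ring
    rw [e2, pd_add k (dQ'.fun_add (dL'.fun_mul (hc.fun_mul hc))) (((dL.fun_mul hc).fun_mul
        hc').const_mul 2),
      pd_add k dQ' (dL'.fun_mul (hc.fun_mul hc)), pd_mul k dL' (hc.fun_mul hc), pd_mul k hc hc,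
      pd_const_mul k 2 ((dL.fun_mul hc).fun_mul hc'), pd_mul k (dL.fun_mul hc) hc', pd_mul k dL hc]
    ring
  have h3 : pd k (fun p => pd l L p * a p * b p + L p * pd l a p * b p + L p * a p * pd l b p) p
      = pd k (pd l L) p * a p * b p + pd l L p * pd k a p * b p + pd l L p * a p * pd k b p
        + (pd k L p * pd l a p * b p + L p * pd k (pd l a) p * b p + L p * pd l a p * pd k b p)
        + (pd k L p * a p * pd l b p + L p * pd k a p * pd l b p
          + L p * a p * pd k (pd l b) p) := by
    rw [pd_add k (((dL'.fun_mul da).fun_mul db).fun_add ((dL.fun_mul da').fun_mul db)) ((dL.fun_mul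
        da).fun_mul db'),
      pd_add k ((dL'.fun_mul da).fun_mul db) ((dL.fun_mul da').fun_mul db), pd_mul k (dL'.fun_mul
          da) db,
      pd_mul k dL' da, pd_mul k (dL.fun_mul da') db, pd_mul k dL da', pd_mul k (dL.fun_mul da) db',
      pd_mul k dL da]
    ring
  rw [e]
  fin_cases i <;> fin_cases j <;>
    simp [frameMetricD, frameMetricDD, h1 da da', h1 db db', h2 da da', h2 db db', h3] <;> ring

end FrameMetricDerivatives

end Meridian

/-! ### Scalar curvature and twist in terms of the profiles. -/

section MeridianCurvature

variable {g : E 3 → Mat 3}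

theorem eventually_pos (p : E 2) (hp : 0 < p 0) : ∀ᶠ q : E 2 in nhds p, 0 < q 0 :=
  (EuclideanSpace.proj (0 : Fin 2) : E 2 →L[ℝ] ℝ).continuous.continuousAt.eventually
    (lt_mem_nhds hp)

/-- The coordinates of space that restrict to those of the meridian plane. -/
def embed : Fin 2 → Fin 3 := ![0, 2]

theorem pd_comp_meridian {f : E 3 → ℝ} {p : E 2} (hf : DifferentiableAt ℝ f (meridian p))
    (k : Fin 2) : pd k (fun q => f (meridian q)) p = pd (embed k) f (meridian p) := by
  fin_cases k
  · exact pd_zero_comp_meridian hf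
  · exact pd_one_comp_meridian hf

theorem pd_pd_comp_meridian {f : E 3 → ℝ} (hf : ContDiff ℝ ∞ f) (p : E 2) (k l : Fin 2) :
    pd k (pd l fun q => f (meridian q)) p = pd (embed k) (pd (embed l) f) (meridian p) := by
  have h : (pd l fun q => f (meridian q)) = fun q => pd (embed l) f (meridian q) :=
    funext fun q => pd_comp_meridian (hf.differentiableAt_top _) l
  rw [h, pd_comp_meridian ((hf.pd _).differentiableAt_top _)]

/-- An axially symmetric Riemannian metric on `ℝ³` in isothermal coordinates. -/
structure IsothermalSlice (g : E 3 → Mat 3) (u : E 2 → ℝ) : Prop where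
  smooth : ∀ i j, ContDiff ℝ ∞ fun x => g x i j
  posDef : ∀ x, (g x).PosDef
  axial : ∀ x, lieTensor eta g x = 0
  isothermal : ∀ p : E 2, 0 < p 0 →
    onMeridian (quotientMetric g) p = Real.exp (2 * u p) • (1 : Mat 2)

namespace IsothermalSlice

variable {u : E 2 → ℝ}

theorem contDiff_profL (h : IsothermalSlice g u) : ContDiff ℝ ∞ (profL g) := AxiMass.contDiff_profL
    h.smooth

theorem contDiff_profA (h : IsothermalSlice g u) : ContDiff ℝ ∞ (profA g) := AxiMass.contDiff_profA
    h.smooth h.posDef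

theorem contDiff_profB (h : IsothermalSlice g u) : ContDiff ℝ ∞ (profB g) := AxiMass.contDiff_profB
    h.smooth h.posDef

theorem contDiff_profQ (h : IsothermalSlice g u) : ContDiff ℝ ∞ (profQ g) := AxiMass.contDiff_profQ
    h.smooth h.posDef

theorem profL_pos (h : IsothermalSlice g u) (p : E 2) : 0 < profL g p := AxiMass.profL_pos h.posDef
    p

theorem profQ_pos (h : IsothermalSlice g u) (p : E 2) : 0 < profQ g p := AxiMass.profQ_pos h.posDef
    p

theorem eq_frameMetric (h : IsothermalSlice g u) {p : E 2} (hp : 0 < p 0) :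
    g (meridian p) = frameMetric (profQ g p) (profL g p) (profA g p) (profB g p) :=
  metric_eq_frameMetric h.posDef hp (h.isothermal p hp)

theorem tensorPd_meridian (h : IsothermalSlice g u) {p : E 2} (hp : 0 < p 0) (k : Fin 2) :
    tensorPd g (embed k) (meridian p) = frameMetricD (profL g p) (profA g p) (profB g p)
      (pd k (profQ g) p) (pd k (profL g) p) (pd k (profA g) p) (pd k (profB g) p) := by
  ext i j
  rw [← pd_frameMetric (h.contDiff_profQ.differentiableAt_top p)
    (h.contDiff_profL.differentiableAt_top p)
    (h.contDiff_profA.differentiableAt_top p)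
    (h.contDiff_profB.differentiableAt_top p)]
  simp only [tensorPd, Matrix.of_apply]
  rw [← pd_comp_meridian ((h.smooth i j).differentiableAt_top _)]
  apply pd_congr
  -- The normal form holds on the open set `ρ > 0`, so it may be differentiated there.
  filter_upwards [eventually_pos p hp] with q hq
  rw [h.eq_frameMetric hq]

theorem tensorPdPd_meridian (h : IsothermalSlice g u) {p : E 2} (hp : 0 < p 0) (k l : Fin 2) :
    tensorPdPd g (embed k) (embed l) (meridian p)
      = frameMetricDD (profL g p) (profA g p) (profB g p)
          (pd k (profL g) p) (pd k (profA g) p) (pd k (profB g) p)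
          (pd l (profL g) p) (pd l (profA g) p) (pd l (profB g) p)
          (pd k (pd l (profQ g)) p) (pd k (pd l (profL g)) p)
          (pd k (pd l (profA g)) p) (pd k (pd l (profB g)) p) := by
  ext i j
  rw [← pd_pd_frameMetric h.contDiff_profQ h.contDiff_profL h.contDiff_profA h.contDiff_profB]
  simp only [tensorPdPd, Matrix.of_apply]
  rw [← pd_pd_comp_meridian (h.smooth i j)]
  apply pd_pd_congr
  filter_upwards [eventually_pos p hp] with q hq
  rw [h.eq_frameMetric hq]

end IsothermalSlice

/-- The curvature `∂_ρ b - b / ρ - ∂_z a` of the connection of the rotations. -/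
def connectionCurvature (g : E 3 → Mat 3) (p : E 2) : ℝ :=
  pd 0 (profB g) p - profB g p / p 0 - pd 1 (profA g) p

theorem frameJet_symm (x Q L a b Qx Lx ax bx Qz Lz az bz : ℝ) (m n p : Fin 3) :
    frameJet x Q L a b Qx Lx ax bx Qz Lz az bz m n p
      = frameJet x Q L a b Qx Lx ax bx Qz Lz az bz m p n := by
  fin_cases m <;> fin_cases n <;> fin_cases p <;> rfl

theorem scalarCurvature_eq (hg : ∀ i j, ContDiff ℝ ∞ fun x => g x i j)
    (hpos : ∀ x, (g x).PosDef) (x : E 3) :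
    scalarCurvature g x = ∑ i, ∑ j, (g x)⁻¹ i j * ∑ k, ∑ b, (g x)⁻¹ k b *
      (firstKindD (fun k l => tensorPdPd g k l x) k i j b
        - firstKindD (fun k l => tensorPdPd g k l x) j i k b
        - ∑ l, ∑ c, (g x)⁻¹ l c * (firstKind (fun k => tensorPd g k x) k b l
            * firstKind (fun k => tensorPd g k x) i j c
          - firstKind (fun k => tensorPd g k x) j b l
            * firstKind (fun k => tensorPd g k x) i k c)) := by
  simp only [scalarCurvature, trace]
  refine Finset.sum_congr rfl fun i _ => Finset.sum_congr rfl fun j _ => ?_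
  rw [ricci_eq hg (fun x i j => (hpos x).apply_comm i j) (fun x => (hpos x).det_pos.ne')]
  simp only [pd_christoffelFirst hg, christoffelFirst_eq]

/-- Twice the sum of the three normalized plane curvatures. The O'Neill terms add up to `2 (1/4 +
1/4 - 3/4) = -1/2`, which is the coefficient that cancels the twist in the mass density. -/
theorem IsothermalSlice.scalarCurvature_meridian {u : E 2 → ℝ} (h : IsothermalSlice g u)
    {p : E 2} (hp : 0 < p 0) :
    profQ g p * scalarCurvature g (meridian p)
      = -(pd 0 (pd 0 (profQ g)) p + pd 1 (pd 1 (profQ g)) p) / profQ g p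
        + (pd 0 (profQ g) p ^ 2 + pd 1 (profQ g) p ^ 2) / profQ g p ^ 2
        - (pd 0 (pd 0 (profL g)) p + pd 1 (pd 1 (profL g)) p) / profL g p
        + (pd 0 (profL g) p ^ 2 + pd 1 (profL g) p ^ 2) / (2 * profL g p ^ 2)
        - 2 * pd 0 (profL g) p / (p 0 * profL g p)
        - profL g p * connectionCurvature g p ^ 2 / (2 * profQ g p) := by
  have hQ := (h.profQ_pos p).ne'
  have hL := (h.profL_pos p).ne'
  have hinv : ∀ i j, (g (meridian p))⁻¹ i j = ∑ m, ![(profQ g p)⁻¹, (profL g p)⁻¹, (profQ g p)⁻¹] m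
      * shearFrame (profA g p) (profB g p) m i * shearFrame (profA g p) (profB g p) m j := by
    intro i j
    rw [h.eq_frameMetric hp]
    exact frameMetric_inv hQ hL i j
  have hx0 : meridian p 0 = p 0 := meridian_zero p
  have hp0 : p 0 ≠ 0 := hp.ne'
  have hx : meridian p 0 ≠ 0 := by rw [hx0]; exact hp0
  have hD0 : tensorPd g 0 (meridian p) = _ := h.tensorPd_meridian hp 0
  have hD2 : tensorPd g 2 (meridian p) = _ := h.tensorPd_meridian hp 1
  have hD00 : tensorPdPd g 0 0 (meridian p) = _ := h.tensorPdPd_meridian hp 0 0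
  have hD02 : tensorPdPd g 0 2 (meridian p) = _ := h.tensorPdPd_meridian hp 0 1
  have hD22 : tensorPdPd g 2 2 (meridian p) = _ := h.tensorPdPd_meridian hp 1 1
  have hj1 : ∀ k, tensorPd g k (meridian p) = jet1 (p 0)
      (frameMetric (profQ g p) (profL g p) (profA g p) (profB g p))
      (frameMetricD (profL g p) (profA g p) (profB g p) (pd 0 (profQ g) p) (pd 0 (profL g) p)
        (pd 0 (profA g) p) (pd 0 (profB g) p))
      (frameMetricD (profL g p) (profA g p) (profB g p) (pd 1 (profQ g) p) (pd 1 (profL g) p)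
        (pd 1 (profA g) p) (pd 1 (profB g) p)) k := by
    intro k
    rw [tensorPd_eq_jet1 h.axial hx (meridian_one p) k, hD0, hD2, hx0, h.eq_frameMetric hp]
  have hj2 : (fun k l => tensorPdPd g k l (meridian p)) = frameMetricJet2 (p 0) (profQ g p)
      (profL g p) (profA g p) (profB g p) (pd 0 (profQ g) p) (pd 0 (profL g) p)
      (pd 0 (profA g) p) (pd 0 (profB g) p) (pd 1 (profQ g) p) (pd 1 (profL g) p)
      (pd 1 (profA g) p) (pd 1 (profB g) p) (pd 0 (pd 0 (profQ g)) p) (pd 0 (pd 0 (profL g)) p)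
      (pd 0 (pd 0 (profA g)) p) (pd 0 (pd 0 (profB g)) p) (pd 0 (pd 1 (profQ g)) p)
      (pd 0 (pd 1 (profL g)) p) (pd 0 (pd 1 (profA g)) p) (pd 0 (pd 1 (profB g)) p)
      (pd 1 (pd 1 (profQ g)) p) (pd 1 (pd 1 (profL g)) p) (pd 1 (pd 1 (profA g)) p)
      (pd 1 (pd 1 (profB g)) p) := by
    funext k l
    rw [tensorPdPd_eq_jet2 h.smooth h.axial hx (meridian_one p) k l, hD00, hD02, hD22, hD0, hD2,
      hx0, h.eq_frameMetric hp]
    rfl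
  rw [scalarCurvature_eq h.smooth h.posDef, frame_contraction hinv, sum_frame_eq _ _ _ _ _ _
    (frameJet (p 0) (profQ g p) (profL g p) (profA g p) (profB g p) (pd 0 (profQ g) p)
      (pd 0 (profL g) p) (pd 0 (profA g) p) (pd 0 (profB g) p) (pd 1 (profQ g) p)
      (pd 1 (profL g) p) (pd 1 (profA g) p) (pd 1 (profB g) p)) (frameJet_symm _ _ _ _ _ _ _ _ _ _
          _ _ _), hj2,
    framePlaneCurvature_zero_one _ _ _ _ _ _ _ _ _ _ _ _ _ _ _ _ _ _ _ _ _ _ _ _ _ hp0 hQ hL,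
    framePlaneCurvature_zero_two _ _ _ _ _ _ _ _ _ _ _ _ _ _ _ _ _ _ _ _ _ _ _ _ _ hp0 hQ hL,
    framePlaneCurvature_one_two _ _ _ _ _ _ _ _ _ _ _ _ _ _ _ _ _ _ _ _ _ _ _ _ _ hp0 hQ hL]
  · simp only [Matrix.cons_val_zero, Matrix.cons_val_one, Matrix.cons_val]
    rw [← connectionCurvature]
    field_simp
    ring
  · intro m n q
    rw [← frame3_jet1 _ _ _ _ _ _ _ _ _ _ _ _ _ hp0]
    simp only [hj1]
  · intro k l i j
    exact congrFun (congrArg (fun f => pd k (pd l f))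
      (funext fun y => (h.posDef y).apply_comm i j)) _
  · intro k l i j
    rw [tensorPdPd_comm h.smooth]

theorem sum_perm_fin_three (F : Fin 3 → Fin 3 → Fin 3 → ℝ) :
    ∑ s : Equiv.Perm (Fin 3), ((Equiv.Perm.sign s : ℤ) : ℝ) * F (s 0) (s 1) (s 2)
      = F 0 1 2 - F 0 2 1 - F 1 0 2 + F 1 2 0 + F 2 0 1 - F 2 1 0 := by
  have h : (Finset.univ : Finset (Equiv.Perm (Fin 3))) = {1, Equiv.swap 0 1, Equiv.swap 0 2,
      Equiv.swap 1 2, Equiv.swap 0 1 * Equiv.swap 1 2, Equiv.swap 1 2 * Equiv.swap 0 1} := by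
    decide
  rw [h]
  repeat rw [Finset.sum_insert (by decide)]
  rw [Finset.sum_singleton]
  simp [Equiv.swap_apply_def]
  ring

theorem christoffel_comm (hsym : ∀ x i j, g x i j = g x j i) (k i j : Fin 3) (x : E 3) :
    christoffel g k i j x = christoffel g k j i x := by
  have h : (fun y => g y i j) = fun y => g y j i := funext fun y => hsym y i j
  simp only [christoffel, h]
  congr 1
  exact Finset.sum_congr rfl fun l _ => by ring

theorem pd_etaLow_meridian (hg : ∀ i j, ContDiff ℝ ∞ fun x => g x i j) (b c : Fin 3) (p : E 2) :
    pd b (fun y => etaLow g y c) (meridian p) = tensorPd g b (meridian p) c 1 * p 0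
      + g (meridian p) c 1 * (if (0 : Fin 3) = b then 1 else 0)
      - g (meridian p) c 0 * (if (1 : Fin 3) = b then 1 else 0) := by
  have h : (fun y => etaLow g y c) = fun y => g y c 1 * y 0 - g y c 0 * y 1 := by
    funext y
    simp [etaLow, Fin.sum_univ_three, eta]; ring
  have hc : ∀ l : Fin 3, DifferentiableAt ℝ (fun y : E 3 => y l) (meridian p) := fun l =>
    (EuclideanSpace.proj l : E 3 →L[ℝ] ℝ).differentiableAt
  have hd := fun i j => (hg i j).differentiableAt_top (meridian p)
  rw [h, pd_sub (f := fun y => g y c 1 * y 0) (g := fun y => g y c 0 * y 1) b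
    ((hd c 1).mul (hc 0)) ((hd c 0).mul (hc 1)), pd_mul b (hd c 1) (hc 0),
    pd_mul b (hd c 0) (hc 1), pd_coord, pd_coord, meridian_zero, meridian_one]
  simp only [tensorPd, Matrix.of_apply]
  ring

/-- The lowered rotation field is `λ² (dφ + A)` with `A = (a dρ + b dz) / ρ`, hence `η ∧ dη = λ⁴ (dφ
+ A) ∧ dA`, and `connectionCurvature` is `ρ` times the coefficient of `dA`. The square makes the
orientation irrelevant. -/
theorem IsothermalSlice.twist_sq_meridian {u : E 2 → ℝ} (h : IsothermalSlice g u)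
    {p : E 2} (hp : 0 < p 0) :
    profQ g p * twist g (meridian p) ^ 2 / normEtaSq g (meridian p) ^ 2
      = profL g p * connectionCurvature g p ^ 2 / profQ g p := by
  have hQ := h.profQ_pos p
  have hL := h.profL_pos p
  have hp0 : p 0 ≠ 0 := hp.ne'
  have hsym : ∀ x i j, g x i j = g x j i := fun x i j => (h.posDef x).apply_comm i j
  have hx0 : meridian p 0 = p 0 := meridian_zero p
  have hx : meridian p 0 ≠ 0 := by rw [hx0]; exact hp0
  have hD0 : tensorPd g 0 (meridian p) = _ := h.tensorPd_meridian hp 0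
  have hD2 : tensorPd g 2 (meridian p) = _ := h.tensorPd_meridian hp 1
  have hD1 : tensorPd g 1 (meridian p) = (p 0)⁻¹ • rotate (g (meridian p)) := by
    rw [← hx0]
    exact tensorPd_eq_jet1 h.axial hx (meridian_one p) 1
  have hG := h.eq_frameMetric hp
  have hdet : (g (meridian p)).det = profQ g p ^ 2 * profL g p := by
    rw [hG, Matrix.det_fin_three]
    simp [frameMetric]
    ring
  have hsq : (Real.sqrt (g (meridian p)).det)⁻¹ ^ 2 = (profQ g p ^ 2 * profL g p)⁻¹ := by
    rw [hdet, inv_pow, Real.sq_sqrt (by positivity)]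
  have hsum : ∑ s : Equiv.Perm (Fin 3), ((Equiv.Perm.sign s : ℤ) : ℝ) *
      (etaLow g (meridian p) (s 0) * (pd (s 1) (fun y => etaLow g y (s 2)) (meridian p)
        - ∑ k, christoffel g k (s 1) (s 2) (meridian p) * etaLow g (meridian p) k))
      = p 0 ^ 2 * profL g p ^ 2 * connectionCurvature g p * (-1) := by
    rw [sum_perm_fin_three fun a b c => etaLow g (meridian p) a *
      (pd b (fun y => etaLow g y c) (meridian p)
        - ∑ k, christoffel g k b c (meridian p) * etaLow g (meridian p) k)]
    -- The Christoffel terms are symmetric in the two indices being antisymmetrized, so they cancel.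
    simp only [christoffel_comm hsym _ 1 0, christoffel_comm hsym _ 2 0,
      christoffel_comm hsym _ 2 1, pd_etaLow_meridian h.smooth, hD0, hD1, hD2, etaLow_meridian, hG,
      connectionCurvature]
    simp [frameMetric, frameMetricD, rotate]
    field_simp
    ring
  rw [twist, mul_pow, hsq, hsum, normEtaSq_meridian]
  field_simp

end MeridianCurvature

/-! ### The mass density as a divergence -/

section Flux

variable {g : E 3 → Mat 3} {u : E 2 → ℝ}

/-- The logarithm of `profL`, that is `σ`. -/
def logL (g : E 3 → Mat 3) (p : E 2) : ℝ := Real.log (profL g p)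

/-- The logarithm of `profQ`, that is `2 u`. -/
def logQ (g : E 3 → Mat 3) (p : E 2) : ℝ := Real.log (profQ g p)

/-- The sum `2 u + σ`. -/
def logSum (g : E 3 → Mat 3) (p : E 2) : ℝ := logQ g p + logL g p

/-- The `ρ` component of the mass flux. -/
def fluxRho (g : E 3 → Mat 3) (p : E 2) : ℝ :=
  -2 * (p 0 * pd 0 (logSum g) p) + 2 * (logQ g p - logL g p)

/-- The `z` component of the mass flux. -/
def fluxZ (g : E 3 → Mat 3) (p : E 2) : ℝ := -2 * (p 0 * pd 1 (logSum g) p)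

theorem contDiff_coord {n : ℕ} (i : Fin n) : ContDiff ℝ ∞ fun p : E n => p i :=
  (EuclideanSpace.proj i : E n →L[ℝ] ℝ).contDiff

namespace IsothermalSlice

theorem contDiff_logL (h : IsothermalSlice g u) : ContDiff ℝ ∞ (logL g) :=
  h.contDiff_profL.log fun p => (h.profL_pos p).ne'

theorem contDiff_logQ (h : IsothermalSlice g u) : ContDiff ℝ ∞ (logQ g) :=
  h.contDiff_profQ.log fun p => (h.profQ_pos p).ne'

theorem contDiff_logSum (h : IsothermalSlice g u) : ContDiff ℝ ∞ (logSum g) :=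
  h.contDiff_logQ.add h.contDiff_logL

theorem contDiff_fluxRho (h : IsothermalSlice g u) : ContDiff ℝ ∞ (fluxRho g) :=
  (contDiff_const.mul ((contDiff_coord 0).mul (h.contDiff_logSum.pd 0))).add
    (contDiff_const.mul (h.contDiff_logQ.sub h.contDiff_logL))

theorem contDiff_fluxZ (h : IsothermalSlice g u) : ContDiff ℝ ∞ (fluxZ g) :=
  contDiff_const.mul ((contDiff_coord 0).mul (h.contDiff_logSum.pd 1))

theorem pd_logL (h : IsothermalSlice g u) (i : Fin 2) (p : E 2) :
    pd i (logL g) p = pd i (profL g) p / profL g p :=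
  pd_log i (h.contDiff_profL.differentiableAt_top p) (h.profL_pos p).ne'

theorem pd_logQ (h : IsothermalSlice g u) (i : Fin 2) (p : E 2) :
    pd i (logQ g) p = pd i (profQ g) p / profQ g p :=
  pd_log i (h.contDiff_profQ.differentiableAt_top p) (h.profQ_pos p).ne'

theorem pd_pd_logL (h : IsothermalSlice g u) (i j : Fin 2) (p : E 2) :
    pd i (pd j (logL g)) p = (pd i (pd j (profL g)) p * profL g p
      - pd j (profL g) p * pd i (profL g) p) / profL g p ^ 2 := by
  have e : pd j (logL g) = fun p => pd j (profL g) p / profL g p := funext (h.pd_logL j)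
  rw [e, pd_div i ((h.contDiff_profL.pd j).differentiableAt_top p)
    (h.contDiff_profL.differentiableAt_top p) (h.profL_pos p).ne']

theorem pd_pd_logQ (h : IsothermalSlice g u) (i j : Fin 2) (p : E 2) :
    pd i (pd j (logQ g)) p = (pd i (pd j (profQ g)) p * profQ g p
      - pd j (profQ g) p * pd i (profQ g) p) / profQ g p ^ 2 := by
  have e : pd j (logQ g) = fun p => pd j (profQ g) p / profQ g p := funext (h.pd_logQ j)
  rw [e, pd_div i ((h.contDiff_profQ.pd j).differentiableAt_top p)
    (h.contDiff_profQ.differentiableAt_top p) (h.profQ_pos p).ne']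

theorem pd_logSum (h : IsothermalSlice g u) (i : Fin 2) (p : E 2) :
    pd i (logSum g) p = pd i (logQ g) p + pd i (logL g) p :=
  pd_add i (h.contDiff_logQ.differentiableAt_top p) (h.contDiff_logL.differentiableAt_top p)

theorem pd_pd_logSum (h : IsothermalSlice g u) (i j : Fin 2) (p : E 2) :
    pd i (pd j (logSum g)) p = pd i (pd j (logQ g)) p + pd i (pd j (logL g)) p := by
  have e : pd j (logSum g) = fun p => pd j (logQ g) p + pd j (logL g) p := funext (h.pd_logSum j)
  rw [e, pd_add i ((h.contDiff_logQ.pd j).differentiableAt_top p)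
    ((h.contDiff_logL.pd j).differentiableAt_top p)]

/-- The summand `2 (logQ - logL)` of `fluxRho` turns the first order term `-2 ∂_ρ logSum` into `-4
∂_ρ logL`, as the mass density requires. -/
theorem divergence_flux (h : IsothermalSlice g u) (p : E 2) :
    pd 0 (fluxRho g) p + pd 1 (fluxZ g) p
      = -2 * p 0 * (pd 0 (pd 0 (logSum g)) p + pd 1 (pd 1 (logSum g)) p)
        - 4 * pd 0 (logL g) p := by
  have d0 : DifferentiableAt ℝ (fun p : E 2 => p 0) p := (contDiff_coord 0).differentiableAt_top p
  have dW := fun i => (h.contDiff_logSum.pd i).differentiableAt_top p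
  have dQ := h.contDiff_logQ.differentiableAt_top p
  have dL := h.contDiff_logL.differentiableAt_top p
  have e1 : pd 0 (fluxRho g) p
      = -2 * (pd 0 (logSum g) p + p 0 * pd 0 (pd 0 (logSum g)) p)
        + 2 * (pd 0 (logQ g) p - pd 0 (logL g) p) := by
    unfold fluxRho
    rw [pd_add 0 ((differentiableAt_const (-2)).fun_mul (d0.fun_mul (dW 0)))
      ((differentiableAt_const 2).fun_mul (dQ.fun_sub dL)), pd_const_mul 0 _ (d0.fun_mul (dW 0)),
      pd_const_mul 0 _ (dQ.fun_sub dL), pd_mul 0 d0 (dW 0), pd_sub 0 dQ dL, pd_coord]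
    simp
  have e2 : pd 1 (fluxZ g) p = -2 * (p 0 * pd 1 (pd 1 (logSum g)) p) := by
    unfold fluxZ
    rw [pd_const_mul 1 _ (d0.fun_mul (dW 1)), pd_mul 1 d0 (dW 1), pd_coord]
    simp
  rw [e1, e2, h.pd_logSum]
  ring

/-- Absence of a conical singularity. On the axis rotation invariance forces `g_xx = g_yy` and `g_xy
= g_yz = 0`, while `q_ρρ = q_zz` extends from `ρ > 0` by continuity. -/
theorem eq_on_axis (h : IsothermalSlice g u) {p : E 2} (hp : p 0 = 0) :
    profQ g p = profL g p := by
  have hcont : ∀ i j, Continuous fun s : ℝ => g (meridian !₂[s, p 1]) i j := fun i j =>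
    ((h.smooth i j).comp contDiff_meridian).continuous.comp (by fun_prop)
  have hp' : !₂[(0 : ℝ), p 1] = p := by
    ext i; fin_cases i <;> simp [hp]
  have hax := fun i j => axial_eq h.axial (meridian p) i j
  simp only [meridian_zero, meridian_one, hp, zero_mul, sub_zero] at hax
  have h01 := hax 0 0
  have h00 := hax 0 1
  have h12 := hax 0 2
  simp [rotate] at h01 h00 h12
  rw [(h.posDef _).apply_comm 1 0] at h01
  have g01 : g (meridian p) 0 1 = 0 := by linarith
  let F : ℝ → ℝ := fun s => (g (meridian !₂[s, p 1]) 0 0 - g (meridian !₂[s, p 1]) 0 1 ^ 2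
    / g (meridian !₂[s, p 1]) 1 1) - (g (meridian !₂[s, p 1]) 2 2
    - g (meridian !₂[s, p 1]) 1 2 ^ 2 / g (meridian !₂[s, p 1]) 1 1)
  have hF : Continuous F :=
    ((hcont 0 0).sub (((hcont 0 1).pow 2).div (hcont 1 1) fun s => (h.profL_pos _).ne')).sub
      ((hcont 2 2).sub (((hcont 1 2).pow 2).div (hcont 1 1) fun s => (h.profL_pos _).ne'))
  have hF0 : ∀ s ∈ Set.Ioi (0 : ℝ), F s = 0 := by
    intro s hs
    have hq : 0 < (!₂[s, p 1] : E 2) 0 := by simpa using hs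
    have hL := (h.profL_pos !₂[s, p 1]).ne'
    have hL1 : g (meridian !₂[s, p 1]) 1 1 = profL g !₂[s, p 1] := rfl
    simp only [F]
    rw [hL1, h.eq_frameMetric hq]
    simp [frameMetric]
    field_simp
    ring
  have hz : F 0 = 0 := by
    have hcl : (0 : ℝ) ∈ closure (Set.Ioi (0 : ℝ)) := by rw [closure_Ioi]; simp
    have := closure_minimal (s := Set.Ioi (0 : ℝ)) (t := {s | F s = 0}) hF0
      (isClosed_eq hF continuous_const)
    exact this hcl
  simp only [F, hp', g01] at hz
  rw [profQ, profL]
  simp at hz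
  linarith

/-- This removes the side on the axis from the divergence theorem. -/
theorem fluxRho_axis (h : IsothermalSlice g u) {p : E 2} (hp : p 0 = 0) : fluxRho g p = 0 := by
  simp [fluxRho, logQ, logL, h.eq_on_axis hp, hp]

end IsothermalSlice

theorem normSq_eq_sum_frame {G K : Mat 3} {P : Fin 3 → Fin 3 → ℝ} {d : Fin 3 → ℝ}
    (hH : ∀ i j, G⁻¹ i j = ∑ m, d m * P m i * P m j) :
    normSq G K = ∑ m, ∑ n, d m * d n * (∑ i, ∑ j, P m i * P n j * K i j) ^ 2 := by
  simp only [normSq]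
  have h1 : ∀ i j, ∑ k, ∑ l, G⁻¹ i k * G⁻¹ j l * K i j * K k l
      = ∑ m, ∑ n, d m * d n * (P m i * P n j * K i j) * ∑ k, ∑ l, P m k * P n l * K k l := by
    intro i j
    simp only [hH, Fin.sum_univ_three]
    ring
  simp only [h1]
  generalize hX : (fun m n => ∑ k, ∑ l, P m k * P n l * K k l) = X
  have hX' : ∀ m n, ∑ k, ∑ l, P m k * P n l * K k l = X m n := fun m n => by rw [← hX]
  simp only [hX', pow_two]
  have h2 : ∀ m n, d m * d n * (X m n * X m n)
      = ∑ i, ∑ j, d m * d n * (P m i * P n j * K i j) * X m n := by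
    intro m n
    rw [← mul_assoc]
    nth_rewrite 1 [← hX']
    simp only [Finset.mul_sum, Finset.sum_mul]
  simp only [h2]
  simp only [Fin.sum_univ_three]
  ring

/-- In the orthogonal frame the norm is a sum of squares with positive weights. -/
theorem IsothermalSlice.normSq_nonneg (h : IsothermalSlice g u) {p : E 2} (hp : 0 < p 0)
    (K : Mat 3) : 0 ≤ normSq (g (meridian p)) K := by
  have hQ := h.profQ_pos p
  have hL := h.profL_pos p
  have hinv : ∀ i j, (g (meridian p))⁻¹ i j = ∑ m, ![(profQ g p)⁻¹, (profL g p)⁻¹, (profQ g p)⁻¹] m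
      * shearFrame (profA g p) (profB g p) m i * shearFrame (profA g p) (profB g p) m j := by
    intro i j
    rw [h.eq_frameMetric hp]
    exact frameMetric_inv hQ.ne' hL.ne' i j
  rw [normSq_eq_sum_frame hinv]
  have hd : ∀ m, 0 ≤ ![(profQ g p)⁻¹, (profL g p)⁻¹, (profQ g p)⁻¹] m := by
    intro m; fin_cases m <;> simp <;> positivity
  exact Finset.sum_nonneg fun m _ => Finset.sum_nonneg fun n _ =>
    mul_nonneg (mul_nonneg (hd m) (hd n)) (sq_nonneg _)

end Flux

/-! ### The constraint equation on a slice and the mass density. -/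

namespace MaximalIsothermalEvolution

variable {J : Set ℝ} (S : MaximalIsothermalEvolution J)

theorem isothermalSlice {t : ℝ} (ht : t ∈ J) : IsothermalSlice (S.γ t) (S.u t) where
  smooth i j := by
    have h := (S.smooth_γ i j).comp (s := Set.univ) (f := fun x : E 3 => (t, x))
      (contDiff_const.prodMk contDiff_id).contDiffOn fun _ _ => ⟨ht, trivial⟩
    exact contDiffOn_univ.1 h
  posDef := S.posDef_γ t ht
  axial := S.axial_γ t ht
  isothermal := S.isothermal t ht

theorem sigma_eq_logL {t : ℝ} (ht : t ∈ J) {p : E 2} (hp : 0 < p 0) :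
    S.σ t p = logL (S.γ t) p := by
  have h := S.norm_eta t ht p hp
  have hL := (S.isothermalSlice ht).profL_pos p
  rw [normEtaSq_meridian, Real.sqrt_mul hL.le, Real.sqrt_sq hp.le, mul_comm] at h
  have h2 := mul_left_cancel₀ hp.ne' h
  have h3 : profL (S.γ t) p = Real.exp (S.σ t p) := by
    rw [← Real.sq_sqrt hL.le, h2, ← Real.exp_nat_mul]
    congr 1; push_cast; ring
  rw [logL, h3, Real.log_exp]

theorem massDensity_nonneg {t : ℝ} (ht : t ∈ J) {p : E 2} (hp : 0 < p 0) :
    0 ≤ S.massDensity t p := by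
  have := (S.isothermalSlice ht).normSq_nonneg hp (S.K t (meridian p))
  unfold massDensity
  positivity

/-- Maximality and the Hamiltonian constraint give `K^{ab} K_{ab} = R`. The quadratic terms of `2 Q
R` are then exactly `-|∂σ|²` and minus the twist term, so only second derivatives of `logSum` and
`∂_ρ σ / ρ` are left. -/
theorem massDensity_mul_eq {t : ℝ} (ht : t ∈ J) {p : E 2} (hp : 0 < p 0) :
    S.massDensity t p * p 0 = pd 0 (fluxRho (S.γ t)) p + pd 1 (fluxZ (S.γ t)) p := by
  have h := S.isothermalSlice ht
  have hQ := (h.profQ_pos p).ne'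
  have hL := (h.profL_pos p).ne'
  have hσ : ∀ i, pd i (S.σ t) p = pd i (logL (S.γ t)) p := fun i => by
    apply pd_congr
    filter_upwards [eventually_pos p hp] with q hq using S.sigma_eq_logL ht hq
  have hK : normSq (S.γ t (meridian p)) (S.K t (meridian p))
      = scalarCurvature (S.γ t) (meridian p) := by
    have := (S.constraints t ht).2 (meridian p)
    rw [S.maximal t ht] at this
    linarith
  have htw := h.twist_sq_meridian hp
  have hR := h.scalarCurvature_meridian hp
  have hu : Real.exp (2 * S.u t p) = profQ (S.γ t) p :=
    (profQ_eq_exp h.posDef hp (h.isothermal p hp)).symm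
  rw [massDensity, hσ, hσ, hu, htw, hK, mul_assoc 2, hR, h.divergence_flux]
  simp only [h.pd_pd_logSum, h.pd_pd_logL, h.pd_pd_logQ, h.pd_logL]
  have hp0 := hp.ne'
  field_simp
  ring

end MaximalIsothermalEvolution

open MeasureTheory Filter

/-! ### The mass as a limit of boundary integrals -/

section Mass

/-- Cartesian coordinates on the plane. -/
def planeEquiv : (ℝ × ℝ) ≃L[ℝ] E 2 :=
  (ContinuousLinearEquiv.finTwoArrow ℝ ℝ).symm.trans (EuclideanSpace.equiv (Fin 2) ℝ).symm

theorem planeEquiv_apply_zero (q : ℝ × ℝ) : planeEquiv q 0 = q.1 := rfl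

theorem planeEquiv_apply_one (q : ℝ × ℝ) : planeEquiv q 1 = q.2 := rfl

theorem planeEquiv_fst : planeEquiv (1, 0) = EuclideanSpace.single 0 1 := by
  ext i; fin_cases i
  · simp [planeEquiv_apply_zero]
  · simp [planeEquiv_apply_one]

theorem planeEquiv_snd : planeEquiv (0, 1) = EuclideanSpace.single 1 1 := by
  ext i; fin_cases i
  · simp [planeEquiv_apply_zero]
  · simp [planeEquiv_apply_one]

theorem measurePreserving_planeEquiv : MeasurePreserving planeEquiv volume volume :=
  (EuclideanSpace.volume_preserving_symm_measurableEquiv_toLp (Fin 2)).symm.comp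
    (volume_preserving_finTwoArrow ℝ).symm

/-- The boundary integral of a vector field over the rectangle `[0, n] × [-n, n]`, without the
side on the axis. -/
def boundaryFlux (F G : E 2 → ℝ) (n : ℝ) : ℝ :=
  ((∫ x in (0 : ℝ)..n, G (planeEquiv (x, n))) - ∫ x in (0 : ℝ)..n, G (planeEquiv (x, -n)))
    + ∫ y in (-n)..n, F (planeEquiv (n, y))

theorem integral_divergence_eq {F G : E 2 → ℝ} (hF : ContDiff ℝ ∞ F) (hG : ContDiff ℝ ∞ G)
    (haxis : ∀ p : E 2, p 0 = 0 → F p = 0) {n : ℝ} (hn : 0 ≤ n) :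
    ∫ q in Set.Icc (0, -n) (n, n), (pd 0 F (planeEquiv q) + pd 1 G (planeEquiv q))
      = boundaryFlux F G n := by
  have hd : ∀ {H : E 2 → ℝ}, ContDiff ℝ ∞ H → ∀ q : ℝ × ℝ, HasFDerivAt (fun q => H (planeEquiv q))
      ((fderiv ℝ H (planeEquiv q)).comp (planeEquiv : (ℝ × ℝ) →L[ℝ] E 2)) q := fun hH q =>
    (hH.differentiableAt_top _).hasFDerivAt.comp q planeEquiv.hasFDerivAt
  have hc : ∀ {H : E 2 → ℝ}, ContDiff ℝ ∞ H → Continuous fun q : ℝ × ℝ => H (planeEquiv q) :=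
    fun hH => hH.continuous.comp planeEquiv.continuous
  have h := integral_divergence_prod_Icc_of_hasFDerivAt_of_le
    (fun q => F (planeEquiv q)) (fun q => G (planeEquiv q)) _ _ ((0 : ℝ), -n) (n, n)
    ⟨hn, by simpa using hn⟩ (hc hF).continuousOn (hc hG).continuousOn
    (fun q _ => hd hF q) (fun q _ => hd hG q) (by
      have e : (fun q : ℝ × ℝ => ((fderiv ℝ F (planeEquiv q)).comp
          (planeEquiv : (ℝ × ℝ) →L[ℝ] E 2)) (1, 0) + ((fderiv ℝ G (planeEquiv q)).comp
          (planeEquiv : (ℝ × ℝ) →L[ℝ] E 2)) (0, 1))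
          = fun q => pd 0 F (planeEquiv q) + pd 1 G (planeEquiv q) := by
        funext q
        simp [pd, planeEquiv_fst, planeEquiv_snd]
      rw [e]
      exact ((hc (hF.pd 0)).add (hc (hG.pd 1))).continuousOn.integrableOn_compact isCompact_Icc)
  simp only [ContinuousLinearMap.comp_apply, ContinuousLinearEquiv.coe_coe, planeEquiv_fst,
    planeEquiv_snd] at h
  have h0 : ∀ y, F (planeEquiv (0, y)) = 0 := fun y => haxis _ rfl
  simp only [h0, intervalIntegral.integral_zero, sub_zero] at h
  exact h

theorem lintegral_rectangle_eq {F G f : E 2 → ℝ} (hF : ContDiff ℝ ∞ F) (hG : ContDiff ℝ ∞ G)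
    (haxis : ∀ p : E 2, p 0 = 0 → F p = 0) (hf : ∀ p : E 2, 0 < p 0 → f p = pd 0 F p + pd 1 G p)
    (hf0 : ∀ p : E 2, 0 < p 0 → 0 ≤ f p) {n : ℝ} (hn : 0 ≤ n) :
    ∫⁻ q in Set.Ioo 0 n ×ˢ Set.Ioo (-n) n, ENNReal.ofReal (f (planeEquiv q))
      = ENNReal.ofReal (boundaryFlux F G n) := by
  have hm : MeasurableSet (Set.Ioo 0 n ×ˢ Set.Ioo (-n) n) := measurableSet_Ioo.prod
      measurableSet_Ioo
  -- The density is known only for `ρ > 0`, while the divergence theorem is used on the closed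
  -- rectangle; the boundary is a null set.
  have hae : (Set.Ioo 0 n ×ˢ Set.Ioo (-n) n : Set (ℝ × ℝ)) =ᵐ[volume] Set.Icc (0, -n) (n, n) := by
    rw [← Set.Icc_prod_Icc]
    exact Measure.set_prod_ae_eq Ioo_ae_eq_Icc Ioo_ae_eq_Icc
  have hc : Continuous fun q : ℝ × ℝ => pd 0 F (planeEquiv q) + pd 1 G (planeEquiv q) :=
    ((hF.pd 0).continuous.comp planeEquiv.continuous).add
      ((hG.pd 1).continuous.comp planeEquiv.continuous)
  have hi : IntegrableOn (fun q : ℝ × ℝ => pd 0 F (planeEquiv q) + pd 1 G (planeEquiv q))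
      (Set.Ioo 0 n ×ˢ Set.Ioo (-n) n) :=
    (hc.continuousOn.integrableOn_compact isCompact_Icc).congr_set_ae hae
  have e : ∀ q ∈ Set.Ioo 0 n ×ˢ Set.Ioo (-n) n,
      f (planeEquiv q) = pd 0 F (planeEquiv q) + pd 1 G (planeEquiv q) := fun q hq =>
    hf _ hq.1.1
  rw [setLIntegral_congr_fun hm fun q hq => congrArg ENNReal.ofReal (e q hq),
    ← ofReal_integral_eq_lintegral_ofReal hi, setIntegral_congr_set hae,
    integral_divergence_eq hF hG haxis hn]
  rw [EventuallyLE, ae_restrict_iff' hm]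
  exact Eventually.of_forall fun q hq => (e q hq) ▸ hf0 _ hq.1.1

/-- Nonnegativity makes this monotone convergence over rectangles exhausting the half plane. No
integrability is needed, and an infinite limit is allowed. -/
theorem tendsto_boundaryFlux {F G f : E 2 → ℝ} (hF : ContDiff ℝ ∞ F) (hG : ContDiff ℝ ∞ G)
    (haxis : ∀ p : E 2, p 0 = 0 → F p = 0) (hf : ∀ p : E 2, 0 < p 0 → f p = pd 0 F p + pd 1 G p)
    (hf0 : ∀ p : E 2, 0 < p 0 → 0 ≤ f p) :
    Tendsto (fun n : ℕ => ENNReal.ofReal (boundaryFlux F G n)) atTop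
      (nhds (∫⁻ p in {p : E 2 | 0 < p 0}, ENNReal.ofReal (f p))) := by
  let B : ℕ → Set (ℝ × ℝ) := fun n => Set.Ioo 0 (n : ℝ) ×ˢ Set.Ioo (-(n : ℝ)) n
  have hB : Monotone B := by
    intro m n hmn
    have h : (m : ℝ) ≤ n := by exact_mod_cast hmn
    exact Set.prod_mono (Set.Ioo_subset_Ioo_right h) (Set.Ioo_subset_Ioo (neg_le_neg h) h)
  have hU : planeEquiv ⁻¹' {p : E 2 | 0 < p 0} = ⋃ n, B n := by
    ext q
    simp only [Set.mem_preimage, Set.mem_ofPred_eq, planeEquiv_apply_zero, Set.mem_iUnion, B,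
      Set.mem_prod, Set.mem_Ioo]
    constructor
    · intro h
      obtain ⟨n, hn⟩ := exists_nat_gt (max q.1 |q.2|)
      have h2 := abs_lt.1 ((le_max_right _ _).trans_lt hn)
      exact ⟨n, ⟨h, (le_max_left _ _).trans_lt hn⟩, h2⟩
    · rintro ⟨n, h, -⟩
      exact h.1
  have h1 : ∫⁻ p in {p : E 2 | 0 < p 0}, ENNReal.ofReal (f p)
      = ⨆ n, ∫⁻ q in B n, ENNReal.ofReal (f (planeEquiv q)) := by
    rw [← measurePreserving_planeEquiv.setLIntegral_comp_preimage_emb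
      planeEquiv.toHomeomorph.measurableEmbedding, hU,
      setLIntegral_iUnion_of_directed _ hB.directed_le]
  have h2 : ∀ n : ℕ, ∫⁻ q in B n, ENNReal.ofReal (f (planeEquiv q))
      = ENNReal.ofReal (boundaryFlux F G n) := fun n =>
    lintegral_rectangle_eq hF hG haxis hf hf0 n.cast_nonneg
  rw [h1]
  simp only [← h2]
  exact tendsto_atTop_iSup fun m n hmn => lintegral_mono_set (hB hmn)

end Mass

/-- Two sequences with vanishing difference have the same limit in `[0, ∞]`. -/
theorem eq_of_tendsto_ofReal {a b : ℕ → ℝ} {A B : ENNReal}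
    (ha : Tendsto (fun n => ENNReal.ofReal (a n)) atTop (nhds A))
    (hb : Tendsto (fun n => ENNReal.ofReal (b n)) atTop (nhds B))
    (hab : Tendsto (fun n => |a n - b n|) atTop (nhds 0)) : A = B := by
  have hε : Tendsto (fun n => ENNReal.ofReal |a n - b n|) atTop (nhds 0) := by
    simpa [Function.comp_def] using (ENNReal.continuous_ofReal.tendsto 0).comp hab
  have key : ∀ x y : ℝ, ENNReal.ofReal x ≤ ENNReal.ofReal y + ENNReal.ofReal |x - y| :=
    fun x y => (ENNReal.ofReal_le_ofReal (by linarith [le_abs_self (x - y)])).trans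
      ENNReal.ofReal_add_le
  have hab' := hb.add hε
  have hba' := ha.add hε
  rw [add_zero] at hab' hba'
  refine le_antisymm (le_of_tendsto_of_tendsto' ha hab' fun n => key _ _)
    (le_of_tendsto_of_tendsto' hb hba' fun n => ?_)
  rw [abs_sub_comm]
  exact key _ _

theorem MaximalIsothermalEvolution.mass_eq_of_tendsto {J : Set ℝ}
    (S : MaximalIsothermalEvolution J) {s t : ℝ} (hs : s ∈ J) (ht : t ∈ J)
    (h : Tendsto (fun n : ℕ => |boundaryFlux (fluxRho (S.γ s)) (fluxZ (S.γ s)) n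
      - boundaryFlux (fluxRho (S.γ t)) (fluxZ (S.γ t)) n|) atTop (nhds 0)) :
    S.mass s = S.mass t := by
  have key : ∀ t ∈ J, Tendsto
      (fun n : ℕ => ENNReal.ofReal (boundaryFlux (fluxRho (S.γ t)) (fluxZ (S.γ t)) n)) atTop
      (nhds (∫⁻ p in {p : E 2 | 0 < p 0}, ENNReal.ofReal (S.massDensity t p * p 0))) :=
    fun t ht => tendsto_boundaryFlux (S.isothermalSlice ht).contDiff_fluxRho
      (S.isothermalSlice ht).contDiff_fluxZ (fun p hp => (S.isothermalSlice ht).fluxRho_axis hp)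
      (fun p hp => S.massDensity_mul_eq ht hp)
      fun p hp => mul_nonneg (S.massDensity_nonneg ht hp) hp.le
  rw [mass, mass, eq_of_tendsto_ofReal (key s hs) (key t ht) h]

/-! ### Evolution of the quotient metric -/

section AxialVector

variable {N : E 3 → E 3}

theorem axial_vector_eq (hax : ∀ x, lieVec eta N x = 0) (p : E 2) :
    p 0 * pd 1 (fun y => N y 0) (meridian p) = -N (meridian p) 1 ∧
    p 0 * pd 1 (fun y => N y 1) (meridian p) = N (meridian p) 0 ∧
    p 0 * pd 1 (fun y => N y 2) (meridian p) = 0 := by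
  have h := fun i => congrFun (hax (meridian p)) i
  simp only [lieVec, lieFun, Fin.sum_univ_three, eta_apply_zero, eta_apply_one, eta_apply_two,
    meridian_zero, meridian_one, Pi.zero_apply] at h
  have h0 := h 0
  have h1 := h 1
  have h2 := h 2
  simp only [eta_apply_zero, eta_apply_one, eta_apply_two, pd_neg, pd_coord, pd_const] at h0 h1 h2
  simp at h0 h1 h2
  refine ⟨by linarith, by linarith, ?_⟩
  rcases h2 with h2 | h2 <;> simp [h2]

/-- The `y` component of the invariance equation is `ρ ∂_y N^y = N^x`. -/
theorem axial_vector_axis (hax : ∀ x, lieVec eta N x = 0) {p : E 2} (hp : p 0 = 0) :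
    N (meridian p) 0 = 0 := by
  have h := (axial_vector_eq hax p).2.1
  rw [hp, zero_mul] at h
  exact h.symm

end AxialVector

namespace MaximalIsothermalEvolution

variable {J : Set ℝ} (S : MaximalIsothermalEvolution J)

theorem contDiff_shift {t : ℝ} (ht : t ∈ J) (i : Fin 3) : ContDiff ℝ ∞ fun x => S.shift t x i := by
  have h := S.smooth_shift.comp (s := Set.univ) (f := fun x : E 3 => (t, x))
    (contDiff_const.prodMk contDiff_id).contDiffOn fun _ _ => ⟨ht, trivial⟩
  exact (EuclideanSpace.proj i : E 3 →L[ℝ] ℝ).contDiff.comp (contDiffOn_univ.1 h)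

theorem contDiff_K {t : ℝ} (ht : t ∈ J) (i j : Fin 3) : ContDiff ℝ ∞ fun x => S.K t x i j :=
  contDiffOn_univ.1 <| (S.smooth_K i j).comp (s := Set.univ) (f := fun x : E 3 => (t, x))
    (contDiff_const.prodMk contDiff_id).contDiffOn fun _ _ => ⟨ht, trivial⟩

theorem contDiff_lapse {t : ℝ} (ht : t ∈ J) : ContDiff ℝ ∞ (S.lapse t) :=
  contDiffOn_univ.1 <| S.smooth_lapse.comp (s := Set.univ) (f := fun x : E 3 => (t, x))
    (contDiff_const.prodMk contDiff_id).contDiffOn fun _ _ => ⟨ht, trivial⟩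

/-- The component `β^i` of the shift on the meridian plane. -/
def beta (i : Fin 2) (t : ℝ) (p : E 2) : ℝ := vecOnMeridian (S.shift t) p i

theorem beta_eq (i : Fin 2) (t : ℝ) :
    S.beta i t = fun p => S.shift t (meridian p) (embed i) := by
  funext p
  fin_cases i <;> rfl

theorem contDiff_beta {t : ℝ} (ht : t ∈ J) (i : Fin 2) : ContDiff ℝ ∞ (S.beta i t) := by
  rw [beta_eq]
  exact contDiff_comp_meridian (S.contDiff_shift ht _)

theorem beta_zero_axis {t : ℝ} (ht : t ∈ J) {p : E 2} (hp : p 0 = 0) : S.beta 0 t p = 0 := by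
  rw [beta_eq]
  exact axial_vector_axis (S.axial_shift t ht) hp

/-- The time derivative of `logL`. -/
def rateL (t : ℝ) (p : E 2) : ℝ :=
  -2 * (S.lapse t (meridian p) * S.K t (meridian p) 1 1 * (profL (S.γ t) p)⁻¹)
    + (S.beta 0 t p * pd 0 (logL (S.γ t)) p + S.beta 1 t p * pd 1 (logL (S.γ t)) p)
    + 2 * (S.beta 0 t p / p 0)

/-- The time derivative of `logQ`. -/
def rateQ (t : ℝ) (p : E 2) : ℝ :=
  -2 * (S.lapse t (meridian p) * (S.K t (meridian p) 2 2
      + -2 * (profB (S.γ t) p * S.K t (meridian p) 1 2)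
      + profB (S.γ t) p * profB (S.γ t) p * S.K t (meridian p) 1 1) * (profQ (S.γ t) p)⁻¹)
    + (S.beta 0 t p * pd 0 (logQ (S.γ t)) p + S.beta 1 t p * pd 1 (logQ (S.γ t)) p)
    + 2 * pd 1 (S.beta 1 t) p

/-- In the Lie derivative along the shift, `∂_y` derivatives are replaced using axial symmetry. The
relation `∂_y N^y = N^ρ / ρ` produces the term `2 β^ρ / ρ` in `rateL`, and the rotational component
of the shift drops out. The `zz` component is used for `Q`, so only `∂_z β^z` appears in `rateQ`. -/
theorem hasDerivAt_logL_logQ {t : ℝ} (ht : t ∈ J) {p : E 2} (hp : 0 < p 0) :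
    HasDerivAt (fun s => logL (S.γ s) p) (S.rateL t p) t ∧
    HasDerivAt (fun s => logQ (S.γ s) p) (S.rateQ t p) t := by
  have h := S.isothermalSlice ht
  have hQ := (h.profQ_pos p).ne'
  have hL := (h.profL_pos p).ne'
  have hp0 : p 0 ≠ 0 := hp.ne'
  have hx : meridian p 0 ≠ 0 := by rw [meridian_zero]; exact hp0
  have e := fun i j => S.evolution_γ t ht (meridian p) i j
  obtain ⟨n0, n1, n2⟩ := axial_vector_eq (S.axial_shift t ht) p
  have n0' : pd 1 (fun y => S.shift t y 0) (meridian p) = -S.shift t (meridian p) 1 / p 0 := by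
    rw [← n0]; field_simp
  have n1' : pd 1 (fun y => S.shift t y 1) (meridian p) = S.shift t (meridian p) 0 / p 0 := by
    rw [← n1]; field_simp
  have n2' : pd 1 (fun y => S.shift t y 2) (meridian p) = 0 :=
    (mul_eq_zero.1 n2).resolve_left hp0
  have hD : ∀ k i j, pd k (fun y => S.γ t y i j) (meridian p)
      = tensorPd (S.γ t) k (meridian p) i j := fun _ _ _ => rfl
  have hD0 : tensorPd (S.γ t) 0 (meridian p) = _ := h.tensorPd_meridian hp 0
  have hD2 : tensorPd (S.γ t) 2 (meridian p) = _ := h.tensorPd_meridian hp 1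
  have hD1 : tensorPd (S.γ t) 1 (meridian p) = (p 0)⁻¹ • rotate (S.γ t (meridian p)) := by
    rw [← meridian_zero p]
    exact tensorPd_eq_jet1 h.axial hx (meridian_one p) 1
  have hG := h.eq_frameMetric hp
  have hb0 : S.beta 0 t p = S.shift t (meridian p) 0 := by rw [beta_eq]; rfl
  have hb1 : S.beta 1 t p = S.shift t (meridian p) 2 := by rw [beta_eq]; rfl
  have hb2 : pd 1 (S.beta 1 t) p = pd 2 (fun y => S.shift t y 2) (meridian p) := by
    rw [beta_eq]
    exact pd_comp_meridian ((S.contDiff_shift ht 2).differentiableAt_top _) 1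
  have e11 := e 1 1
  have e12 := e 1 2
  have e22 := e 2 2
  simp only [lieTensor, lieFun, Matrix.of_apply, Fin.sum_univ_three, n0', n1', n2', hD, hD0, hD1,
    hD2, hG] at e11 e12 e22
  simp [frameMetric, frameMetricD, rotate] at e11 e12 e22
  have g11 : S.γ t (meridian p) 1 1 = profL (S.γ t) p := rfl
  have g12 : S.γ t (meridian p) 1 2 = profL (S.γ t) p * profB (S.γ t) p := by
    rw [hG]; simp [frameMetric]
  have g11' : S.γ t (meridian p) 1 1 ≠ 0 := hL
  constructor
  · refine (e11.log g11').congr_deriv ?_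
    rw [rateL, h.pd_logL, h.pd_logL, hb0, hb1, g11]
    field_simp
    ring
  · have hq := (e22.sub ((e12.pow 2).div e11 g11'))
    refine (hq.log hQ).congr_deriv ?_
    rw [rateQ, h.pd_logQ, h.pd_logQ, hb0, hb1, hb2]
    change _ / profQ (S.γ t) p = _
    simp only [Pi.pow_apply, g11, g12]
    field_simp
    ring

end MaximalIsothermalEvolution

open Asymptotics

/-! ### Symbols -/

section Symbols

variable {n : ℕ} {C J : Set ℝ} {Ω : Set (E n)} {k l : ℝ} {f g : ℝ → E n → ℝ}

/-- The filter `r → ∞` on `Ω`, uniformly in the time `t ∈ C`. -/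
def infinityFilter (C : Set ℝ) (Ω : Set (E n)) : Filter (ℝ × E n) :=
  comap (fun q => ‖q.2‖) atTop ⊓ 𝓟 (C ×ˢ Ω)

theorem eventually_infinityFilter {P : ℝ × E n → Prop} :
    (∀ᶠ q in infinityFilter C Ω, P q) ↔ ∃ R, ∀ t ∈ C, ∀ x ∈ Ω, R ≤ ‖x‖ → P (t, x) := by
  rw [infinityFilter, eventually_inf_principal, eventually_comap, eventually_atTop]
  constructor
  · rintro ⟨R, hR⟩
    exact ⟨R, fun t ht x hx h => hR _ h (t, x) rfl ⟨ht, hx⟩⟩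
  · rintro ⟨R, hR⟩
    refine ⟨R, fun r hr q hq h => ?_⟩
    exact hR q.1 h.1 q.2 h.2 (hq ▸ hr)

theorem eventually_norm_ge (R : ℝ) : ∀ᶠ q in infinityFilter C Ω, R ≤ ‖q.2‖ :=
  eventually_infinityFilter.2 ⟨R, fun _ _ _ _ h => h⟩

theorem eventually_mem : ∀ᶠ q in infinityFilter C Ω, q.1 ∈ C ∧ q.2 ∈ Ω :=
  eventually_infinityFilter.2 ⟨0, fun _ ht _ hx _ => ⟨ht, hx⟩⟩

/-- The family `f t` is `O(r^k)` on `Ω`, and its gradient is `O(r^(k-1))`, uniformly in the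
time `t ∈ C`. -/
structure IsSymbol (C : Set ℝ) (Ω : Set (E n)) (k : ℝ) (f : ℝ → E n → ℝ) : Prop where
  diff : ∀ᶠ q in infinityFilter C Ω, DifferentiableAt ℝ (f q.1) q.2
  bound : (fun q : ℝ × E n => f q.1 q.2) =O[infinityFilter C Ω] fun q => ‖q.2‖ ^ k
  grad : (fun q : ℝ × E n => fderiv ℝ (f q.1) q.2) =O[infinityFilter C Ω] fun q => ‖q.2‖ ^ (k - 1)

theorem rpow_isBigO (h : k ≤ l) :
    (fun q : ℝ × E n => ‖q.2‖ ^ k) =O[infinityFilter C Ω] fun q => ‖q.2‖ ^ l := by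
  refine IsBigO.of_bound 1 ?_
  filter_upwards [eventually_norm_ge 1] with q hq
  rw [one_mul, Real.norm_of_nonneg (by positivity), Real.norm_of_nonneg (by positivity)]
  exact Real.rpow_le_rpow_of_exponent_le hq h

theorem rpow_mul_rpow_eventuallyEq (k l : ℝ) :
    (fun q : ℝ × E n => ‖q.2‖ ^ k * ‖q.2‖ ^ l) =ᶠ[infinityFilter C Ω]
      fun q => ‖q.2‖ ^ (k + l) := by
  filter_upwards [eventually_norm_ge 1] with q hq
  rw [Real.rpow_add (by linarith)]

namespace IsSymbol

theorem mono (hf : IsSymbol C Ω k f) (h : k ≤ l) : IsSymbol C Ω l f :=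
  ⟨hf.diff, hf.bound.trans (rpow_isBigO h), hf.grad.trans (rpow_isBigO (by linarith))⟩

theorem const (c : ℝ) : IsSymbol C Ω 0 fun _ _ => c where
  diff := Eventually.of_forall fun _ => differentiableAt_const c
  bound := by simpa using isBigO_const_const c (one_ne_zero (α := ℝ)) _
  grad := by simpa using isBigO_zero _ _

theorem add (hf : IsSymbol C Ω k f) (hg : IsSymbol C Ω k g) :
    IsSymbol C Ω k fun t x => f t x + g t x where
  diff := by
    filter_upwards [hf.diff, hg.diff] with q h1 h2 using h1.fun_add h2
  bound := hf.bound.add hg.bound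
  grad := by
    refine (hf.grad.add hg.grad).congr' ?_ EventuallyEq.rfl
    filter_upwards [hf.diff, hg.diff] with q h1 h2 using (fderiv_fun_add h1 h2).symm

theorem mul (hf : IsSymbol C Ω k f) (hg : IsSymbol C Ω l g) :
    IsSymbol C Ω (k + l) fun t x => f t x * g t x where
  diff := by
    filter_upwards [hf.diff, hg.diff] with q h1 h2 using h1.fun_mul h2
  bound := (hf.bound.mul hg.bound).trans_eventuallyEq (rpow_mul_rpow_eventuallyEq k l)
  grad := by
    have e1 : k + (l - 1) = k + l - 1 := by ring
    have e2 : l + (k - 1) = k + l - 1 := by ring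
    have h1 := (hf.bound.smul hg.grad).trans_eventuallyEq (rpow_mul_rpow_eventuallyEq k (l - 1))
    have h2 := (hg.bound.smul hf.grad).trans_eventuallyEq (rpow_mul_rpow_eventuallyEq l (k - 1))
    rw [e1] at h1
    rw [e2] at h2
    refine (h1.add h2).congr' ?_ EventuallyEq.rfl
    filter_upwards [hf.diff, hg.diff] with q h1 h2 using (fderiv_fun_mul h1 h2).symm

theorem const_mul (c : ℝ) (hf : IsSymbol C Ω k f) : IsSymbol C Ω k fun t x => c * f t x := by
  simpa using (const c).mul hf

theorem sub (hf : IsSymbol C Ω k f) (hg : IsSymbol C Ω k g) :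
    IsSymbol C Ω k fun t x => f t x - g t x := by
  simpa [sub_eq_add_neg] using hf.add (hg.const_mul (-1))

theorem inv (hf : IsSymbol C Ω 0 f) {c : ℝ} (hc : 0 < c)
    (h : ∀ᶠ q in infinityFilter C Ω, c ≤ f q.1 q.2) :
    IsSymbol C Ω 0 fun t x => (f t x)⁻¹ := by
  have hb : (fun q : ℝ × E n => (f q.1 q.2)⁻¹) =O[infinityFilter C Ω] fun q => ‖q.2‖ ^ (0 : ℝ) := by
    refine IsBigO.of_bound c⁻¹ ?_
    filter_upwards [h] with q hq
    have : 0 < f q.1 q.2 := hc.trans_le hq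
    rw [Real.rpow_zero, norm_one, mul_one, Real.norm_of_nonneg (by positivity)]
    exact inv_anti₀ hc hq
  have hd : ∀ᶠ q in infinityFilter C Ω, HasFDerivAt (fun x => (f q.1 x)⁻¹)
      ((-((f q.1 q.2)⁻¹ * (f q.1 q.2)⁻¹)) • fderiv ℝ (f q.1) q.2) q.2 := by
    filter_upwards [h, hf.diff] with q hq hdq
    have h0 : f q.1 q.2 ≠ 0 := (hc.trans_le hq).ne'
    have h1 := (hasDerivAt_inv h0).comp_hasFDerivAt q.2 hdq.hasFDerivAt
    have e : -(f q.1 q.2 ^ 2)⁻¹ = -((f q.1 q.2)⁻¹ * (f q.1 q.2)⁻¹) := by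
      rw [pow_two, mul_inv]
    rw [e] at h1
    exact h1
  refine ⟨hd.mono fun q hq => hq.differentiableAt, hb, ?_⟩
  have h2 := ((hb.mul hb).neg_left).smul hf.grad
  refine (h2.congr' ?_ EventuallyEq.rfl).trans ?_
  · filter_upwards [hd] with q hq using hq.fderiv.symm
  · simpa using isBigO_refl _ _

theorem comp_meridian {f : ℝ → E 3 → ℝ} {Ω : Set (E 2)} (hf : IsSymbol C Set.univ k f) :
    IsSymbol C Ω k fun t p => f t (meridian p) := by
  have ht : Tendsto (fun q : ℝ × E 2 => (q.1, meridian q.2)) (infinityFilter C Ω)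
      (infinityFilter C Set.univ) := by
    intro s hs
    obtain ⟨R, hR⟩ := eventually_infinityFilter.1 hs
    refine eventually_infinityFilter.2 ⟨R, fun t ht x _ hx => ?_⟩
    exact hR t ht _ trivial (by rwa [norm_meridian])
  have hd : ∀ᶠ q in infinityFilter C Ω, HasFDerivAt (fun p => f q.1 (meridian p))
      ((fderiv ℝ (f q.1) (meridian q.2)).comp meridianL.toContinuousLinearMap) q.2 := by
    filter_upwards [ht.eventually hf.diff] with q hq
    exact hq.hasFDerivAt.comp q.2 (hasFDerivAt_meridian q.2)
  refine ⟨hd.mono fun q hq => hq.differentiableAt, ?_, ?_⟩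
  · simpa [Function.comp_def, norm_meridian] using hf.bound.comp_tendsto ht
  · have h1 := hf.grad.comp_tendsto ht
    simp only [Function.comp_def, norm_meridian] at h1
    refine IsBigO.trans (IsBigO.of_bound 1 ?_) h1
    filter_upwards [hd] with q hq
    rw [hq.fderiv, one_mul]
    refine (ContinuousLinearMap.opNorm_comp_le _ _).trans ?_
    exact mul_le_of_le_one_right (norm_nonneg _) meridianL.norm_toContinuousLinearMap_le

end IsSymbol

theorem norm_fderiv_pd_le {f : E n → ℝ} (hf : ContDiff ℝ ∞ f) (i : Fin n) (x : E n) :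
    ‖fderiv ℝ (pd i f) x‖ ≤ ‖iteratedFDeriv ℝ 2 f x‖ := by
  have hd : Differentiable ℝ (fderiv ℝ f) :=
    (hf.fderiv_right (m := ∞) (by simp)).differentiable (by simp)
  have h2 : ‖iteratedFDeriv ℝ 2 f x‖ = ‖fderiv ℝ (fderiv ℝ f) x‖ := by
    rw [← norm_iteratedFDeriv_fderiv, ← norm_iteratedFDeriv_fderiv, norm_iteratedFDeriv_zero]
  rw [h2]
  refine ContinuousLinearMap.opNorm_le_bound _
    (norm_nonneg (fderiv ℝ (fderiv ℝ f) x)) fun v => ?_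
  have e : fderiv ℝ (pd i f) x v = fderiv ℝ (fderiv ℝ f) x v (EuclideanSpace.single i 1) := by
    unfold pd
    rw [fderiv_clm_apply (hd x) (differentiableAt_const _)]
    simp
  rw [e]
  refine ((fderiv ℝ (fderiv ℝ f) x v).le_opNorm _).trans ?_
  simpa using (fderiv ℝ (fderiv ℝ f) x).le_opNorm v

theorem abs_pd_le (f : E n → ℝ) (i : Fin n) (x : E n) : |pd i f x| ≤ ‖fderiv ℝ f x‖ := by
  simpa [pd] using (fderiv ℝ f x).le_opNorm (EuclideanSpace.single i 1)

/-- The bounds up to order two in `LittleOInfty`. -/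
theorem LittleOInfty.bounds (h : LittleOInfty J f k) (hC : IsCompact C) (hCJ : C ⊆ J)
    (hf : ∀ t ∈ J, ContDiff ℝ ∞ (f t)) {ε : ℝ} (hε : 0 < ε) :
    ∃ R, 0 < R ∧ ∀ t ∈ C, ∀ x, R ≤ ‖x‖ → |f t x| ≤ ε * ‖x‖ ^ k ∧
      ‖fderiv ℝ (f t) x‖ ≤ ε * ‖x‖ ^ (k - 1) ∧
      ∀ i, ‖fderiv ℝ (pd i (f t)) x‖ ≤ ε * ‖x‖ ^ (k - 2) := by
  obtain ⟨R0, hR0, h0⟩ := h 0 C hCJ hC ε hε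
  obtain ⟨R1, hR1, h1⟩ := h 1 C hCJ hC ε hε
  obtain ⟨R2, hR2, h2⟩ := h 2 C hCJ hC ε hε
  refine ⟨max R0 (max R1 R2), lt_max_of_lt_left hR0, fun t ht x hx => ⟨?_, ?_, fun i => ?_⟩⟩
  · simpa using h0 t ht x ((le_max_left _ _).trans hx)
  · have := h1 t ht x (((le_max_left _ _).trans (le_max_right _ _)).trans hx)
    rw [← norm_iteratedFDeriv_fderiv, norm_iteratedFDeriv_zero] at this
    simpa using this
  · refine (norm_fderiv_pd_le (hf t (hCJ ht)) i x).trans ?_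
    simpa using h2 t ht x (((le_max_right _ _).trans (le_max_right _ _)).trans hx)

theorem LittleOInfty.isSymbol (h : LittleOInfty J f k) (hC : IsCompact C) (hCJ : C ⊆ J)
    (hf : ∀ t ∈ J, ContDiff ℝ ∞ (f t)) : IsSymbol C Ω k f := by
  -- Only the `O` bound is needed from here on, so `ε = 1` is enough.
  obtain ⟨R, -, hR⟩ := h.bounds hC hCJ hf one_pos
  refine ⟨?_, IsBigO.of_bound 1 ?_, IsBigO.of_bound 1 ?_⟩
  · filter_upwards [eventually_mem] with q hq using (hf q.1 (hCJ hq.1)).differentiableAt_top _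
  · filter_upwards [eventually_mem, eventually_norm_ge R] with q hq hq2
    rw [Real.norm_of_nonneg (r := ‖q.2‖ ^ k) (by positivity)]
    exact (hR q.1 hq.1 q.2 hq2).1
  · filter_upwards [eventually_mem, eventually_norm_ge R] with q hq hq2
    rw [Real.norm_of_nonneg (r := ‖q.2‖ ^ (k - 1)) (by positivity)]
    exact (hR q.1 hq.1 q.2 hq2).2.1

theorem LittleOInfty.isSymbol_pd (h : LittleOInfty J f k) (hC : IsCompact C) (hCJ : C ⊆ J)
    (hf : ∀ t ∈ J, ContDiff ℝ ∞ (f t)) (i : Fin n) :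
    IsSymbol C Ω (k - 1) fun t => pd i (f t) := by
  obtain ⟨R, -, hR⟩ := h.bounds hC hCJ hf one_pos
  refine ⟨?_, IsBigO.of_bound 1 ?_, IsBigO.of_bound 1 ?_⟩
  · filter_upwards [eventually_mem] with q hq
      using ((hf q.1 (hCJ hq.1)).pd i).differentiableAt_top _
  · filter_upwards [eventually_mem, eventually_norm_ge R] with q hq hq2
    rw [Real.norm_of_nonneg (r := ‖q.2‖ ^ (k - 1)) (by positivity)]
    exact (abs_pd_le _ i _).trans (hR q.1 hq.1 q.2 hq2).2.1
  · filter_upwards [eventually_mem, eventually_norm_ge R] with q hq hq2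
    have e : k - 1 - 1 = k - 2 := by ring
    rw [e, Real.norm_of_nonneg (r := ‖q.2‖ ^ (k - 2)) (by positivity)]
    exact (hR q.1 hq.1 q.2 hq2).2.2 i

end Symbols

/-! ### Division by `ρ` of functions that vanish on the axis. -/

section AxisQuotient

theorem norm_fderiv_le_pd (f : E 2 → ℝ) (p : E 2) :
    ‖fderiv ℝ f p‖ ≤ |pd 0 f p| + |pd 1 f p| := by
  refine ContinuousLinearMap.opNorm_le_bound _ (by positivity) fun v => ?_
  have hv : v = v 0 • EuclideanSpace.single 0 1 + v 1 • EuclideanSpace.single 1 1 := by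
    ext i; fin_cases i <;> simp
  have e : fderiv ℝ f p v = v 0 * pd 0 f p + v 1 * pd 1 f p := by
    conv_lhs => rw [hv]
    simp [pd]
  have h0 : |v 0| ≤ ‖v‖ := PiLp.norm_apply_le v 0
  have h1 : |v 1| ≤ ‖v‖ := PiLp.norm_apply_le v 1
  rw [e, Real.norm_eq_abs]
  calc |v 0 * pd 0 f p + v 1 * pd 1 f p| ≤ |v 0| * |pd 0 f p| + |v 1| * |pd 1 f p| := by
        rw [← abs_mul, ← abs_mul]; exact abs_add_le _ _
    _ ≤ ‖v‖ * |pd 0 f p| + ‖v‖ * |pd 1 f p| := by gcongr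
    _ = (|pd 0 f p| + |pd 1 f p|) * ‖v‖ := by ring

theorem norm_le_abs_add_abs (p : E 2) : ‖p‖ ≤ |p 0| + |p 1| := by
  rw [EuclideanSpace.norm_eq, Fin.sum_univ_two]
  refine Real.sqrt_le_iff.2 ⟨by positivity, ?_⟩
  simp only [Real.norm_eq_abs]
  nlinarith [abs_nonneg (p 0), abs_nonneg (p 1)]

theorem hasDerivAt_planeEquiv_fst {h : E 2 → ℝ} (hd : Differentiable ℝ h) (s z : ℝ) :
    HasDerivAt (fun s => h (planeEquiv (s, z))) (pd 0 h (planeEquiv (s, z))) s := by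
  have h1 : HasDerivAt (fun s : ℝ => planeEquiv (s, z)) (planeEquiv (1, 0)) s :=
    planeEquiv.hasFDerivAt.comp_hasDerivAt s ((hasDerivAt_id s).prodMk (hasDerivAt_const s z))
  rw [planeEquiv_fst] at h1
  exact (hd _).hasFDerivAt.comp_hasDerivAt s h1

theorem planeEquiv_eta (p : E 2) : planeEquiv (p 0, p 1) = p := by
  ext i; fin_cases i <;> rfl

/-- A function vanishing on the axis is bounded by the distance to the axis. -/
theorem abs_le_mul_of_axis {h : E 2 → ℝ} (hd : Differentiable ℝ h)
    (h0 : ∀ p : E 2, p 0 = 0 → h p = 0) {p : E 2} (hp : 0 < p 0) {M : ℝ}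
    (hM : ∀ s ∈ Set.Icc 0 (p 0), |pd 0 h (planeEquiv (s, p 1))| ≤ M) : |h p| ≤ M * p 0 := by
  have h1 := (convex_Icc 0 (p 0)).norm_image_sub_le_of_norm_hasDerivWithin_le
    (fun s _ => (hasDerivAt_planeEquiv_fst hd s (p 1)).hasDerivWithinAt) hM
    (Set.left_mem_Icc.2 hp.le) (Set.right_mem_Icc.2 hp.le)
  rw [planeEquiv_eta, h0 (planeEquiv (0, p 1)) rfl, sub_zero, sub_zero] at h1
  simpa [abs_of_pos hp] using h1

theorem norm_planeEquiv_ge {p : E 2} (h : |p 0| ≤ |p 1|) (s : ℝ) :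
    ‖p‖ / 2 ≤ ‖planeEquiv (s, p 1)‖ := by
  have h1 : |p 1| ≤ ‖planeEquiv (s, p 1)‖ := PiLp.norm_apply_le (planeEquiv (s, p 1)) 1
  linarith [norm_le_abs_add_abs p]

variable {C J : Set ℝ} {k : ℝ} {f : ℝ → E 2 → ℝ}

theorem pd_div_coord {f : E 2 → ℝ} (hf : ContDiff ℝ ∞ f) {p : E 2} (hp : 0 < p 0) :
    pd 0 (fun p => f p / p 0) p = (p 0 * pd 0 f p - f p) / p 0 ^ 2 ∧
    pd 1 (fun p => f p / p 0) p = pd 1 f p / p 0 := by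
  have d0 := (contDiff_coord (n := 2) 0).differentiableAt_top p
  have df := hf.differentiableAt_top p
  have hp0 := hp.ne'
  constructor
  · rw [pd_div 0 df d0 hp0, pd_coord]
    simp; ring
  · rw [pd_div 1 df d0 hp0, pd_coord]
    simp; field_simp

/-- The quotient by `ρ` of a function of order `k` that vanishes on the axis has order `k - 1`. -/
theorem LittleOInfty.isSymbol_div_coord (h : LittleOInfty J f k) (hk : k ≤ 0) (hC : IsCompact C)
    (hCJ : C ⊆ J) (hf : ∀ t ∈ J, ContDiff ℝ ∞ (f t))
    (h0 : ∀ t ∈ J, ∀ p : E 2, p 0 = 0 → f t p = 0) :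
    IsSymbol C {p : E 2 | 0 < p 0} (k - 1) fun t p => f t p / p 0 := by
  obtain ⟨R, hR0, hR⟩ := h.bounds hC hCJ hf one_pos
  have antitone : ∀ {x y a : ℝ}, 0 < x → x ≤ y → a ≤ 0 → y ^ a ≤ x ^ a := fun hx hxy ha =>
    Real.rpow_le_rpow_of_nonpos hx hxy ha
  -- Beyond `2 * R`, points at distance at least `‖p‖ / 2` from the origin still lie where the
  -- bounds hold.
  have main : ∀ t ∈ C, ∀ p : E 2, 0 < p 0 → 2 * R ≤ ‖p‖ →
      |f t p / p 0| ≤ (‖p‖ / 2) ^ (k - 1) ∧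
      |pd 0 (fun p => f t p / p 0) p| ≤ 2 * (‖p‖ / 2) ^ (k - 2) ∧
      |pd 1 (fun p => f t p / p 0) p| ≤ (‖p‖ / 2) ^ (k - 2) := by
    intro t ht p hp hpR
    have hft := hf t (hCJ ht)
    have hax := h0 t (hCJ ht)
    have hD : 0 < ‖p‖ / 2 := by linarith
    have hDr : ‖p‖ / 2 ≤ ‖p‖ := by linarith
    rw [(pd_div_coord hft hp).1, (pd_div_coord hft hp).2]
    simp only [abs_div, abs_of_pos hp, abs_pow]
    set D := ‖p‖ / 2
    -- Away from the axis `ρ ≥ ‖p‖ / 2`, so dividing by `ρ` gains one order directly.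
    rcases le_total |p 1| |p 0| with hc | hc
    · have hρ : D ≤ p 0 := by
        have := norm_le_abs_add_abs p
        rw [abs_of_pos hp] at this hc
        simp only [D]; linarith
      obtain ⟨b0, b1, -⟩ := hR t ht p (by linarith)
      have c0 : |f t p| ≤ D ^ k := b0.trans (by rw [one_mul]; exact antitone hD hDr hk)
      have c1 : ∀ i, |pd i (f t) p| ≤ D ^ (k - 1) := fun i =>
        (abs_pd_le _ i p).trans (b1.trans (by rw [one_mul]; exact antitone hD hDr (by linarith)))
      have e1 : D ^ (k - 1) = D ^ k / D := Real.rpow_sub_one hD.ne' k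
      have e2 : D ^ (k - 2) = D ^ (k - 1) / D := by
        rw [← Real.rpow_sub_one hD.ne']; congr 1; ring
      have q : ∀ {x y : ℝ}, 0 ≤ x → x ≤ y → x / p 0 ≤ y / D := fun hx hxy =>
        div_le_div₀ (hx.trans hxy) hxy hD hρ
      refine ⟨?_, ?_, ?_⟩
      · rw [e1]; exact q (abs_nonneg _) c0
      · have t1 : |p 0 * pd 0 (f t) p - f t p| ≤ p 0 * |pd 0 (f t) p| + |f t p| := by
          refine (abs_sub _ _).trans ?_
          rw [abs_mul, abs_of_pos hp]
        have t2 : |pd 0 (f t) p| / p 0 ≤ D ^ (k - 2) := by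
          rw [e2]; exact q (abs_nonneg _) (c1 0)
        have t3 : |f t p| / p 0 / p 0 ≤ D ^ (k - 2) := by
          rw [e2]; exact q (by positivity) (by rw [e1]; exact q (abs_nonneg _) c0)
        calc |p 0 * pd 0 (f t) p - f t p| / p 0 ^ 2
            ≤ (p 0 * |pd 0 (f t) p| + |f t p|) / p 0 ^ 2 := by gcongr
          _ = |pd 0 (f t) p| / p 0 + |f t p| / p 0 / p 0 := by field_simp
          _ ≤ 2 * D ^ (k - 2) := by linarith
      · rw [e2]; exact q (abs_nonneg _) (c1 1)
    -- Near the axis, `|z| ≥ ‖p‖ / 2` keeps the whole horizontal segment to the axis far out, and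
    -- the gain comes from the mean value theorem along it.
    · have near : ∀ s, R ≤ ‖planeEquiv (s, p 1)‖ ∧ D ≤ ‖planeEquiv (s, p 1)‖ := fun s => by
        have := norm_planeEquiv_ge hc s
        exact ⟨by linarith, this⟩
      have c1 : ∀ s i, |pd i (f t) (planeEquiv (s, p 1))| ≤ D ^ (k - 1) := fun s i =>
        (abs_pd_le _ i _).trans ((hR t ht _ (near s).1).2.1.trans (by
          rw [one_mul]; exact antitone hD (near s).2 (by linarith)))
      have c2 : ∀ s i, |pd 0 (pd i (f t)) (planeEquiv (s, p 1))| ≤ D ^ (k - 2) := fun s i =>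
        (abs_pd_le _ 0 _).trans (((hR t ht _ (near s).1).2.2 i).trans (by
          rw [one_mul]; exact antitone hD (near s).2 (by linarith)))
      have hax1 : ∀ p : E 2, p 0 = 0 → pd 1 (f t) p = 0 := by
        intro p hp
        have e : (fun s => f t (planeEquiv (p 0, s))) = fun _ => 0 :=
          funext fun s => hax _ hp
        have h1 : HasDerivAt (fun s : ℝ => planeEquiv (p 0, s)) (planeEquiv (0, 1)) (p 1) :=
          planeEquiv.hasFDerivAt.comp_hasDerivAt (p 1)
            ((hasDerivAt_const (p 1) (p 0)).prodMk (hasDerivAt_id (p 1)))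
        have h2 := (hft.differentiableAt_top (planeEquiv (p 0, p 1))).hasFDerivAt.comp_hasDerivAt
          (p 1) h1
        rw [planeEquiv_snd, planeEquiv_eta] at h2
        change HasDerivAt (fun s => f t (planeEquiv (p 0, s))) (pd 1 (f t) p) (p 1) at h2
        rw [e] at h2
        exact h2.unique (hasDerivAt_const _ _)
      have d0 : ∀ q, DifferentiableAt ℝ (fun p : E 2 => p 0) q :=
        (contDiff_coord (n := 2) 0).differentiableAt_top
      have dp := fun q => (hft.pd 0).differentiableAt_top q
      refine ⟨?_, ?_, ?_⟩
      · rw [div_le_iff₀ hp]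
        exact abs_le_mul_of_axis (hft.differentiable (by simp)) hax hp fun s _ => c1 s 0
      -- The numerator `ρ ∂_ρ f - f` vanishes on the axis and its `ρ` derivative is `ρ ∂_ρ² f`, so
      -- it is bounded by `ρ²` times a second derivative; this cancels the denominator `ρ²`.
      · have hh := abs_le_mul_of_axis (h := fun q => q 0 * pd 0 (f t) q - f t q)
          (M := p 0 * D ^ (k - 2))
          (fun q => ((d0 q).fun_mul (dp q)).fun_sub (hft.differentiableAt_top q))
          (fun q hq => by simp [hq, hax q hq]) hp (fun s hs => by
            rw [pd_sub 0 ((d0 _).fun_mul (dp _)) (hft.differentiableAt_top _),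
              pd_mul 0 (d0 _) (dp _), pd_coord]
            simp only [if_true, one_mul, add_sub_cancel_left, abs_mul, planeEquiv_apply_zero,
              abs_of_nonneg hs.1]
            exact mul_le_mul hs.2 (c2 s 0) (abs_nonneg _) hp.le)
        rw [div_le_iff₀ (by positivity)]
        have : 0 ≤ D ^ (k - 2) := by positivity
        nlinarith
      · rw [div_le_iff₀ hp]
        exact abs_le_mul_of_axis ((hft.pd 1).differentiable (by simp)) hax1 hp fun s _ => c2 s 1
  have e : ∀ (p : E 2) (a : ℝ), (‖p‖ / 2) ^ a = (1 / 2) ^ a * ‖p‖ ^ a := fun p a => by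
    rw [← Real.mul_rpow (by norm_num) (norm_nonneg _)]
    congr 1; ring
  refine ⟨?_, IsBigO.of_bound ((1 / 2) ^ (k - 1)) ?_,
    IsBigO.of_bound (3 * (1 / 2) ^ (k - 2)) ?_⟩
  · filter_upwards [eventually_mem] with q hq
    exact ((hf q.1 (hCJ hq.1)).differentiableAt_top _).mul
      (((contDiff_coord (n := 2) 0).differentiableAt_top _).inv (ne_of_gt hq.2))
  · filter_upwards [eventually_mem, eventually_norm_ge (2 * R)] with q hq hq2
    rw [Real.norm_of_nonneg (r := ‖q.2‖ ^ (k - 1)) (by positivity), ← e]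
    exact (main q.1 hq.1 q.2 hq.2 hq2).1
  · filter_upwards [eventually_mem, eventually_norm_ge (2 * R)] with q hq hq2
    have e3 : k - 1 - 1 = k - 2 := by ring
    rw [e3, Real.norm_of_nonneg (r := ‖q.2‖ ^ (k - 2)) (by positivity), mul_assoc, ← e]
    have := main q.1 hq.1 q.2 hq.2 hq2
    refine (norm_fderiv_le_pd _ _).trans ?_
    linarith

end AxisQuotient

/-! ### Fall off of the time derivatives -/

section Symbols

variable {n : ℕ} {C : Set ℝ} {Ω : Set (E n)} {k l : ℝ} {f g : ℝ → E n → ℝ}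

theorem IsSymbol.congr (hf : IsSymbol C Ω k f) (h : ∀ t ∈ C, f t = g t) : IsSymbol C Ω k g := by
  have e : ∀ᶠ q in infinityFilter C Ω, f q.1 = g q.1 := by
    filter_upwards [eventually_mem] with q hq using h q.1 hq.1
  refine ⟨?_, hf.bound.congr' ?_ EventuallyEq.rfl, hf.grad.congr' ?_ EventuallyEq.rfl⟩
  · filter_upwards [hf.diff, e] with q h1 h2 using h2 ▸ h1
  · filter_upwards [e] with q h2 using by rw [h2]
  · filter_upwards [e] with q h2 using by rw [h2]

theorem IsSymbol.of_sub_const (hk : k ≤ 0) (c : ℝ) (hf : IsSymbol C Ω k fun t x => f t x - c) :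
    IsSymbol C Ω 0 f := by
  simpa using (hf.mono hk).add (const c)

theorem IsSymbol.tendsto_zero (hf : IsSymbol C Ω k f) (hk : k < 0) :
    Tendsto (fun q : ℝ × E n => f q.1 q.2) (infinityFilter C Ω) (nhds 0) := by
  refine hf.bound.trans_tendsto ?_
  have h : Tendsto (fun q : ℝ × E n => ‖q.2‖) (infinityFilter C Ω) atTop :=
    tendsto_comap.mono_left inf_le_left
  simpa [Function.comp_def] using (tendsto_rpow_neg_atTop (neg_pos.2 hk)).comp h

theorem IsSymbol.inv_of_sub_one (hk : k < 0) (hf : IsSymbol C Ω k fun t x => f t x - 1) :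
    IsSymbol C Ω 0 fun t x => (f t x)⁻¹ := by
  refine (hf.of_sub_const hk.le).inv (c := 1 / 2) (by norm_num) ?_
  filter_upwards [(hf.tendsto_zero hk).eventually (lt_mem_nhds (a := -(1 / 2)) (by norm_num))]
    with q hq
  linarith

end Symbols

/-- Written with `b = g_yz / g_yy`, every summand is a product of factors whose decay is known. -/
theorem IsothermalSlice.pd_profQ {g : E 3 → Mat 3} {u : E 2 → ℝ} (h : IsothermalSlice g u) (a : Fin
    2) (p : E 2) :
    pd a (profQ g) p = pd a (fun p => g (meridian p) 2 2) p
      + (-2 * (profB g p * pd a (fun p => g (meridian p) 1 2) p)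
        + profB g p * profB g p * pd a (fun p => g (meridian p) 1 1) p) := by
  have d := fun i j => (contDiff_comp_meridian (h.smooth i j)).differentiableAt_top p
  have hL : g (meridian p) 1 1 ≠ 0 := (h.profL_pos p).ne'
  have dL := h.contDiff_profL.differentiableAt_top p
  have d3 : DifferentiableAt ℝ (fun p => g (meridian p) 1 2 * g (meridian p) 1 2
      / g (meridian p) 1 1) p := ((d 1 2).fun_mul (d 1 2)).mul (dL.inv hL)
  unfold profQ profB
  simp only [pow_two]
  rw [pd_sub a (d 2 2) d3,
    pd_div a ((d 1 2).fun_mul (d 1 2)) (d 1 1) hL, pd_mul a (d 1 2) (d 1 2)]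
  field_simp
  ring

namespace MaximalIsothermalEvolution

variable {J C : Set ℝ} {Ω : Set (E 2)} (S : MaximalIsothermalEvolution J)

theorem isSymbol_metric_sub (hC : IsCompact C) (hCJ : C ⊆ J) (i j : Fin 3) :
    IsSymbol C Ω (-1 / 2) fun t p => S.γ t (meridian p) i j - if i = j then 1 else 0 :=
  ((S.falloff_γ i j).isSymbol hC hCJ fun _ ht =>
    ((S.isothermalSlice ht).smooth i j).sub contDiff_const).comp_meridian

theorem isSymbol_pd_metric (hC : IsCompact C) (hCJ : C ⊆ J) (a : Fin 2)
    (i j : Fin 3) :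
    IsSymbol C Ω (-3 / 2) fun t => pd a fun p => S.γ t (meridian p) i j := by
  have h := ((S.falloff_γ i j).isSymbol_pd (Ω := Set.univ) hC hCJ (fun _ ht =>
    ((S.isothermalSlice ht).smooth i j).sub contDiff_const) (embed a)).comp_meridian (Ω := Ω)
  refine (h.congr fun t ht => funext fun p => ?_).mono (by norm_num)
  have hd := ((S.isothermalSlice (hCJ ht)).smooth i j).differentiableAt_top (meridian p)
  rw [pd_comp_meridian hd, pd_sub _ hd (differentiableAt_const _), pd_const, sub_zero]

theorem isSymbol_inv_profL (hC : IsCompact C) (hCJ : C ⊆ J) :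
    IsSymbol C Ω 0 fun t p => (profL (S.γ t) p)⁻¹ :=
  IsSymbol.inv_of_sub_one (k := -1 / 2) (by norm_num) (S.isSymbol_metric_sub hC hCJ 1 1)

theorem isSymbol_profB (hC : IsCompact C) (hCJ : C ⊆ J) :
    IsSymbol C Ω (-1 / 2) fun t => profB (S.γ t) := by
  have h := (S.isSymbol_metric_sub (Ω := Ω) hC hCJ 1 2).mul (S.isSymbol_inv_profL hC hCJ)
  refine (h.congr fun t _ => funext fun p => ?_).mono (by norm_num)
  simp [profB, profL, div_eq_mul_inv]

/-- `Q - 1` is `g_zz - 1` minus a quadratic term in `g_yz`, so it decays and `Q` is bounded below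
far out. -/
theorem isSymbol_inv_profQ (hC : IsCompact C) (hCJ : C ⊆ J) :
    IsSymbol C Ω 0 fun t p => (profQ (S.γ t) p)⁻¹ := by
  have h12 := S.isSymbol_metric_sub (Ω := Ω) hC hCJ 1 2
  have h := (S.isSymbol_metric_sub (Ω := Ω) hC hCJ 2 2).sub
    (((h12.mul h12).mul (S.isSymbol_inv_profL hC hCJ)).mono (l := -1 / 2) (by norm_num))
  refine IsSymbol.inv_of_sub_one (k := -1 / 2) (by norm_num)
    (h.congr fun t _ => funext fun p => ?_)
  simp [profQ, profL, div_eq_mul_inv]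
  ring

theorem isSymbol_pd_logL (hC : IsCompact C) (hCJ : C ⊆ J) (a : Fin 2) :
    IsSymbol C Ω (-3 / 2) fun t => pd a (logL (S.γ t)) := by
  refine (((S.isSymbol_pd_metric (Ω := Ω) hC hCJ a 1 1).mul
    (S.isSymbol_inv_profL hC hCJ)).congr fun t ht => funext fun p => ?_).mono (by norm_num)
  rw [(S.isothermalSlice (hCJ ht)).pd_logL, div_eq_mul_inv]
  rfl

theorem isSymbol_pd_logQ (hC : IsCompact C) (hCJ : C ⊆ J) (a : Fin 2) :
    IsSymbol C Ω (-3 / 2) fun t => pd a (logQ (S.γ t)) := by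
  have hB := S.isSymbol_profB (Ω := Ω) hC hCJ
  have h1 := ((hB.mul (S.isSymbol_pd_metric hC hCJ a 1 2)).const_mul (-2)).mono (l := -3 / 2)
    (by norm_num)
  have h2 := ((hB.mul hB).mul (S.isSymbol_pd_metric hC hCJ a 1 1)).mono (l := -3 / 2)
    (by norm_num)
  refine ((((S.isSymbol_pd_metric hC hCJ a 2 2).add (h1.add h2)).mul
    (S.isSymbol_inv_profQ hC hCJ)).congr fun t ht => funext fun p => ?_).mono (by norm_num)
  have h := S.isothermalSlice (hCJ ht)
  rw [h.pd_logQ, div_eq_mul_inv, h.pd_profQ]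

theorem isSymbol_K (hC : IsCompact C) (hCJ : C ⊆ J) (i j : Fin 3) :
    IsSymbol C Ω (-3 / 2) fun t p => S.K t (meridian p) i j :=
  ((S.falloff_K i j).isSymbol hC hCJ fun _ ht => S.contDiff_K ht i j).comp_meridian

theorem isSymbol_lapse (hC : IsCompact C) (hCJ : C ⊆ J) :
    IsSymbol C Ω 0 fun t p => S.lapse t (meridian p) :=
  ((S.falloff_lapse.isSymbol hC hCJ fun _ ht =>
    (S.contDiff_lapse ht).sub contDiff_const).of_sub_const (by norm_num) 1).comp_meridian

theorem isSymbol_beta (hC : IsCompact C) (hCJ : C ⊆ J) (i : Fin 2) :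
    IsSymbol C Ω (-1 / 2) (S.beta i) :=
  (S.falloff_shift i).isSymbol hC hCJ fun _ ht => S.contDiff_beta ht i

theorem isSymbol_advection (hC : IsCompact C) (hCJ : C ⊆ J) {f : ℝ → E 2 → ℝ}
    (h : ∀ a, IsSymbol C Ω (-3 / 2) fun t => pd a (f t)) :
    IsSymbol C Ω (-3 / 2) fun t p =>
      S.beta 0 t p * pd 0 (f t) p + S.beta 1 t p * pd 1 (f t) p :=
  (((S.isSymbol_beta hC hCJ 0).mul (h 0)).add ((S.isSymbol_beta hC hCJ 1).mul (h 1))).mono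
    (by norm_num)

/-- The extrinsic curvature and `β^ρ / ρ` determine the order `-3/2`; advection is of the better
order `-2`. The division by `ρ` restricts the statement to the open half plane. -/
theorem isSymbol_rateL (hC : IsCompact C) (hCJ : C ⊆ J) :
    IsSymbol C {p : E 2 | 0 < p 0} (-3 / 2) S.rateL := by
  have h1 := ((((S.isSymbol_lapse hC hCJ).mul (S.isSymbol_K hC hCJ 1 1)).mul
    (S.isSymbol_inv_profL (Ω := {p : E 2 | 0 < p 0}) hC hCJ)).const_mul (-2)).mono
    (l := -3 / 2) (by norm_num)
  have h2 := S.isSymbol_advection (Ω := {p : E 2 | 0 < p 0}) hC hCJ (S.isSymbol_pd_logL hC hCJ)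
  have h3 := ((LittleOInfty.isSymbol_div_coord (S.falloff_shift 0) (by norm_num) hC hCJ
    (fun _ ht => S.contDiff_beta ht 0) fun _ ht _ hp => S.beta_zero_axis ht hp).const_mul 2).mono
    (l := -3 / 2) (by norm_num)
  exact (h1.add h2).add h3

theorem isSymbol_rateQ (hC : IsCompact C) (hCJ : C ⊆ J) :
    IsSymbol C {p : E 2 | 0 < p 0} (-3 / 2) S.rateQ := by
  have hB := S.isSymbol_profB (Ω := {p : E 2 | 0 < p 0}) hC hCJ
  have k1 := ((hB.mul (S.isSymbol_K hC hCJ 1 2)).const_mul (-2)).mono (l := -3 / 2) (by norm_num)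
  have k2 := ((hB.mul hB).mul (S.isSymbol_K hC hCJ 1 1)).mono (l := -3 / 2) (by norm_num)
  have h1 := ((((S.isSymbol_lapse hC hCJ).mul
    (((S.isSymbol_K hC hCJ 2 2).add k1).add k2)).mul
    (S.isSymbol_inv_profQ hC hCJ)).const_mul (-2)).mono (l := -3 / 2) (by norm_num)
  have h2 := S.isSymbol_advection (Ω := {p : E 2 | 0 < p 0}) hC hCJ (S.isSymbol_pd_logQ hC hCJ)
  have h3 := (((S.falloff_shift 1).isSymbol_pd (Ω := {p : E 2 | 0 < p 0}) hC hCJ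
    (fun _ ht => S.contDiff_beta ht 1) 1).const_mul 2).mono (l := -3 / 2) (by norm_num)
  exact (h1.add h2).add h3

end MaximalIsothermalEvolution

/-! ### Conservation of the mass -/

/-- Integration in time of a symbol on an open set: the change of a function whose time derivative
has order `k` is of order `k`, and its gradient of order `k - 1`. -/
theorem IsSymbol.integrate_time {n : ℕ} {s t k : ℝ} {Ω : Set (E n)} {Z f : ℝ → E n → ℝ}
    (hZ : IsSymbol (Set.uIcc s t) Ω k Z) (hΩ : IsOpen Ω) (hk : k ≤ 1)
    (hf : ∀ τ ∈ Set.uIcc s t, ∀ p ∈ Ω, HasDerivAt (fun τ => f τ p) (Z τ p) τ) :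
    ∃ A R : ℝ, 0 ≤ A ∧ ∀ p ∈ Ω, R ≤ ‖p‖ → |f t p - f s p| ≤ A * ‖p‖ ^ k ∧
      ‖fderiv ℝ (fun q => f t q - f s q) p‖ ≤ A * ‖p‖ ^ (k - 1) := by
  obtain ⟨c, hc, hb⟩ := hZ.bound.exists_nonneg
  obtain ⟨d, hd, hg⟩ := hZ.grad.exists_nonneg
  obtain ⟨R, hR⟩ := eventually_infinityFilter.1 (hZ.diff.and (hb.bound.and hg.bound))
  have mvt : ∀ {h h' : ℝ → ℝ} {M : ℝ}, (∀ τ ∈ Set.uIcc s t, HasDerivAt h (h' τ) τ) →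
      (∀ τ ∈ Set.uIcc s t, |h' τ| ≤ M) → |h t - h s| ≤ M * |t - s| := fun h1 h2 =>
    (convex_uIcc s t).norm_image_sub_le_of_norm_hasDerivWithin_le
      (fun τ hτ => (h1 τ hτ).hasDerivWithinAt) h2 Set.left_mem_uIcc Set.right_mem_uIcc
  -- The factor `(1 / 2) ^ (k - 1)` comes from evaluating a power with nonpositive exponent at
  -- radius `‖p‖ / 2`, and `2 * R` keeps that radius beyond `R`.
  refine ⟨c * |t - s| + d * (1 / 2) ^ (k - 1) * |t - s|, max 1 (2 * R), by positivity,
    fun p hp hpR => ⟨?_, ?_⟩⟩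
  · have h1 := mvt (fun τ hτ => hf τ hτ p hp) (M := c * ‖p‖ ^ k) fun τ hτ => by
      have := (hR τ hτ p hp (by
        have := (le_max_left 1 (2 * R)).trans hpR
        have := (le_max_right 1 (2 * R)).trans hpR
        linarith)).2.1
      simpa [Real.norm_of_nonneg (Real.rpow_nonneg (norm_nonneg p) k)] using this
    have h2 : 0 ≤ d * (1 / 2) ^ (k - 1) * |t - s| * ‖p‖ ^ k := by positivity
    linarith
  · have hp1 : 1 ≤ ‖p‖ := (le_max_left 1 (2 * R)).trans hpR
    have hp2 : 2 * R ≤ ‖p‖ := (le_max_right 1 (2 * R)).trans hpR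
    have e : (‖p‖ / 2) ^ (k - 1) = (1 / 2) ^ (k - 1) * ‖p‖ ^ (k - 1) := by
      rw [← Real.mul_rpow (by norm_num) (norm_nonneg _)]
      congr 1; ring
    -- No derivative is exchanged with the time integral: `Z τ` is Lipschitz on a small ball around
    -- `p`, and the mean value theorem in time carries this over to the increment of `f τ q - f τ
    -- p`.
    have hlip : ‖fderiv ℝ (fun q => f t q - f s q) p‖
        ≤ d * (‖p‖ / 2) ^ (k - 1) * |t - s| := by
      refine norm_fderiv_le_of_lip' ℝ (by positivity) ?_
      obtain ⟨δ, hδ, hball⟩ := Metric.isOpen_iff.1 hΩ p hp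
      filter_upwards [Metric.ball_mem_nhds p (lt_min hδ (by linarith : 0 < ‖p‖ / 2))] with q hq
      have hmem : ∀ x ∈ Metric.ball p (min δ (‖p‖ / 2)), x ∈ Ω ∧ ‖p‖ / 2 ≤ ‖x‖ := by
        intro x hx
        rw [Metric.mem_ball, lt_min_iff] at hx
        refine ⟨hball hx.1, ?_⟩
        have h1 := norm_sub_norm_le p x
        have h2 := hx.2
        rw [dist_comm, dist_eq_norm] at h2
        linarith
      have hself : p ∈ Metric.ball p (min δ (‖p‖ / 2)) :=
        Metric.mem_ball_self (lt_min hδ (by linarith))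
      have hZlip : ∀ τ ∈ Set.uIcc s t, |Z τ q - Z τ p| ≤ d * (‖p‖ / 2) ^ (k - 1) * ‖q - p‖ := by
        intro τ hτ
        have hx := fun x hx => hR τ hτ x (hmem x hx).1 (by linarith [(hmem x hx).2])
        refine (convex_ball p (min δ (‖p‖ / 2))).norm_image_sub_le_of_norm_fderiv_le (𝕜 := ℝ)
          (f := Z τ) (fun x hxm => (hx x hxm).1) (fun x hxm => ?_) hself hq
        have h2 := (hx x hxm).2.2
        rw [Real.norm_of_nonneg (r := ‖(τ, x).2‖ ^ (k - 1)) (by positivity)] at h2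
        exact h2.trans (mul_le_mul_of_nonneg_left
          (Real.rpow_le_rpow_of_nonpos (by linarith) (hmem x hxm).2 (by linarith)) hd)
      have h1 := mvt (h := fun τ => f τ q - f τ p)
        (fun τ hτ => (hf τ hτ q (hmem q hq).1).sub (hf τ hτ p hp)) hZlip
      rw [Real.norm_eq_abs]
      calc _ = |f t q - f t p - (f s q - f s p)| := by congr 1; ring
        _ ≤ _ := h1
        _ = _ := by ring
    rw [e] at hlip
    have h2 : 0 ≤ c * |t - s| * ‖p‖ ^ (k - 1) := by positivity
    linarith

/-- The three remaining sides have lengths `n`, `n` and `2 n`, and all their points are at distance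
at least `n` from the origin. -/
theorem abs_boundaryFlux_sub_le {F G F' G' : E 2 → ℝ} (hF : Continuous F) (hG : Continuous G)
    (hF' : Continuous F') (hG' : Continuous G') {n B : ℝ} (hn : 0 < n)
    (h : ∀ p : E 2, 0 < p 0 → n ≤ ‖p‖ → |F p - F' p| ≤ B ∧ |G p - G' p| ≤ B) :
    |boundaryFlux F G n - boundaryFlux F' G' n| ≤ 4 * (B * n) := by
  have hi : ∀ {H : E 2 → ℝ} (_ : Continuous H) (a b y : ℝ),
      IntervalIntegrable (fun x => H (planeEquiv (x, y))) MeasureTheory.volume a b :=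
    fun hH a b y => (hH.comp (planeEquiv.continuous.comp (by fun_prop))).intervalIntegrable a b
  have hj : ∀ {H : E 2 → ℝ} (_ : Continuous H) (a b x : ℝ),
      IntervalIntegrable (fun y => H (planeEquiv (x, y))) MeasureTheory.volume a b :=
    fun hH a b x => (hH.comp (planeEquiv.continuous.comp (by fun_prop))).intervalIntegrable a b
  have top : ∀ y : ℝ, |y| = n → |(∫ x in (0 : ℝ)..n, G (planeEquiv (x, y)))
      - ∫ x in (0 : ℝ)..n, G' (planeEquiv (x, y))| ≤ B * n := by
    intro y hy
    rw [← intervalIntegral.integral_sub (hi hG _ _ _) (hi hG' _ _ _)]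
    have := intervalIntegral.norm_integral_le_of_norm_le_const (a := 0) (b := n) (C := B)
      (f := fun x => G (planeEquiv (x, y)) - G' (planeEquiv (x, y))) fun x hx => by
        rw [Set.uIoc_of_le hn.le] at hx
        exact (h _ hx.1 (hy ▸ PiLp.norm_apply_le (planeEquiv (x, y)) 1)).2
    simpa [abs_of_pos hn] using this
  have side : |(∫ y in (-n)..n, F (planeEquiv (n, y)))
      - ∫ y in (-n)..n, F' (planeEquiv (n, y))| ≤ 2 * (B * n) := by
    rw [← intervalIntegral.integral_sub (hj hF _ _ _) (hj hF' _ _ _)]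
    have := intervalIntegral.norm_integral_le_of_norm_le_const (a := -n) (b := n) (C := B)
      (f := fun y => F (planeEquiv (n, y)) - F' (planeEquiv (n, y))) fun y _ =>
        (h _ hn ((le_abs_self n).trans (PiLp.norm_apply_le (planeEquiv (n, y)) 0))).1
    rw [sub_neg_eq_add, abs_of_pos (by linarith : 0 < n + n)] at this
    refine this.trans (by linarith)
  have h1 := abs_le.1 (top n (abs_of_pos hn))
  have h2 := abs_le.1 (top (-n) (by rw [abs_neg, abs_of_pos hn]))
  have h3 := abs_le.1 side
  rw [boundaryFlux, boundaryFlux, abs_le]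
  constructor <;> linarith [h1.1, h1.2, h2.1, h2.2, h3.1, h3.2]

/-- The change of the mass flux is bounded by the changes of `logL` and `logQ`. -/
theorem abs_flux_sub_le {g g' : E 3 → Mat 3} {u u' : E 2 → ℝ} (h : IsothermalSlice g u)
    (h' : IsothermalSlice g' u') {p : E 2} {a b : ℝ}
    (hL : |logL g p - logL g' p| ≤ a) (hQ : |logQ g p - logQ g' p| ≤ a)
    (hL' : ‖fderiv ℝ (fun q => logL g q - logL g' q) p‖ ≤ b)
    (hQ' : ‖fderiv ℝ (fun q => logQ g q - logQ g' q) p‖ ≤ b) :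
    |fluxRho g p - fluxRho g' p| ≤ 4 * (a + ‖p‖ * b) ∧
    |fluxZ g p - fluxZ g' p| ≤ 4 * (a + ‖p‖ * b) := by
  have ha : 0 ≤ a := (abs_nonneg _).trans hL
  have dL : ∀ i, |pd i (logL g) p - pd i (logL g') p| ≤ b := fun i => by
    rw [← pd_sub i (h.contDiff_logL.differentiableAt_top p)
      (h'.contDiff_logL.differentiableAt_top p)]
    exact (abs_pd_le _ i p).trans hL'
  have dQ : ∀ i, |pd i (logQ g) p - pd i (logQ g') p| ≤ b := fun i => by
    rw [← pd_sub i (h.contDiff_logQ.differentiableAt_top p)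
      (h'.contDiff_logQ.differentiableAt_top p)]
    exact (abs_pd_le _ i p).trans hQ'
  have key : ∀ i, |p 0 * (pd i (logSum g) p - pd i (logSum g') p)| ≤ ‖p‖ * (2 * b) := fun i => by
    rw [abs_mul, h.pd_logSum, h'.pd_logSum]
    refine mul_le_mul (PiLp.norm_apply_le p 0) ?_ (abs_nonneg _) (norm_nonneg _)
    have e1 := abs_le.1 (dL i)
    have e2 := abs_le.1 (dQ i)
    rw [abs_le]
    constructor <;> linarith [e1.1, e1.2, e2.1, e2.2]
  have e1 := abs_le.1 (key 0)
  have e2 := abs_le.1 (key 1)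
  have e3 := abs_le.1 hL
  have e4 := abs_le.1 hQ
  rw [mul_sub] at e1 e2
  -- The gradient of `logSum` contributes `2 * (‖p‖ * (2 * b))` and the undifferentiated logarithms
  -- `2 * (a + a)`.
  rw [fluxRho, fluxRho, fluxZ, fluxZ, abs_le, abs_le]
  refine ⟨⟨?_, ?_⟩, ?_, ?_⟩ <;>
    linarith [e1.1, e1.2, e2.1, e2.2, e3.1, e3.2, e4.1, e4.2]

theorem MaximalIsothermalEvolution.mass_eq {J : Set ℝ} (hJ : J.OrdConnected)
    (S : MaximalIsothermalEvolution J) {s t : ℝ} (hs : s ∈ J) (ht : t ∈ J) :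
    S.mass s = S.mass t := by
  -- The interval property of `J` supplies a compact time segment, on which the decay is uniform.
  have hCJ : Set.uIcc t s ⊆ J := hJ.uIcc_subset ht hs
  have hΩ : IsOpen {p : E 2 | 0 < p 0} :=
    isOpen_lt continuous_const (EuclideanSpace.proj (0 : Fin 2) : E 2 →L[ℝ] ℝ).continuous
  obtain ⟨A, R, hA, hL⟩ := (S.isSymbol_rateL isCompact_uIcc hCJ).integrate_time hΩ (by norm_num)
    fun τ hτ p hp => (S.hasDerivAt_logL_logQ (hCJ hτ) hp).1
  obtain ⟨A', R', hA', hQ⟩ := (S.isSymbol_rateQ isCompact_uIcc hCJ).integrate_time hΩ (by norm_num)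
    fun τ hτ p hp => (S.hasDerivAt_logL_logQ (hCJ hτ) hp).2
  have h1 := S.isothermalSlice hs
  have h2 := S.isothermalSlice ht
  refine S.mass_eq_of_tendsto hs ht (squeeze_zero' (Eventually.of_forall fun n => abs_nonneg _)
    -- With `a` and `‖p‖ * b` both at most `(A + A') n^{-3/2}`, the flux densities differ by at most
    -- `8 (A + A') n^{-3/2}`; the boundary has length `4 n`.
    (g := fun n : ℕ => 32 * (A + A') * (n : ℝ) ^ (-(1 / 2) : ℝ)) ?_ ?_)
  · have hlarge := tendsto_natCast_atTop_atTop.eventually (eventually_ge_atTop (max 1 (max R R')))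
    filter_upwards [hlarge] with n hn
    have hn0 : (0 : ℝ) < n := zero_lt_one.trans_le ((le_max_left _ _).trans hn)
    have hR : R ≤ n := ((le_max_left _ _).trans (le_max_right _ _)).trans hn
    have hR' : R' ≤ n := ((le_max_right _ _).trans (le_max_right _ _)).trans hn
    have hb := abs_boundaryFlux_sub_le h1.contDiff_fluxRho.continuous h1.contDiff_fluxZ.continuous
      h2.contDiff_fluxRho.continuous h2.contDiff_fluxZ.continuous hn0
      (B := 8 * ((A + A') * (n : ℝ) ^ (-3 / 2 : ℝ))) fun p hp hpn => by
        have hp0 : 0 < ‖p‖ := hn0.trans_le hpn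
        have le1 : ∀ {x e : ℝ}, x ≤ A * ‖p‖ ^ e → x ≤ (A + A') * ‖p‖ ^ e := fun {x e} hx =>
          hx.trans (by gcongr; linarith)
        have le2 : ∀ {x e : ℝ}, x ≤ A' * ‖p‖ ^ e → x ≤ (A + A') * ‖p‖ ^ e := fun {x e} hx =>
          hx.trans (by gcongr; linarith)
        obtain ⟨l1, l2⟩ := hL p hp (hR.trans hpn)
        obtain ⟨q1, q2⟩ := hQ p hp (hR'.trans hpn)
        have hfl := abs_flux_sub_le h1 h2 (le1 l1) (le2 q1) (le1 l2) (le2 q2)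
        have e : ‖p‖ * ((A + A') * ‖p‖ ^ (-3 / 2 - 1 : ℝ)) = (A + A') * ‖p‖ ^ (-3 / 2 : ℝ) := by
          rw [Real.rpow_sub_one hp0.ne']; field_simp
        have hmono : ‖p‖ ^ (-3 / 2 : ℝ) ≤ (n : ℝ) ^ (-3 / 2 : ℝ) :=
          Real.rpow_le_rpow_of_nonpos hn0 hpn (by norm_num)
        have hm : (A + A') * ‖p‖ ^ (-3 / 2 : ℝ) ≤ (A + A') * (n : ℝ) ^ (-3 / 2 : ℝ) := by gcongr
        rw [e] at hfl
        exact ⟨hfl.1.trans (by linarith), hfl.2.trans (by linarith)⟩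
    refine hb.trans (le_of_eq ?_)
    have e : (n : ℝ) ^ (-(1 / 2) : ℝ) = (n : ℝ) ^ (-3 / 2 : ℝ) * n := by
      rw [← Real.rpow_add_one hn0.ne']; norm_num
    rw [e]; ring
  · have h := ((tendsto_rpow_neg_atTop (by norm_num : (0 : ℝ) < 1 / 2)).comp
      (tendsto_natCast_atTop_atTop (R := ℝ))).const_mul (32 * (A + A'))
    rw [mul_zero] at h
    exact h

end AxiMass

end

theorem theorem3 {J : Set ℝ} (hJ : IsOpen J) (hJ' : J.OrdConnected)
    (S : AxiMass.MaximalIsothermalEvolution J) :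
    (∀ s ∈ J, ∀ t ∈ J, S.mass s = S.mass t) ∧
    (∀ t ∈ J, S.mass t ≠ ⊤ → HasDerivAt (fun τ => (S.mass τ).toReal) 0 t) := by
  refine ⟨fun s hs t ht => S.mass_eq hJ' hs ht, fun t ht _ => ?_⟩
  refine (hasDerivAt_const t (S.mass t).toReal).congr_of_eventuallyEq ?_
  -- `J` is a neighbourhood of `t`, so the mass is constant near `t`.
  filter_upwards [hJ.mem_nhds ht] with τ hτ
  rw [S.mass_eq hJ' hτ ht]
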